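/- Let $m,s\ge 1$ and $n\ge 0$ be integers and let $\mathcal H=\{X_1,\dots,X_m\}$, $X_j=f_j\cdot\nabla$, be vector fields on $\mathbb R^n$ of class $C^1$. Write $e^{tX}x$ for the flow, $X^\sharp g(x)=\lim_{t\to0}(g(e^{tX}x)-g(x))/t$ for the Lie derivative, and let $d(x,y)$ be the infimum of all $r>0$ such that $y=e^{t_1Z_1}\cdots e^{t_\mu Z_\mu}x$ for some $\mu\in\mathbb N$, $Z_j\in\{rX_1,\dots,rX_m\}$ and $\sum|t_j|\le1$ ($d=\infty$ if there is none). Assume that all derivatives $X^\sharp_{j_1}\cdots X^\sharp_{j_p}f_k$ with $p\le s-1$ exist and are $d$-continuous, and that those with $p=s-1$ are $d$-Lipschitz on Euclidean-bounded sets. For a word $w=w_1\cdots w_\ell$ in $\{1,\dots,m\}$ of length $|w|=\ell\ge1$ let $\pi_\ell$ be the coefficients in $[A_{w_1},[A_{w_2},\dots,[A_{w_{\ell-1}},A_{w_\ell}]\dots]]=\sum_{\sigma}\pi_\ell(\sigma)A_{\sigma_1(w)}\cdots A_{\sigma_\ell(w)}$ (an identity for arbitrary linear operators), and for $\ell\le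 s$ put $$f_w=\sum_\sigma\pi_\ell(\sigma)X^\sharp_{\sigma_1(w)}\cdots X^\sharp_{\sigma_{\ell-1}(w)}f_{\sigma_\ell(w)},\qquad X_w\psi=f_w\cdot\nabla\psi .$$ For $Z=g\cdot\nabla\in\pm\mathcal H$ let $\mathrm{ad}_ZX_w=(Z^\sharp f_w-f_w\cdot\nabla g)\cdot\nabla$. Say that $\mathcal H$ is involutive on $\Omega$ with constant $C_0>1$ if for all $Z\in\pm\mathcal H$, $|w|=s$, $x\in\Omega$ and a.e. $t\in[-C_0^{-1},C_0^{-1}]$ for which $e^{tZ}x$ exists, $\mathrm{ad}_ZX_w=\sum_{1\le|u|\le s}b^uX_u$ at $e^{tZ}x$ for some real numbers $b^u$ with $|b^u|\le C_0$. Define $$C_t(X_{w_1})=e^{tX_{w_1}},\qquad C_t(X_{w_1},\dots,X_{w_\ell})=C_t(X_{w_2},\dots,X_{w_\ell})^{-1}e^{-tX_{w_1}}C_t(X_{w_2},\dots,X_{w_\ell})e^{tX_{w_1}},$$ and $\exp_{\rm ap}(tX_w)=C_{t^{1/\ell}}(X_{w_1},\dots,X_{w_\ell})$ if $t\ge0$,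 $\exp_{\rm ap}(tX_w)=C_{|t|^{1/\ell}}(X_{w_1},\dots,X_{w_\ell})^{-1}$ if $t<0$. Let $Y_1,\dots,Y_q$ be an enumeration of the commutators $X_w$, $1\le|w|\le s$. Assume that $\mathcal H$ is of class $\mathcal A_s$: in addition to the above, $\mathcal H$ is involutive on each bounded open set with some constant, and for all $1\le|w|\le s$, $1\le p\le n$, $i_1<\dots<i_p$ and $x\in\mathbb R^n$ the map $h\mapsto f_w\big(\exp_{\rm ap}(h_1Y_{i_1})\cdots\exp_{\rm ap}(h_pY_{i_p})x\big)$ is continuous on the set of $h\in\mathbb R^p$ where it is defined. Let $\Omega_0\subset\mathbb R^n$ be open and bounded, $\overline\Omega\subset\Omega_0$, let $\mathcal H$ be involutive on $\Omega_0$ with constant $C_0$, and suppose that $$L_0=\sum_{j_1,\dots,j_s=1}^m\Big\{\sup_{\Omega_0}\Big(|f_{j_1}|+|\nabla f_{j_1}|+\sum_{p\le s}|X^\sharp_{j_1}\cdots X^\sharp_{j_{p-1}}f_{j_p}|\Big)+\mathrm{Lip}_d\big(X^\sharp_{j_1}\cdots X^\sharp_{j_{s-1}}f_{j_s};\Omega_0\big)\Big\}<\infty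 .$$ There is an integer $N_0$ depending only on $n,m,s$ such that the following holds. Let $t_0>0$ be so small that $e^{\tau_1Z_1}\cdots e^{\tau_NZ_N}x$ exists and lies in $\Omega_0$ whenever $x\in\Omega$, $N\le N_0$, $Z_j\in\mathcal H$ and $|\tau_j|\le t_0$. **Theorem.** Let $1\le|w|=\ell\le s$ and $C_t=C_t(X_{w_1},\dots,X_{w_\ell})$. Then for all $\psi\in C^1(\mathbb R^n)$, $x\in\Omega$ and $t\in[0,t_0]$ (with one-sided derivatives at the end points) $$\frac{d}{dt}\psi(C_tx)=\ell t^{\ell-1}X_w\psi(C_tx)+\sum_{|v|=\ell+1}^sa_vt^{|v|-1}X_v\psi(C_tx)+t^s\sum_{|u|=1}^sb_u(x,t)X_u\psi(C_tx),$$ $$\frac{d}{dt}\psi(C_t^{-1}x)=-\ell t^{\ell-1}X_w\psi(C_t^{-1}x)+\sum_{|v|=\ell+1}^s\overline a_vt^{|v|-1}X_v\psi(C_t^{-1}x)+t^s\sum_{|u|=1}^s\overline b_u(x,t)X_u\psi(C_t^{-1}x).$$ Here $a_v,\overline a_v$ are real numbers which depend only on $m$, $s$, $w$ and $v$ (not on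 the vector fields, nor on $n,x,t,\psi$). The sums over $v$ are empty if $\ell=s$; if $\ell<s$, then $\sum_{|v|=\ell+1}(a_v+\overline a_v)f_v(x)=0$ for all $x\in\Omega$. The real coefficients $b_u(x,t),\overline b_u(x,t)$ do not depend on $\psi$, and their absolute values are bounded by a constant which depends only on $n,m,s$, on upper bounds for $L_0$ and $t_0$, and on $C_0$. -/

import Mathlib

open Set Filter Topology MeasureTheory
open scoped ENNReal

noncomputable section

namespace HorizontalFields

/-! ### Words in the alphabet `Fin m` -/

/-- The finite set of the words `v` in the alphabet `Fin m` with `k ≤ |v| ≤ l`. -/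
def words (m k l : ℕ) : Finset (List (Fin m)) :=
  (Finset.Icc k l).biUnion fun i =>
    (Finset.univ : Finset (Fin i → Fin m)).image List.ofFn

theorem mem_words {m k l : ℕ} {v : List (Fin m)} :
    v ∈ words m k l ↔ k ≤ v.length ∧ v.length ≤ l := by
  simp only [words, Finset.mem_biUnion, Finset.mem_Icc, Finset.mem_image, Finset.mem_univ,
    true_and]
  constructor
  · rintro ⟨i, hi, g, rfl⟩
    simpa using hi
  · intro h
    exact ⟨v.length, h, v.get, List.ofFn_get v⟩

/-- The formal expansion of the right-nested commutator
`[A_{w_1}, [A_{w_2}, … [A_{w_{ℓ-1}}, A_{w_ℓ}]…]]` as a list of signed rearrangements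
of the word `w`. -/
def expansion {m : ℕ} : List (Fin m) → List (ℤ × List (Fin m))
  | [] => []
  | [a] => [(1, [a])]
  | a :: b :: v =>
      ((expansion (b :: v)).map fun p => (p.1, a :: p.2)) ++
        ((expansion (b :: v)).map fun p => (-p.1, p.2 ++ [a]))

/-- The right-nested commutator of elements of a ring. -/
def nestedBracket {m : ℕ} {R : Type*} [Ring R] (A : Fin m → R) : List (Fin m) → R
  | [] => 0
  | [a] => A a
  | a :: b :: v => A a * nestedBracket A (b :: v) - nestedBracket A (b :: v) * A a

/-- `expansion` gives the coefficients of the nested commutator, for any operators `A_j`. -/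
theorem nestedBracket_eq_expansion {m : ℕ} {R : Type*} [Ring R] (A : Fin m → R)
    (w : List (Fin m)) :
    nestedBracket A w = ((expansion w).map fun p => p.1 • (p.2.map A).prod).sum := by
  induction w with
  | nil => simp [nestedBracket, expansion]
  | cons a w ih =>
    cases w with
    | nil => simp [nestedBracket, expansion]
    | cons b v =>
      have h₁ : ((expansion (b :: v)).map fun p => p.1 • ((a :: p.2).map A).prod).sum =
          A a * ((expansion (b :: v)).map fun p => p.1 • (p.2.map A).prod).sum := by
        induction expansion (b :: v) with
        | nil => simp
        | cons p L h =>
          rw [List.map_cons, List.sum_cons, h]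
          simp only [List.map_cons, List.sum_cons, List.prod_cons, mul_add, mul_smul_comm]
      have h₂ : ((expansion (b :: v)).map fun p => -p.1 • ((p.2 ++ [a]).map A).prod).sum =
          -(((expansion (b :: v)).map fun p => p.1 • (p.2.map A).prod).sum * A a) := by
        induction expansion (b :: v) with
        | nil => simp
        | cons p L h =>
          rw [List.map_cons, List.sum_cons, h]
          simp only [List.map_cons, List.sum_cons, add_mul, neg_add, List.map_append,
            List.map_nil, List.prod_append, List.prod_cons, List.prod_nil, mul_one, neg_smul,
            smul_mul_assoc]
      rw [nestedBracket, ih, expansion, List.map_append, List.sum_append, List.map_map,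
        List.map_map, sub_eq_add_neg]
      exact congrArg₂ (· + ·) h₁.symm h₂.symm

/-! ### Flows, compositions of flows and the distance -/

section Flows

variable {E : Type*} [NormedAddCommGroup E] [NormedSpace ℝ E]

/-- `y = e^{tZ} x`: some integral curve of `Z`, defined between the times `0` and `t`, leads from
`x` to `y`. -/
def FlowTo (Z : E → E) (t : ℝ) (x y : E) : Prop :=
  ∃ γ : ℝ → E, γ 0 = x ∧ γ t = y ∧ IsIntegralCurveOn γ (fun _ => Z) (uIcc 0 t)

/-- The point `e^{tZ} x` exists. -/
def FlowDefined (Z : E → E) (t : ℝ) (x : E) : Prop :=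
  ∃ y, FlowTo Z t x y

open Classical in
/-- The point `e^{tZ} x` (with the junk value `x` if the integral curve from `x` does not exist up
to the time `t`). -/
def flow (Z : E → E) (t : ℝ) (x : E) : E :=
  if h : FlowDefined Z t x then h.choose else x

/-- The composition `e^{t_N Z_{j_N}} ⋯ e^{t_1 Z_{j_1}} x`, where the list is
`[(j_1, t_1), …, (j_N, t_N)]`: the head of the list acts first. -/
def run {m : ℕ} (Z : Fin m → E → E) : List (Fin m × ℝ) → E → E
  | [], x => x
  | p :: L, x => run Z L (flow (Z p.1) p.2 x)

/-- All the flows in the composition `run Z L x` are defined. -/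
def RunDefined {m : ℕ} (Z : Fin m → E → E) : List (Fin m × ℝ) → E → Prop
  | [], _ => True
  | p :: L, x => FlowDefined (Z p.1) p.2 x ∧ RunDefined Z L (flow (Z p.1) p.2 x)

theorem run_append {m : ℕ} (Z : Fin m → E → E) (L L' : List (Fin m × ℝ)) (x : E) :
    run Z (L ++ L') x = run Z L' (run Z L x) := by
  induction L generalizing x with
  | nil => rfl
  | cons p L ih => exact ih _

/-- The Franchi–Lanconelli distance: the infimum of the `r > 0` such that
`y = e^{t_1 Z_1} ⋯ e^{t_μ Z_μ} x` with `Z_j ∈ rℋ` and `∑ |t_j| ≤ 1`. It is `∞` if there is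
no such `r`. -/
def hdist {m : ℕ} (f : Fin m → E → E) (x y : E) : ℝ≥0∞ :=
  ⨅ (r : ℝ) (_ : 0 < r ∧ ∃ L : List (Fin m × ℝ), (L.map fun p => |p.2|).sum ≤ 1 ∧
      RunDefined (fun j => r • f j) L x ∧ run (fun j => r • f j) L x = y),
    ENNReal.ofReal r

/-! ### Horizontal regularity -/

variable {F : Type*} [NormedAddCommGroup F] [NormedSpace ℝ F]

/-- `g(y) → g(x)` as `d(y, x) → 0`, for all `x`. -/
def DContinuous {m : ℕ} (f : Fin m → E → E) (g : E → F) : Prop :=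
  ∀ x : E, ∀ ε : ℝ, 0 < ε → ∃ δ : ℝ, 0 < δ ∧
    ∀ y : E, hdist f y x < ENNReal.ofReal δ → ‖g y - g x‖ < ε

/-- The Lipschitz constant of `g` on `A` with respect to the distance `d`. -/
def dLip {m : ℕ} (f : Fin m → E → E) (g : E → F) (A : Set E) : ℝ≥0∞ :=
  ⨆ (x ∈ A) (y ∈ A) (_ : x ≠ y), ‖g x - g y‖ₑ / hdist f x y

/-- The Lie derivative `Z^♯ g(x) = lim_{t → 0} (g(e^{tZ} x) - g(x)) / t`. -/
def lieDeriv (Z : E → E) (g : E → F) (x : E) : F :=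
  deriv (fun t => g (flow Z t x)) 0

/-- The limit which defines `Z^♯ g(x)` exists. -/
def LieDifferentiableAt (Z : E → E) (g : E → F) (x : E) : Prop :=
  DifferentiableAt ℝ (fun t => g (flow Z t x)) 0

/-- `X_{v_1}^♯ ⋯ X_{v_p}^♯ g`. -/
def iterLie {m : ℕ} (f : Fin m → E → E) : List (Fin m) → (E → F) → E → F
  | [], g => g
  | j :: v, g => lieDeriv (f j) (iterLie f v g)

/-- The class `C^k_ℋ`: the derivatives `X_{v_1}^♯ ⋯ X_{v_p}^♯ g` with `p ≤ k` exist and are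
`d`-continuous. -/
def HContDiff {m : ℕ} (f : Fin m → E → E) (k : ℕ) (g : E → F) : Prop :=
  (∀ v : List (Fin m), v.length < k →
    ∀ (j : Fin m) (x : E), LieDifferentiableAt (f j) (iterLie f v g) x) ∧
  ∀ v : List (Fin m), v.length ≤ k → DContinuous f (iterLie f v g)

/-- The class `C^{k,1}_{ℋ,loc}`: moreover, the derivatives of order `k` are `d`-Lipschitz on bounded
sets. -/
def HContDiffLip {m : ℕ} (f : Fin m → E → E) (k : ℕ) (g : E → F) : Prop :=
  HContDiff f k g ∧ ∀ v : List (Fin m), v.length = k →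
    ∀ A : Set E, Bornology.IsBounded A → dLip f (iterLie f v g) A < ∞

/-! ### Commutators -/

/-- `X_{v_1}^♯ ⋯ X_{v_{p-1}}^♯ f_{v_p}`. -/
def coeff {m : ℕ} (f : Fin m → E → E) : List (Fin m) → E → E
  | [] => 0
  | [j] => f j
  | j :: k :: v => lieDeriv (f j) (coeff f (k :: v))

/-- The vector `f_w` of the coefficients of the nested commutator `X_w = f_w · ∇`. -/
def commVec {m : ℕ} (f : Fin m → E → E) (w : List (Fin m)) (x : E) : E :=
  ((expansion w).map fun p => p.1 • coeff f p.2 x).sum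

/-- `X_w ψ = f_w · ∇ψ`. -/
def commDeriv {m : ℕ} (f : Fin m → E → E) (w : List (Fin m)) (ψ : E → ℝ) (x : E) : ℝ :=
  fderiv ℝ ψ x (commVec f w x)

/-- The vector of the coefficients `Z^♯ f_w - f_w · ∇Z` of `ad_Z X_w`. -/
def adComm {m : ℕ} (f : Fin m → E → E) (Z : E → E) (w : List (Fin m)) (x : E) : E :=
  lieDeriv Z (commVec f w) x - fderiv ℝ Z x (commVec f w x)

/-! ### Approximate exponentials -/

/-- The inverse of a composition of flows. -/
def invSteps {m : ℕ} (L : List (Fin m × ℝ)) : List (Fin m × ℝ) :=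
  (L.map fun p => (p.1, -p.2)).reverse

/-- The flows which make up `C_t(X_{w_1}, …, X_{w_ℓ})`, the first to act coming first. -/
def cSteps {m : ℕ} : List (Fin m) → ℝ → List (Fin m × ℝ)
  | [], _ => []
  | [a], t => [(a, t)]
  | a :: b :: v, t =>
      [(a, t)] ++ cSteps (b :: v) t ++ [(a, -t)] ++ invSteps (cSteps (b :: v) t)

/-- `C_t(X_{w_1}, …, X_{w_ℓ}) x`. -/
def cMap {m : ℕ} (f : Fin m → E → E) (w : List (Fin m)) (t : ℝ) (x : E) : E :=
  run f (cSteps w t) x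

/-- `C_t(X_{w_1}, …, X_{w_ℓ})⁻¹ x`. -/
def cMapInv {m : ℕ} (f : Fin m → E → E) (w : List (Fin m)) (t : ℝ) (x : E) : E :=
  run f (invSteps (cSteps w t)) x

theorem cMap_singleton {m : ℕ} (f : Fin m → E → E) (a : Fin m) (t : ℝ) (x : E) :
    cMap f [a] t x = flow (f a) t x := rfl

theorem cMap_cons {m : ℕ} (f : Fin m → E → E) (a b : Fin m) (v : List (Fin m)) (t : ℝ) (x : E) :
    cMap f (a :: b :: v) t x =
      cMapInv f (b :: v) t (flow (f a) (-t) (cMap f (b :: v) t (flow (f a) t x))) := by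
  simp [cMap, cMapInv, cSteps, run_append, run]

/-- The flows which make up `exp_ap(t X_w)`. -/
def apSteps {m : ℕ} (w : List (Fin m)) (t : ℝ) : List (Fin m × ℝ) :=
  if 0 ≤ t then cSteps w (t ^ (1 / (w.length : ℝ)))
  else invSteps (cSteps w (|t| ^ (1 / (w.length : ℝ))))

/-- The flows which make up `exp_ap(h_1 X_{v_1}) ⋯ exp_ap(h_p X_{v_p})`; the last factor acts
first. -/
def eSteps {m p : ℕ} (v : Fin p → List (Fin m)) (h : Fin p → ℝ) : List (Fin m × ℝ) :=
  (List.ofFn fun k => apSteps (v k) (h k)).reverse.flatten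

/-! ### The class `𝒜_s` -/

/-- The involutivity condition on the set `Ω` with the constant `C₀`. -/
def Involutive {m : ℕ} (f : Fin m → E → E) (s : ℕ) (Ω : Set E) (C₀ : ℝ) : Prop :=
  ∀ Z : E → E, (∃ j, Z = f j ∨ Z = -f j) → ∀ w : List (Fin m), w.length = s →
    ∀ x ∈ Ω, ∀ᵐ t ∂(volume.restrict (Icc (-C₀⁻¹) C₀⁻¹)), FlowDefined Z t x →
      ∃ b : List (Fin m) → ℝ,
        adComm f Z w (flow Z t x) = ∑ u ∈ words m 1 s, b u • commVec f u (flow Z t x) ∧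
        ∀ u ∈ words m 1 s, |b u| ≤ C₀

end Flows

/-- The family `ℋ = {X_1, …, X_m}`, `X_j = f_j · ∇`, of vector fields on `ℝⁿ` is of class `𝒜_s`.
Here `Y` is the enumeration `Y_1, …, Y_q` of the commutators of length at most `s`. -/
structure ClassA {n m q : ℕ} (s : ℕ)
    (f : Fin m → EuclideanSpace ℝ (Fin n) → EuclideanSpace ℝ (Fin n))
    (Y : Fin q ≃ {w : List (Fin m) // w ∈ words m 1 s}) : Prop where
  contDiff : ∀ j, ContDiff ℝ 1 (f j)
  horizontal : ∀ j, HContDiffLip f (s - 1) (f j)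
  involutive : ∀ Ω : Set (EuclideanSpace ℝ (Fin n)), IsOpen Ω → Bornology.IsBounded Ω →
    ∃ C₀ : ℝ, 1 < C₀ ∧ Involutive f s Ω C₀
  continuous_comp : ∀ w ∈ words m 1 s, ∀ p : ℕ, 1 ≤ p → p ≤ n → ∀ I : Fin p ↪o Fin q,
    ∀ (x : EuclideanSpace ℝ (Fin n)) (h₀ : Fin p → ℝ),
      RunDefined f (eSteps (fun k => (Y (I k)).1) h₀) x →
      Tendsto (fun h => commVec f w (run f (eSteps (fun k => (Y (I k)).1) h) x))
        (𝓝[{h | RunDefined f (eSteps (fun k => (Y (I k)).1) h) x}] h₀)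
        (𝓝 (commVec f w (run f (eSteps (fun k => (Y (I k)).1) h₀) x)))

/-- The constant `L₀` of the family on the set `Ω₀`:
`∑_{j_1,…,j_s} { sup_{Ω₀} ( |f_{j_1}| + |∇f_{j_1}| + ∑_{p ≤ s} |X_{j_1}^♯ ⋯ X_{j_{p-1}}^♯ f_{j_p}| )
+ Lip_ℋ(X_{j_1}^♯ ⋯ X_{j_{s-1}}^♯ f_{j_s}; Ω₀) }`. -/
def lipConst {E : Type*} [NormedAddCommGroup E] [NormedSpace ℝ E] {m : ℕ} (f : Fin m → E → E)
    (s : ℕ) [NeZero s] (Ω₀ : Set E) : ℝ≥0∞ :=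
  ∑ J : Fin s → Fin m,
    ((⨆ x ∈ Ω₀, (‖f (J 0) x‖ₑ + ‖fderiv ℝ (f (J 0)) x‖ₑ +
        ∑ p ∈ Finset.Icc 1 s, ‖coeff f ((List.ofFn J).take p) x‖ₑ)) +
      dLip f (coeff f (List.ofFn J)) Ω₀)

end HorizontalFields

end

open HorizontalFields

/-! Both $C_t$ and its inverse are compositions of flows $e^{\pm tX_j}$. Following such a
composition by $e^{ctX_j}$ turns its velocity $D$ into $cf_j+de^{ctX_j}(D)$. Since
$\mathrm{ad}_{X_j}X_v=X_{jv}$ for short words, the differential acts on commutators by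
$f_v\mapsto\sum_i\frac{(-ct)^i}{i!}f_{j^iv}$. On words this is left multiplication by $\exp(-cta_j)$
in the free algebra. Hence the velocity is represented, up to an error of order $t^s$, by a
universal power series $V$ (`velSeries`), whose coefficients are the numbers $a_v$, $\overline a_v$.

A word stands for its nested bracket. The linear map `nest`, from words to brackets, turns left
multiplication by $a$ into $\mathrm{ad}\,a$, so it turns left multiplication by an exponential into
a conjugation. It follows that `nest` sends $V$ to $P^{-1}P'$, where $P$ is the product of the
exponentials (`nest_velSeries`). For $C_t$ one has $P=1+t^\ell([w]+\dots)$. So all terms of $V$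
below degree $\ell-1$ cancel as commutators, and the first remaining one is $\ell t^{\ell-1}[w]$;
for the inverse the sign changes. The sum of the two logarithmic derivatives is the commutator of
$P^{-1}$ and $P'$. It has order at least $2\ell-1$, and it vanishes for $\ell=1$; therefore
$\sum_{|v|=\ell+1}(a_v+\overline a_v)f_v=0$.

Two points need analysis. First, $\mathrm{ad}_{X_j}X_w=X_{jw}$ requires $X_w^\sharp
f_j=f_w\cdot\nabla f_j$ for fields which are only $C^1$. This comes from the horizontal Taylor
formula along $C_t$, applied to $f_j$ and to the identity map, by comparison of the terms in
$t^\ell$ (`fderiv_commVec`). Secondly, commutators of length $s$ are only Lipschitz along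
trajectories. Involutivity bounds their derivatives almost everywhere, and Gronwall's inequality,
applied to the transported commutators tested with a fixed functional $\xi$, closes the expansion
(`jet_transport`).

The resulting error $R$ satisfies $|\xi(R)|\le Ct^s\sum_u|\xi(f_u)|$ for every $\xi$, with $f_u$
taken at the final point. By the Hahn–Banach theorem this says that $R=t^s\sum_ub_uf_u$ with
$|b_u|\le C$ (`exists_sum_eq_of_forall_dual`). -/

noncomputable section

namespace HorizontalFields

/-! ### Power series over a noncommutative algebra -/

section PowerSeries

open PowerSeries (X C constantCoeff coeff_mk coeff_one coeff_C coeff_mul coeff_C_mul coeff_mul_C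
  coeff_zero_eq_constantCoeff_apply)
open scoped PowerSeries

variable {R : Type*} [Ring R] [Algebra ℝ R]

/-- The exponential series `∑ (c^i / i!) a^i X^i`. -/
def pexp (c : ℝ) (a : R) : R⟦X⟧ := PowerSeries.mk fun i => (c ^ i / (i.factorial : ℝ)) • a ^ i

/-- The formal derivative of a power series with noncommuting coefficients. -/
def pderiv (F : R⟦X⟧) : R⟦X⟧ := PowerSeries.mk fun n => ((n : ℝ) + 1) • PowerSeries.coeff (n + 1) F

theorem coeff_pexp (c : ℝ) (a : R) (i : ℕ) :
    PowerSeries.coeff i (pexp c a) = (c ^ i / (i.factorial : ℝ)) • a ^ i := coeff_mk _ _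

theorem coeff_pderiv (F : R⟦X⟧) (n : ℕ) : PowerSeries.coeff n (pderiv F) = ((n : ℝ) + 1) • PowerSeries.coeff (n + 1) F :=
  coeff_mk _ _

theorem pderiv_add (F G : R⟦X⟧) : pderiv (F + G) = pderiv F + pderiv G := by
  ext n; simp [coeff_pderiv]

theorem pderiv_neg (F : R⟦X⟧) : pderiv (-F) = -pderiv F := by
  ext n; simp [coeff_pderiv]

theorem pderiv_one : pderiv (1 : R⟦X⟧) = 0 := by
  ext n; simp [coeff_pderiv, coeff_one]

theorem pderiv_C (x : R) : pderiv (C x : R⟦X⟧) = 0 := by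
  ext n; simp [coeff_pderiv]

theorem pderiv_mul (F G : R⟦X⟧) : pderiv (F * G) = pderiv F * G + F * pderiv G := by
  ext n
  have h₁ : ∑ p ∈ Finset.HasAntidiagonal.antidiagonal (n + 1), (p.1 : ℝ) • (PowerSeries.coeff p.1 F * PowerSeries.coeff p.2 G) =
      PowerSeries.coeff n (pderiv F * G) := by
    rw [Finset.Nat.sum_antidiagonal_succ, coeff_mul]
    simp [coeff_pderiv]
  have h₂ : ∑ p ∈ Finset.HasAntidiagonal.antidiagonal (n + 1), (p.2 : ℝ) • (PowerSeries.coeff p.1 F * PowerSeries.coeff p.2 G) =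
      PowerSeries.coeff n (F * pderiv G) := by
    rw [Finset.Nat.sum_antidiagonal_succ', coeff_mul]
    simp [coeff_pderiv]
  rw [map_add, ← h₁, ← h₂, ← Finset.sum_add_distrib, coeff_pderiv, coeff_mul, Finset.smul_sum]
  refine Finset.sum_congr rfl fun p hp => ?_
  rw [← add_smul]
  congr 1
  rw [Finset.HasAntidiagonal.mem_antidiagonal] at hp
  exact_mod_cast hp.symm

/-- The scalars have characteristic zero, so the factors $n+1$ can be cancelled. This replaces
uniqueness for differential equations. -/
theorem eq_zero_of_pderiv_eq_zero {F : R⟦X⟧} (h₀ : constantCoeff F = 0) (h : pderiv F = 0) :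
    F = 0 := by
  ext n
  cases n with
  | zero => simpa using h₀
  | succ n =>
    have := congrArg (PowerSeries.coeff n) h
    rw [coeff_pderiv, map_zero, smul_eq_zero] at this
    rcases this with h | h
    · exact absurd h (by positivity)
    · simpa using h

theorem constantCoeff_pexp (c : ℝ) (a : R) : constantCoeff (pexp c a) = 1 := by
  rw [← coeff_zero_eq_constantCoeff_apply, coeff_pexp]; simp

theorem pderiv_pexp (c : ℝ) (a : R) : pderiv (pexp c a) = C (c • a) * pexp c a := by
  ext n
  rw [coeff_pderiv, coeff_C_mul, coeff_pexp, coeff_pexp, smul_smul, smul_mul_smul_comm, ← pow_succ']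
  congr 1
  rw [Nat.factorial_succ]
  push_cast
  field_simp
  ring

theorem C_mul_pexp (c : ℝ) (a : R) : C (c • a) * pexp c a = pexp c a * C (c • a) := by
  ext n
  rw [coeff_C_mul, coeff_mul_C, coeff_pexp, smul_mul_smul_comm, smul_mul_smul_comm, ← pow_succ',
    ← pow_succ, mul_comm]

theorem C_mul_pexp_neg (c : ℝ) (a : R) : C (c • a) * pexp (-c) a = pexp (-c) a * C (c • a) := by
  have := C_mul_pexp (-c) a
  rwa [neg_smul, map_neg, neg_mul, mul_neg, neg_inj] at this

theorem pexp_mul_pexp_neg (c : ℝ) (a : R) : pexp c a * pexp (-c) a = 1 := by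
  rw [← sub_eq_zero]
  apply eq_zero_of_pderiv_eq_zero
  · simp [constantCoeff_pexp]
  · rw [sub_eq_add_neg, pderiv_add, pderiv_neg, pderiv_one, pderiv_mul, pderiv_pexp, pderiv_pexp,
      C_mul_pexp, neg_smul, map_neg, neg_mul, mul_neg, mul_assoc]
    simp

theorem pexp_neg_mul_pexp (c : ℝ) (a : R) : pexp (-c) a * pexp c a = 1 := by
  simpa using pexp_mul_pexp_neg (-c) a

/-- Hadamard's formula $e^{-ca}xe^{ca}=e^{-c\,\mathrm{ad}\,a}x$. The conjugated series solves
$F'=-[ca,F]$, which is a recursion for its coefficients. -/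
theorem pexp_neg_mul_C_mul_pexp (c : ℝ) (a x : R) (n : ℕ) :
    PowerSeries.coeff n (pexp (-c) a * C x * pexp c a) =
      ((-c) ^ n / (n.factorial : ℝ)) • (fun y => a * y - y * a)^[n] x := by
  have hd : pderiv (pexp (-c) a * C x * pexp c a) =
      -(C (c • a) * (pexp (-c) a * C x * pexp c a)) +
        (pexp (-c) a * C x * pexp c a) * C (c • a) := by
    rw [pderiv_mul, pderiv_mul, pderiv_C, pderiv_pexp, pderiv_pexp, C_mul_pexp c a, neg_smul,
      map_neg]
    noncomm_ring
  induction n with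
  | zero =>
    simp [constantCoeff_pexp]
  | succ n ih =>
    have h := congrArg (PowerSeries.coeff n) hd
    rw [coeff_pderiv, map_add, map_neg, coeff_C_mul, coeff_mul_C, ih] at h
    have hn : ((n : ℝ) + 1) ≠ 0 := by positivity
    rw [Function.iterate_succ_apply', Nat.factorial_succ]
    refine smul_right_injective R hn ?_
    simp only
    rw [h, smul_smul]
    push_cast
    have e : ((n : ℝ) + 1) * ((-c) ^ (n + 1) / (((n : ℝ) + 1) * (n.factorial : ℝ))) =
      -(c * ((-c) ^ n / (n.factorial : ℝ))) := by field_simp; ring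
    rw [e, smul_mul_smul_comm, smul_mul_smul_comm]
    module

/-- The map on power series which applies a map to all coefficients. -/
def mapCoeff {R : Type*} [Ring R] (φ : R → R) (F : R⟦X⟧) : R⟦X⟧ :=
  PowerSeries.mk fun n => φ (PowerSeries.coeff n F)

theorem coeff_mapCoeff {R : Type*} [Ring R] (φ : R → R) (F : R⟦X⟧) (n : ℕ) :
    PowerSeries.coeff n (mapCoeff φ F) = φ (PowerSeries.coeff n F) := coeff_mk _ _

/-- A linear map which intertwines the left multiplication by `a` with `ad a` on a submodule `M`
intertwines the multiplication by `exp (-c a X)` with a conjugation. -/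
theorem mapCoeff_pexp_mul (θ : R →ₗ[ℝ] R) (M : Submodule ℝ R) (a : R)
    (hM : ∀ x ∈ M, a * x ∈ M) (hθ : ∀ x ∈ M, θ (a * x) = a * θ x - θ x * a) (c : ℝ) (S : R⟦X⟧)
    (hS : ∀ n, PowerSeries.coeff n S ∈ M) :
    mapCoeff θ (pexp (-c) a * S) = pexp (-c) a * mapCoeff θ S * pexp c a := by
  have hpow : ∀ x ∈ M, ∀ n : ℕ, a ^ n * x ∈ M ∧
      θ (a ^ n * x) = (fun y => a * y - y * a)^[n] (θ x) := by
    intro x hx n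
    induction n with
    | zero => simpa using hx
    | succ n ih =>
      rw [pow_succ', mul_assoc, Function.iterate_succ_apply', ← ih.2]
      exact ⟨hM _ ih.1, hθ _ ih.1⟩
  ext n
  induction n generalizing S with
  | zero =>
    rw [coeff_mapCoeff]
    simp [coeff_mul, coeff_mapCoeff, coeff_pexp]
  | succ n ih =>
    -- Induction on the degree: the constant term of $S$ is handled by Hadamard's formula, and the
    -- rest is $X$ times a series to which the induction hypothesis applies.
    set S' : R⟦X⟧ := PowerSeries.mk fun p => PowerSeries.coeff (p + 1) S with hS'
    have hd : S = X * S' + C (constantCoeff S) := PowerSeries.eq_X_mul_shift_add_const S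
    have hm : mapCoeff θ S = X * mapCoeff θ S' + C (θ (constantCoeff S)) := by
      ext k
      cases k with
      | zero => simp [coeff_mapCoeff]
      | succ k =>
        rw [coeff_mapCoeff, map_add, PowerSeries.coeff_succ_X_mul, coeff_mapCoeff, coeff_C,
          if_neg (by simp), add_zero, hS', coeff_mk]
    have h0 : constantCoeff S ∈ M := by
      simpa using hS 0
    rw [hm, mul_add, add_mul, map_add, pexp_neg_mul_C_mul_pexp, ← (hpow _ h0 _).2,
      ← mul_assoc, ← PowerSeries.X_mul, mul_assoc, mul_assoc, PowerSeries.coeff_succ_X_mul,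
      ← mul_assoc, ← ih S' (fun k => by rw [hS', coeff_mk]; exact hS _), coeff_mapCoeff,
      coeff_mapCoeff]
    conv_lhs => rw [hd]
    rw [mul_add, map_add, map_add, coeff_mul_C, coeff_pexp, ← mul_assoc, ← PowerSeries.X_mul,
      mul_assoc, PowerSeries.coeff_succ_X_mul, smul_mul_assoc, map_smul]

end PowerSeries

/-! ### Words in the free algebra -/

section FreeAlg

variable {m : ℕ}

/-- The generators of the free algebra. -/
abbrev gen (j : Fin m) : FreeAlgebra ℝ (Fin m) := FreeAlgebra.ι ℝ j

/-- The monomial of a word. -/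
def monom (v : List (Fin m)) : FreeAlgebra ℝ (Fin m) := (v.map gen).prod

theorem monom_nil : monom ([] : List (Fin m)) = 1 := rfl

theorem monom_cons (j : Fin m) (v : List (Fin m)) : monom (j :: v) = gen j * monom v := by
  simp [monom]

theorem monom_append (u v : List (Fin m)) : monom (u ++ v) = monom u * monom v := by
  simp [monom]

theorem monom_replicate (n : ℕ) (j : Fin m) : monom (List.replicate n j) = gen j ^ n := by
  simp [monom]

theorem basisFreeMonoid_eq_monom (v : List (Fin m)) :
    FreeAlgebra.basisFreeMonoid ℝ (Fin m) (FreeMonoid.ofList v) = monom v := by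
  simp [FreeAlgebra.basisFreeMonoid, monom, FreeAlgebra.equivMonoidAlgebraFreeMonoid]

theorem span_monom : Submodule.span ℝ (Set.range (monom (m := m))) = ⊤ := by
  rw [← (FreeAlgebra.basisFreeMonoid ℝ (Fin m)).span_eq]
  congr 1
  ext x
  constructor
  · rintro ⟨v, rfl⟩
    exact ⟨FreeMonoid.ofList v, basisFreeMonoid_eq_monom v⟩
  · rintro ⟨v, rfl⟩
    exact ⟨FreeMonoid.toList v, (basisFreeMonoid_eq_monom _).symm⟩

variable {V : Type*} [AddCommGroup V] [Module ℝ V]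

/-- The linear map on the free algebra with the value `h v` at the monomial of the word `v`. -/
def pair (h : List (Fin m) → V) : FreeAlgebra ℝ (Fin m) →ₗ[ℝ] V :=
  (FreeAlgebra.basisFreeMonoid ℝ (Fin m)).constr ℝ fun v => h (FreeMonoid.toList v)

theorem pair_monom (h : List (Fin m) → V) (v : List (Fin m)) : pair h (monom v) = h v := by
  rw [pair, ← basisFreeMonoid_eq_monom, Module.Basis.constr_basis]
  rfl

theorem linearMap_ext_monom {φ φ' : FreeAlgebra ℝ (Fin m) →ₗ[ℝ] V}
    (h : ∀ v, φ (monom v) = φ' (monom v)) : φ = φ' :=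
  LinearMap.ext_on_range span_monom h

/-- The elements of degree `k` of the free algebra. -/
def homog (m k : ℕ) : Submodule ℝ (FreeAlgebra ℝ (Fin m)) :=
  Submodule.span ℝ (monom '' {v | v.length = k})

theorem monom_mem_homog (v : List (Fin m)) : monom v ∈ homog m v.length :=
  Submodule.subset_span ⟨v, rfl, rfl⟩

theorem gen_mul_mem_homog {k : ℕ} (j : Fin m) {x : FreeAlgebra ℝ (Fin m)} (hx : x ∈ homog m k) :
    gen j * x ∈ homog m (k + 1) := by
  induction hx using Submodule.span_induction with
  | mem x h =>
    obtain ⟨v, rfl, rfl⟩ := h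
    rw [← monom_cons]
    exact monom_mem_homog (j :: v)
  | zero => simp
  | add x y _ _ hx hy => rw [mul_add]; exact add_mem hx hy
  | smul c x _ hx => rw [mul_smul_comm]; exact Submodule.smul_mem _ _ hx

theorem gen_pow_mul_mem_homog {k : ℕ} (j : Fin m) (n : ℕ) {x : FreeAlgebra ℝ (Fin m)}
    (hx : x ∈ homog m k) : gen j ^ n * x ∈ homog m (n + k) := by
  induction n with
  | zero => simpa using hx
  | succ n ih =>
    rw [pow_succ', mul_assoc, add_right_comm]
    exact gen_mul_mem_homog j ih

theorem exists_sum_monom_of_mem_homog {k : ℕ} {x : FreeAlgebra ℝ (Fin m)} (hx : x ∈ homog m k) :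
    ∃ α : List (Fin m) → ℝ, x = ∑ v ∈ words m k k, α v • monom v := by
  induction hx using Submodule.span_induction with
  | mem x h =>
    obtain ⟨v, hv, rfl⟩ := h
    refine ⟨Pi.single v 1, ?_⟩
    rw [Finset.sum_eq_single v]
    · simp
    · intro u _ huv
      simp [huv]
    · intro h
      exact absurd (mem_words.2 ⟨hv.ge, hv.le⟩) h
  | zero => exact ⟨0, by simp⟩
  | add x y _ _ hx hy =>
    obtain ⟨α, rfl⟩ := hx
    obtain ⟨β, rfl⟩ := hy
    exact ⟨α + β, by simp [add_smul, Finset.sum_add_distrib]⟩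
  | smul c x _ hx =>
    obtain ⟨α, rfl⟩ := hx
    exact ⟨c • α, by simp [Finset.smul_sum, smul_smul]⟩

/-- The augmentation ideal. -/
def augment (m : ℕ) : Submodule ℝ (FreeAlgebra ℝ (Fin m)) :=
  Submodule.span ℝ (monom '' {v | v ≠ []})

theorem homog_le_augment (k : ℕ) : homog m (k + 1) ≤ augment m := by
  refine Submodule.span_mono (Set.image_mono ?_)
  intro v hv h
  rw [h] at hv
  simp at hv

theorem gen_mul_mem_augment (j : Fin m) {x : FreeAlgebra ℝ (Fin m)} (hx : x ∈ augment m) :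
    gen j * x ∈ augment m := by
  induction hx using Submodule.span_induction with
  | mem x h =>
    obtain ⟨v, hv, rfl⟩ := h
    rw [← monom_cons]
    exact Submodule.subset_span ⟨_, List.cons_ne_nil _ _, rfl⟩
  | zero => simp
  | add x y _ _ hx hy => rw [mul_add]; exact add_mem hx hy
  | smul c x _ hx => rw [mul_smul_comm]; exact Submodule.smul_mem _ _ hx

/-- The linear map which sends a monomial to the corresponding nested commutator. -/
def nest (m : ℕ) : FreeAlgebra ℝ (Fin m) →ₗ[ℝ] FreeAlgebra ℝ (Fin m) := pair (nestedBracket gen)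

/-- On nonempty words this is the recursion for nested brackets. The empty word has to be excluded:
its bracket is $0$, whereas that of the single letter $j$ is the generator itself. -/
theorem nest_gen_mul (j : Fin m) {x : FreeAlgebra ℝ (Fin m)} (hx : x ∈ augment m) :
    nest m (gen j * x) = gen j * nest m x - nest m x * gen j := by
  induction hx using Submodule.span_induction with
  | mem x h =>
    obtain ⟨v, hv, rfl⟩ := h
    rw [← monom_cons, nest, pair_monom, pair_monom]
    cases v with
    | nil => exact absurd rfl hv
    | cons a v => rfl
  | zero => simp
  | add x y _ _ hx hy => rw [mul_add, map_add, map_add, hx, hy]; noncomm_ring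
  | smul c x _ hx =>
    rw [mul_smul_comm, map_smul, map_smul, hx, smul_sub, mul_smul_comm, smul_mul_assoc]

/-! ### The series of a composition of flows -/

open PowerSeries (X C constantCoeff coeff_C coeff_mul coeff_C_mul coeff_mul_C)
open scoped PowerSeries

/-- The formal composition of flows. -/
def flowSeries (σ : List (Fin m × ℝ)) : (FreeAlgebra ℝ (Fin m))⟦X⟧ :=
  (σ.map fun p => pexp p.2 (gen p.1)).prod

/-- The formal velocity of a composition of flows; the last flow to act comes first in the list. -/
def velSeriesRev : List (Fin m × ℝ) → (FreeAlgebra ℝ (Fin m))⟦X⟧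
  | [] => 0
  | p :: σ => pexp (-p.2) (gen p.1) * velSeriesRev σ + C (p.2 • gen p.1)

/-- The formal velocity of a composition of flows. -/
def velSeries (σ : List (Fin m × ℝ)) : (FreeAlgebra ℝ (Fin m))⟦X⟧ := velSeriesRev σ.reverse

theorem velSeries_nil : velSeries ([] : List (Fin m × ℝ)) = 0 := rfl

theorem velSeries_concat (σ : List (Fin m × ℝ)) (p : Fin m × ℝ) :
    velSeries (σ ++ [p]) = pexp (-p.2) (gen p.1) * velSeries σ + C (p.2 • gen p.1) := by
  simp [velSeries, velSeriesRev]

theorem flowSeries_append (σ σ' : List (Fin m × ℝ)) :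
    flowSeries (σ ++ σ') = flowSeries σ * flowSeries σ' := by
  simp [flowSeries]

theorem flowSeries_nil : flowSeries ([] : List (Fin m × ℝ)) = 1 := rfl

theorem flowSeries_singleton (p : Fin m × ℝ) : flowSeries [p] = pexp p.2 (gen p.1) := by
  simp [flowSeries]

theorem invSteps_append (σ σ' : List (Fin m × ℝ)) :
    invSteps (σ ++ σ') = invSteps σ' ++ invSteps σ := by
  simp [invSteps]

theorem invSteps_singleton (p : Fin m × ℝ) : invSteps [p] = [(p.1, -p.2)] := rfl

theorem invSteps_invSteps (σ : List (Fin m × ℝ)) : invSteps (invSteps σ) = σ := by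
  simp [invSteps, List.map_reverse, Function.comp_def]

theorem flowSeries_mul_invSteps (σ : List (Fin m × ℝ)) :
    flowSeries σ * flowSeries (invSteps σ) = 1 := by
  induction σ using List.reverseRecOn with
  | nil => simp [flowSeries, invSteps]
  | append_singleton σ p ih =>
    rw [invSteps_append, flowSeries_append, flowSeries_append, invSteps_singleton,
      flowSeries_singleton, flowSeries_singleton, mul_assoc, ← mul_assoc (pexp _ _),
      pexp_mul_pexp_neg, one_mul, ih]

theorem flowSeries_invSteps_mul (σ : List (Fin m × ℝ)) :
    flowSeries (invSteps σ) * flowSeries σ = 1 := by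
  simpa [invSteps_invSteps] using flowSeries_mul_invSteps (invSteps σ)

/-- Every power of $X$ in an exponential brings one letter, and the added constant term has one
letter; hence the shift by one between degree and word length. -/
theorem coeff_velSeries_mem (σ : List (Fin m × ℝ)) (n : ℕ) :
    PowerSeries.coeff n (velSeries σ) ∈ homog m (n + 1) := by
  induction σ using List.reverseRecOn generalizing n with
  | nil => simp [velSeries_nil]
  | append_singleton σ p ih =>
    rw [velSeries_concat, map_add, coeff_mul, coeff_C]
    refine add_mem (Submodule.sum_mem _ fun q hq => ?_) ?_
    · rw [Finset.HasAntidiagonal.mem_antidiagonal] at hq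
      rw [coeff_pexp, smul_mul_assoc, ← hq, add_assoc]
      exact Submodule.smul_mem _ _ (gen_pow_mul_mem_homog _ _ (ih _))
    · split_ifs with h
      · subst h
        refine Submodule.smul_mem _ _ ?_
        simpa [monom] using monom_mem_homog [p.1]
      · exact zero_mem _

theorem nest_gen (j : Fin m) : nest m (gen j) = gen j := by
  have : gen j = monom [j] := by simp [monom]
  rw [nest]
  nth_rw 1 [this]
  rw [pair_monom]
  rfl

/-- The nested commutators of the formal velocity make up the logarithmic derivative. -/
theorem nest_velSeries (σ : List (Fin m × ℝ)) :
    mapCoeff (nest m) (velSeries σ) = flowSeries (invSteps σ) * pderiv (flowSeries σ) := by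
  induction σ using List.reverseRecOn with
  | nil =>
    rw [flowSeries_nil, pderiv_one, mul_zero]
    ext n
    simp [coeff_mapCoeff, velSeries_nil]
  | append_singleton σ p ih =>
    have hadd : mapCoeff (nest m) (velSeries (σ ++ [p])) =
        mapCoeff (nest m) (pexp (-p.2) (gen p.1) * velSeries σ) + C (p.2 • gen p.1) := by
      ext n
      rw [velSeries_concat, map_add, coeff_mapCoeff, coeff_mapCoeff, map_add, map_add, coeff_C]
      split_ifs <;> simp [nest_gen]
    -- With $e$ the new exponential, both sides become $e^{-1}(P^{-1}P')e+ca$: on the left by the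
    -- conjugation rule, on the right by the product rule for $Pe$.
    rw [hadd, mapCoeff_pexp_mul (nest m) (augment m) (gen p.1)
      (fun x hx => gen_mul_mem_augment p.1 hx) (fun x hx => nest_gen_mul p.1 hx) p.2 (velSeries σ)
      (fun n => homog_le_augment n (coeff_velSeries_mem σ n)), ih, flowSeries_append,
      invSteps_append, flowSeries_append, pderiv_mul, invSteps_singleton, flowSeries_singleton,
      flowSeries_singleton, pderiv_pexp, mul_add, C_mul_pexp]
    congr 1
    · simp only [mul_assoc]
    · rw [mul_assoc, ← mul_assoc (flowSeries (invSteps σ)), flowSeries_invSteps_mul, one_mul,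
        ← mul_assoc, pexp_neg_mul_pexp, one_mul]

theorem exists_pexp_eq {R : Type*} [Ring R] [Algebra ℝ R] (c : ℝ) (a : R) :
    ∃ e : R⟦X⟧, pexp c a = 1 + X * (C (c • a) + X * e) := by
  refine ⟨PowerSeries.mk fun n => PowerSeries.coeff (n + 2) (pexp c a), ?_⟩
  ext n
  match n with
  | 0 => simp [constantCoeff_pexp]
  | 1 =>
    rw [map_add, PowerSeries.coeff_succ_X_mul, coeff_pexp]
    simp [PowerSeries.coeff_one]
  | n + 2 =>
    rw [map_add, PowerSeries.coeff_succ_X_mul, map_add, PowerSeries.coeff_succ_X_mul,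
      PowerSeries.coeff_mk, coeff_C, PowerSeries.coeff_one]
    simp

/-! ### The formal series of a commutator of flows -/

theorem cSteps_cons_cons (a b : Fin m) (v : List (Fin m)) (t : ℝ) :
    cSteps (a :: b :: v) t =
      [(a, t)] ++ cSteps (b :: v) t ++ [(a, -t)] ++ invSteps (cSteps (b :: v) t) := rfl

/-- The lowest order term of a commutator of flows. -/
theorem exists_flowSeries_cSteps (w : List (Fin m)) (hw : w ≠ []) :
    ∃ Y : (FreeAlgebra ℝ (Fin m))⟦X⟧, flowSeries (cSteps w 1) = 1 + X ^ w.length * Y ∧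
      constantCoeff Y = nestedBracket gen w := by
  induction w with
  | nil => exact absurd rfl hw
  | cons a w ih =>
    obtain ⟨e, he⟩ := exists_pexp_eq 1 (gen a)
    cases w with
    | nil =>
      refine ⟨_, (flowSeries_singleton _).trans (by simpa using he), ?_⟩
      simp [nestedBracket]
    | cons b v =>
      obtain ⟨U, hU, hU0⟩ := ih (List.cons_ne_nil _ _)
      set D := flowSeries (invSteps (cSteps (b :: v) 1)) with hD
      have hD1 : flowSeries (cSteps (b :: v) 1) * D = 1 := flowSeries_mul_invSteps _
      have hD0 : constantCoeff D = 1 := by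
        have := congrArg constantCoeff hD1
        rw [hU] at this
        simpa using this
      obtain ⟨A, hA⟩ : ∃ A : (FreeAlgebra ℝ (Fin m))⟦X⟧, A = C ((1 : ℝ) • gen a) + X * e :=
        ⟨_, rfl⟩
      rw [← hA] at he
      have hE1 : pexp 1 (gen a) * pexp (-1) (gen a) = 1 := pexp_mul_pexp_neg _ _
      refine ⟨(A * U - U * A) * pexp (-1) (gen a) * D, ?_, ?_⟩
      -- With $E=1+XA$ and $P=1+X^kU$ only the product terms fail to commute, so
      -- $EP-PE=X^{k+1}(AU-UA)$. Then $EPE^{-1}P^{-1}=1+(EP-PE)E^{-1}P^{-1}$.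
      · have hcomm : flowSeries (cSteps (b :: v) 1) * pexp 1 (gen a) +
            X ^ (v.length + 1 + 1) * (A * U - U * A) =
            pexp 1 (gen a) * flowSeries (cSteps (b :: v) 1) := by
          rw [hU, he, List.length_cons]
          have hX : ∀ F : (FreeAlgebra ℝ (Fin m))⟦X⟧, F * X = X * F :=
            fun F => PowerSeries.X_mul.symm
          have hXp : ∀ (F : (FreeAlgebra ℝ (Fin m))⟦X⟧) k, F * X ^ k = X ^ k * F :=
            fun F k => PowerSeries.X_pow_mul.symm
          have e1 : X * A * (X ^ (v.length + 1) * U) = X ^ (v.length + 1 + 1) * (A * U) := by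
            rw [mul_assoc, ← mul_assoc A, hXp, pow_succ' _ (v.length + 1)]
            simp only [mul_assoc]
          have e2 : X ^ (v.length + 1) * U * (X * A) = X ^ (v.length + 1 + 1) * (U * A) := by
            rw [mul_assoc, ← mul_assoc U, hX, pow_succ _ (v.length + 1)]
            simp only [mul_assoc]
          rw [add_mul, mul_add (X ^ (v.length + 1) * U), e2, one_mul, mul_one, add_mul, one_mul,
            mul_add (X * A), e1, mul_one]
          noncomm_ring
        rw [cSteps_cons_cons, flowSeries_append, flowSeries_append, flowSeries_append,
          flowSeries_singleton, flowSeries_singleton, ← hD, ← hcomm, add_mul, add_mul,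
          mul_assoc (flowSeries _), hE1, mul_one, hD1]
        simp only [List.length_cons, mul_assoc]
      · simp [hU0, hD0, constantCoeff_pexp, hA, nestedBracket]

/-- If $P=1+X^\ell Y$ and $PD=1$, then $D=1-X^\ell YD$, and $D$ has constant term $1$. -/
theorem exists_flowSeries_invSteps_cSteps (w : List (Fin m)) (hw : w ≠ []) :
    ∃ Y : (FreeAlgebra ℝ (Fin m))⟦X⟧,
      flowSeries (invSteps (cSteps w 1)) = 1 + X ^ w.length * Y ∧
      constantCoeff Y = -nestedBracket gen w := by
  obtain ⟨Y, hY, hY0⟩ := exists_flowSeries_cSteps w hw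
  have h := flowSeries_mul_invSteps (cSteps w 1)
  set D := flowSeries (invSteps (cSteps w 1)) with hD
  have hX : constantCoeff (X ^ w.length * Y) = 0 := by
    rw [map_mul, map_pow, PowerSeries.constantCoeff_X, zero_pow (by simpa using hw), zero_mul]
  have hD0 : constantCoeff D = 1 := by
    have := congrArg constantCoeff h
    rw [hY, map_mul, map_add, hX, map_one, add_zero, one_mul] at this
    exact this
  refine ⟨-Y * D, ?_, by simp [hY0, hD0]⟩
  rw [hY, add_mul, one_mul] at h
  rw [← h, add_assoc, neg_mul, mul_neg, mul_assoc, add_neg_cancel, add_zero]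

theorem coeff_one_add_X_pow_mul {R : Type*} [Ring R] {k : ℕ} (hk : k ≠ 0) (Y : R⟦X⟧) :
    PowerSeries.coeff 0 (1 + X ^ k * Y) = 1 ∧
    (∀ i, 0 < i → i < k → PowerSeries.coeff i (1 + X ^ k * Y) = 0) ∧
    PowerSeries.coeff k (1 + X ^ k * Y) = constantCoeff Y := by
  refine ⟨?_, fun i hi hik => ?_, ?_⟩
  · rw [map_add, PowerSeries.coeff_X_pow_mul', if_neg (by omega), PowerSeries.coeff_one, if_pos rfl,
      add_zero]
  · rw [map_add, PowerSeries.coeff_X_pow_mul', if_neg (by omega), PowerSeries.coeff_one,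
      if_neg (by omega), add_zero]
  · rw [map_add, PowerSeries.coeff_X_pow_mul', if_pos le_rfl, PowerSeries.coeff_one,
      if_neg (by omega), zero_add, Nat.sub_self, PowerSeries.coeff_zero_eq_constantCoeff_apply]

theorem exists_pderiv_one_add {R : Type*} [Ring R] [Algebra ℝ R] {k : ℕ} (hk : k ≠ 0)
    (Y : R⟦X⟧) : ∃ Z : R⟦X⟧, pderiv (1 + X ^ k * Y) = X ^ (k - 1) * Z ∧
      constantCoeff Z = (k : ℝ) • constantCoeff Y := by
  obtain ⟨k, rfl⟩ := Nat.exists_eq_succ_of_ne_zero hk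
  refine ⟨PowerSeries.mk fun n => ((n : ℝ) + k + 1) • PowerSeries.coeff n Y, ?_, ?_⟩
  · ext n
    rw [coeff_pderiv, map_add, PowerSeries.coeff_one, if_neg (by omega), zero_add,
      PowerSeries.coeff_X_pow_mul', PowerSeries.coeff_X_pow_mul', Nat.succ_sub_one]
    by_cases h : k ≤ n
    · rw [if_pos (by omega), if_pos h, PowerSeries.coeff_mk, Nat.succ_eq_add_one,
        Nat.add_sub_add_right]
      congr 1
      push_cast [Nat.cast_sub h]
      ring
    · rw [if_neg (by omega), if_neg h, smul_zero]
  · rw [← PowerSeries.coeff_zero_eq_constantCoeff_apply, PowerSeries.coeff_mk]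
    simp

/-- The logarithmic derivative of $1+X^kY$ is $X^{k-1}$ times a series with constant term $kY(0)$.
-/
theorem nest_coeff_velSeries (σ : List (Fin m × ℝ)) {k : ℕ} (hk : k ≠ 0)
    {Y : (FreeAlgebra ℝ (Fin m))⟦X⟧} (hY : flowSeries σ = 1 + X ^ k * Y) :
    (∀ i, i + 1 < k → nest m (PowerSeries.coeff i (velSeries σ)) = 0) ∧
      nest m (PowerSeries.coeff (k - 1) (velSeries σ)) = (k : ℝ) • constantCoeff Y := by
  obtain ⟨Z, hZ, hZ0⟩ := exists_pderiv_one_add hk Y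
  have h0 : constantCoeff (flowSeries (invSteps σ)) = 1 := by
    have := congrArg constantCoeff (flowSeries_mul_invSteps σ)
    rw [hY] at this
    simpa [hk] using this
  have h := nest_velSeries σ
  rw [hY, hZ, ← mul_assoc, ← PowerSeries.X_pow_mul, mul_assoc] at h
  constructor
  · intro i hi
    rw [← coeff_mapCoeff (nest m), h, PowerSeries.coeff_X_pow_mul', if_neg (by omega)]
  · rw [← coeff_mapCoeff (nest m), h, PowerSeries.coeff_X_pow_mul', if_pos le_rfl, Nat.sub_self,
      PowerSeries.coeff_zero_eq_constantCoeff_apply, map_mul, h0, one_mul, hZ0]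

/-- With $D=P^{-1}$, differentiating $PD=1$ turns the sum of the logarithmic derivatives into
$DP'-P'D$. For $\ell\ge2$ the leading $1$ of $D$ drops out and $X^{2\ell-1}$ factors out, with
$2\ell-1>\ell$. For $\ell=1$ the series $D$ and $P'$ commute. -/
theorem nest_coeff_velSeries_add (w : List (Fin m)) (hw : w ≠ []) :
    nest m (PowerSeries.coeff w.length (velSeries (cSteps w 1))) +
      nest m (PowerSeries.coeff w.length (velSeries (invSteps (cSteps w 1)))) = 0 := by
  set σ := cSteps w 1 with hσ
  set P := flowSeries σ with hP
  set D := flowSeries (invSteps σ) with hD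
  have hk : w.length ≠ 0 := by simpa using hw
  have hPD : P * D = 1 := flowSeries_mul_invSteps σ
  have hd : P * pderiv D = -(pderiv P * D) := by
    have := congrArg pderiv hPD
    rw [pderiv_mul, pderiv_one] at this
    exact eq_neg_of_add_eq_zero_right this
  rw [← coeff_mapCoeff (nest m), ← coeff_mapCoeff (nest m), nest_velSeries, nest_velSeries, invSteps_invSteps,
    ← map_add, ← hP, ← hD, hd]
  match w, hw with
  | [a], _ =>
    have e1 : P = pexp 1 (gen a) := by rw [hP, hσ]; exact flowSeries_singleton (a, (1 : ℝ))
    have e2 : D = pexp (-1) (gen a) := by rw [hD, hσ]; exact flowSeries_singleton (a, -(1 : ℝ))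
    rw [e1, e2, pderiv_pexp, ← mul_assoc, ← C_mul_pexp_neg, mul_assoc, mul_assoc,
      pexp_mul_pexp_neg, pexp_neg_mul_pexp, add_neg_cancel, map_zero]
  | a :: b :: v, hw =>
    obtain ⟨Y, hY, -⟩ := exists_flowSeries_cSteps _ hw
    obtain ⟨Y', hY', -⟩ := exists_flowSeries_invSteps_cSteps _ hw
    obtain ⟨Z, hZ, -⟩ := exists_pderiv_one_add hk Y
    rw [← hσ] at hY hY'
    rw [hP, hY, hZ, hD, hY']
    have e1 : (1 + X ^ (a :: b :: v).length * Y') * (X ^ ((a :: b :: v).length - 1) * Z) +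
        -(X ^ ((a :: b :: v).length - 1) * Z * (1 + X ^ (a :: b :: v).length * Y')) =
        X ^ ((a :: b :: v).length - 1 + (a :: b :: v).length) * (Y' * Z - Z * Y') := by
      have hXp : ∀ (F : (FreeAlgebra ℝ (Fin m))⟦X⟧) k, F * X ^ k = X ^ k * F :=
        fun F k => PowerSeries.X_pow_mul.symm
      have h1 : X ^ (a :: b :: v).length * Y' * (X ^ ((a :: b :: v).length - 1) * Z) =
          X ^ ((a :: b :: v).length - 1 + (a :: b :: v).length) * (Y' * Z) := by
        rw [mul_assoc, ← mul_assoc Y', hXp, ← mul_assoc, ← mul_assoc, ← pow_add, mul_assoc,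
          add_comm]
      have h2 : X ^ ((a :: b :: v).length - 1) * Z * (X ^ (a :: b :: v).length * Y') =
          X ^ ((a :: b :: v).length - 1 + (a :: b :: v).length) * (Z * Y') := by
        rw [mul_assoc, ← mul_assoc Z, hXp, ← mul_assoc, ← mul_assoc, ← pow_add, mul_assoc]
      rw [add_mul, mul_add, one_mul, mul_one, h1, h2]
      noncomm_ring
    rw [e1, PowerSeries.coeff_X_pow_mul', if_neg (by simp)]

end FreeAlg

/-! ### Linear differential equations -/

section LinearODE

variable {V : Type*} [NormedAddCommGroup V] [NormedSpace ℝ V]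

/-- The radial retraction onto the closed ball of radius `r`. -/
def radialRetract (r : ℝ) (v : V) : V := (min 1 (r / ‖v‖)) • v

theorem radialRetract_of_le {r : ℝ} {v : V} (h : ‖v‖ ≤ r) : radialRetract r v = v := by
  rcases eq_or_ne v 0 with rfl | hv
  · simp [radialRetract]
  · rw [radialRetract, min_eq_left, one_smul]
    rwa [le_div_iff₀ (norm_pos_iff.2 hv), one_mul]

theorem radialRetract_of_ge {r : ℝ} {v : V} (hr : 0 < r) (h : r ≤ ‖v‖) :
    radialRetract r v = (r / ‖v‖) • v := by
  rw [radialRetract, min_eq_right]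
  rw [div_le_iff₀ (hr.trans_le h), one_mul]
  exact h

theorem norm_radialRetract_le {r : ℝ} (hr : 0 < r) (v : V) :
    ‖radialRetract r v‖ ≤ r ∧ ‖radialRetract r v‖ ≤ ‖v‖ := by
  rcases le_total ‖v‖ r with h | h
  · rw [radialRetract_of_le h]
    exact ⟨h, le_rfl⟩
  · have hv : 0 < ‖v‖ := hr.trans_le h
    have : ‖(r / ‖v‖) • v‖ = r := by
      rw [norm_smul, Real.norm_of_nonneg (by positivity)]
      field_simp
    rw [radialRetract_of_ge hr h, this]
    exact ⟨le_rfl, h⟩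

/-- The constant $2$ is valid in every normed space: the difference of the vectors and the change of
the scaling factor each contribute at most $\|u-v\|$. -/
theorem norm_radialRetract_sub_le {r : ℝ} (hr : 0 < r) (u v : V) :
    ‖radialRetract r u - radialRetract r v‖ ≤ 2 * ‖u - v‖ := by
  have key : ∀ u v : V, ‖u‖ ≤ ‖v‖ → ‖radialRetract r u - radialRetract r v‖ ≤ 2 * ‖u - v‖ := by
    intro u v huv
    have hd : ‖v‖ - ‖u‖ ≤ ‖u - v‖ := by
      rw [norm_sub_rev]; exact norm_sub_norm_le v u
    rcases le_total ‖v‖ r with h | h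
    · rw [radialRetract_of_le h, radialRetract_of_le (huv.trans h)]
      linarith [norm_nonneg (u - v)]
    · have hv : 0 < ‖v‖ := hr.trans_le h
      rw [radialRetract_of_ge hr h]
      rcases le_total ‖u‖ r with h' | h'
      · rw [radialRetract_of_le h']
        have e : u - (r / ‖v‖) • v = (u - v) + (1 - r / ‖v‖) • v := by module
        have e2 : ‖(1 - r / ‖v‖) • v‖ = ‖v‖ - r := by
          rw [norm_smul, Real.norm_of_nonneg]
          · field_simp
          · rw [sub_nonneg, div_le_one hv]; exact h
        rw [e]
        refine (norm_add_le _ _).trans ?_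
        rw [e2]
        linarith
      · have hu : 0 < ‖u‖ := hr.trans_le h'
        rw [radialRetract_of_ge hr h']
        have e : (r / ‖u‖) • u - (r / ‖v‖) • v =
            (r / ‖v‖) • (u - v) + (r / ‖u‖ - r / ‖v‖) • u := by module
        have e1 : ‖(r / ‖v‖) • (u - v)‖ ≤ 1 * ‖u - v‖ := by
          rw [norm_smul, Real.norm_of_nonneg (by positivity)]
          gcongr
          rw [div_le_one hv]; exact h
        have e2 : ‖(r / ‖u‖ - r / ‖v‖) • u‖ ≤ ‖v‖ - ‖u‖ := by
          have e3 : r / ‖u‖ - r / ‖v‖ = r / ‖v‖ * (‖v‖ - ‖u‖) / ‖u‖ := by field_simp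
          rw [norm_smul, Real.norm_of_nonneg, e3]
          · rw [div_mul_cancel₀ _ hu.ne']
            refine mul_le_of_le_one_left (by linarith) ?_
            rw [div_le_one hv]; exact h
          · rw [e3]
            have : 0 ≤ ‖v‖ - ‖u‖ := by linarith
            positivity
        rw [e]
        refine (norm_add_le _ _).trans ?_
        linarith
  rcases le_total ‖u‖ ‖v‖ with h | h
  · exact key u v h
  · rw [norm_sub_rev, norm_sub_rev u]
    exact key v u h

/-- Linear differential equations with continuous coefficients have global solutions. -/
theorem exists_linear_ode_solution [CompleteSpace V] {T M : ℝ} (hT : 0 ≤ T) (hM : 0 ≤ M)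
    (A : ℝ → V →L[ℝ] V) (hA : ContinuousOn A (Icc 0 T)) (hb : ∀ t ∈ Icc 0 T, ‖A t‖ ≤ M) (v₀ : V) :
    ∃ α : ℝ → V, α 0 = v₀ ∧
      ∀ t ∈ Icc 0 T, HasDerivWithinAt α (A t (α t)) (Icc 0 T) t := by
  -- This radius exceeds the a priori Gronwall bound. Truncation at $r$ makes the field bounded, so
  -- that Picard–Lindelöf applies on all of $[0,T]$, and the solution never reaches the truncated
  -- region.
  set r : ℝ := ‖v₀‖ * Real.exp (M * T) + 1 with hrdef
  have hr : 0 < r := by positivity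
  lift M to NNReal using hM
  have hpl : IsPicardLindelof (fun t v => A t (radialRetract r v)) (tmin := 0) (tmax := T)
      ⟨0, left_mem_Icc.2 hT⟩ v₀ (M * ⟨r, hr.le⟩ * ⟨T, hT⟩) 0 (M * ⟨r, hr.le⟩) (M * 2) := by
    constructor
    · intro t ht
      apply LipschitzOnWith.of_dist_le_mul
      intro u _ v _
      rw [dist_eq_norm, dist_eq_norm, ← map_sub]
      refine (ContinuousLinearMap.le_opNorm _ _).trans ?_
      have := norm_radialRetract_sub_le hr u v
      push_cast
      rw [mul_assoc]
      exact mul_le_mul (hb t ht) this (norm_nonneg _) M.2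
    · intro v _
      exact hA.clm_apply continuousOn_const
    · intro t ht v _
      refine (ContinuousLinearMap.le_opNorm _ _).trans ?_
      exact mul_le_mul (hb t ht) (norm_radialRetract_le hr v).1 (norm_nonneg _) M.2
    · push_cast
      rw [sub_zero, sub_zero, sub_zero, max_eq_left hT]
      rfl
  obtain ⟨α, hα0, hα⟩ := hpl.exists_eq_forall_mem_Icc_hasDerivWithinAt₀
  refine ⟨α, hα0, fun t ht => ?_⟩
  have hcont : ContinuousOn α (Icc 0 T) := fun t ht => (hα t ht).continuousWithinAt
  have hgr := norm_le_gronwallBound_of_norm_deriv_right_le (f := α)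
    (f' := fun t => A t (radialRetract r (α t))) (δ := ‖v₀‖) (K := M) (ε := 0) hcont
    (fun t ht => (hα t (Ico_subset_Icc_self ht)).mono_of_mem_nhdsWithin
      (Icc_mem_nhdsGE_of_mem ht)) (by simp only at hα0; rw [hα0]) (fun t ht => by
      rw [add_zero]
      refine (ContinuousLinearMap.le_opNorm _ _).trans ?_
      exact mul_le_mul (hb t (Ico_subset_Icc_self ht)) (norm_radialRetract_le hr _).2
        (norm_nonneg _) M.2) t ht
  rw [gronwallBound_ε0, sub_zero] at hgr
  have hle : ‖α t‖ ≤ r := by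
    refine hgr.trans ?_
    have : Real.exp (M * t) ≤ Real.exp (M * T) :=
      Real.exp_le_exp.2 (mul_le_mul_of_nonneg_left ht.2 M.2)
    have := mul_le_mul_of_nonneg_left this (norm_nonneg v₀)
    linarith
  have := hα t ht
  rwa [radialRetract_of_le hle] at this

end LinearODE

/-! ### Duality -/

/-- If all functionals are dominated on the vector `R` by their values at the vectors `g u`, then
`R` is a linear combination of these vectors with bounded coefficients. -/
theorem exists_sum_eq_of_forall_dual {E ι : Type*} [NormedAddCommGroup E] [NormedSpace ℝ E]
    (S : Finset ι) (g : ι → E) (R : E) {K : ℝ} (hK : 0 ≤ K)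
    (h : ∀ ξ : E →L[ℝ] ℝ, |ξ R| ≤ K * ∑ u ∈ S, |ξ (g u)|) :
    ∃ c : ι → ℝ, (∀ u, |c u| ≤ K) ∧ R = ∑ u ∈ S, c u • g u := by
  classical
  let Φ : (ι → ℝ) → E := fun c => ∑ u ∈ S, c u • g u
  have hΦ : Continuous Φ := by fun_prop
  have hlin : IsLinearMap ℝ Φ :=
    ⟨fun x y => by simp [Φ, add_smul, Finset.sum_add_distrib],
      fun a x => by simp [Φ, Finset.smul_sum, smul_smul]⟩
  -- The combinations with coefficients in this cube form a compact convex set. If $R$ lay outside,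
  -- a functional $\xi$ would strictly separate it; the coefficients $\pm K$ with the signs of
  -- $\xi(g_u)$ give the value $K\sum_u|\xi(g_u)|$, contrary to the hypothesis.
  let Q : Set (ι → ℝ) := Set.pi univ fun _ => Icc (-K) K
  have hQ : IsCompact Q := isCompact_univ_pi fun _ => isCompact_Icc
  have hQc : Convex ℝ Q := convex_pi fun _ _ => convex_Icc _ _
  by_cases hR : R ∈ Φ '' Q
  · obtain ⟨c, hc, rfl⟩ := hR
    exact ⟨c, fun u => abs_le.2 (hc u (mem_univ u)), rfl⟩
  · exfalso
    obtain ⟨ξ, a, hξ, ha⟩ := geometric_hahn_banach_closed_point (hQc.is_linear_image hlin)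
      (hQ.image hΦ).isClosed hR
    have := hξ (Φ fun u => if 0 ≤ ξ (g u) then K else -K) ⟨_, fun u _ => by
      simp only
      split_ifs
      · exact ⟨by linarith, le_rfl⟩
      · exact ⟨le_rfl, by linarith⟩, rfl⟩
    have e : ξ (Φ fun u => if 0 ≤ ξ (g u) then K else -K) = K * ∑ u ∈ S, |ξ (g u)| := by
      simp only [Φ, map_sum, map_smul, Finset.mul_sum, smul_eq_mul]
      refine Finset.sum_congr rfl fun u _ => ?_
      split_ifs with h
      · rw [abs_of_nonneg h]
      · rw [abs_of_neg (not_le.1 h)]; ring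
    rw [e] at this
    have h1 := h ξ
    have h2 := le_abs_self (ξ R)
    linarith

/-! ### Taylor expansion of jets -/

theorem hasDerivAt_mul_pow_div_factorial (c σ : ℝ) (i : ℕ) :
    HasDerivAt (fun σ : ℝ => (c * σ) ^ (i + 1) / ((i + 1).factorial : ℝ))
      (c * ((c * σ) ^ i / (i.factorial : ℝ))) σ := by
  have h := (((hasDerivAt_id σ).const_mul c).pow (i + 1)).div_const ((i + 1).factorial : ℝ)
  refine h.congr_deriv ?_
  rw [Nat.factorial_succ]
  simp only [id_eq, Nat.add_sub_cancel]
  push_cast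
  field_simp

/-- Taylor's formula for a family of functions which is indexed by words, such that the derivative
of the function `h u` is `c • h (j :: u)`. -/
theorem jet_taylor {m : ℕ} {V : Type*} [NormedAddCommGroup V] [NormedSpace ℝ V]
    (h : List (Fin m) → ℝ → V) {c t ε : ℝ} (hc : |c| ≤ 1) (j : Fin m) (k₀ k : ℕ) (hε : 0 ≤ ε)
    (hd : ∀ u : List (Fin m), k₀ ≤ u.length → u.length < k → ∀ σ ∈ Icc 0 t,
      HasDerivWithinAt (h u) (c • h (j :: u) σ) (Icc 0 t) σ)
    (he : ∀ u : List (Fin m), k₀ ≤ u.length → u.length = k → ∀ σ ∈ Icc 0 t,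
      ‖h u σ - h u 0‖ ≤ ε)
    (r : ℕ) (u : List (Fin m)) (hu₀ : k₀ ≤ u.length) (hu : u.length + r = k) :
    ∀ σ ∈ Icc 0 t, ‖h u σ - ∑ i ∈ Finset.range (r + 1),
      ((c * σ) ^ i / (i.factorial : ℝ)) • h (List.replicate i j ++ u) 0‖ ≤ ε * σ ^ r := by
  induction r generalizing u with
  | zero =>
    intro σ hσ
    simpa using he u hu₀ hu σ hσ
  | succ r ih =>
    intro σ hσ
    set F : ℝ → V := fun σ => h u σ - ∑ i ∈ Finset.range (r + 1 + 1),
      ((c * σ) ^ i / (i.factorial : ℝ)) • h (List.replicate i j ++ u) 0 with hF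
    set G : ℝ → V := fun σ => h (j :: u) σ - ∑ i ∈ Finset.range (r + 1),
      ((c * σ) ^ i / (i.factorial : ℝ)) • h (List.replicate i j ++ (j :: u)) 0 with hG
    have hF' : F = fun σ => h u σ - (∑ i ∈ Finset.range (r + 1),
        ((c * σ) ^ (i + 1) / ((i + 1).factorial : ℝ)) • h (List.replicate i j ++ (j :: u)) 0
          + h u 0) := by
      funext σ
      rw [hF]
      simp only
      rw [Finset.sum_range_succ']
      congr 2
      · refine Finset.sum_congr rfl fun i _ => ?_
        rw [List.replicate_succ', List.append_assoc, List.singleton_append]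
      · simp
    have hF0 : F 0 = 0 := by
      rw [hF']
      simp
    -- The derivative of the remainder for $u$ is $c$ times the remainder $G$ of one order less for
    -- $ju$. Integration of the bound for $G$ gains one power of $\sigma$.
    have hder : ∀ τ ∈ Icc 0 t, HasDerivWithinAt F (c • G τ) (Icc 0 t) τ := by
      intro τ hτ
      rw [hF']
      refine ((hd u hu₀ (by omega) τ hτ).sub
        ((HasDerivWithinAt.fun_sum fun i _ =>
          ((hasDerivAt_mul_pow_div_factorial c τ i).hasDerivWithinAt.smul_const
            _)).add_const _)).congr_deriv ?_
      rw [hG]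
      simp only [smul_sub, Finset.smul_sum, smul_smul]
    have hbound : ∀ τ ∈ Icc 0 σ, ‖c • G τ‖ ≤ ε * σ ^ r := by
      intro τ hτ
      have h1 := ih (j :: u) (by simp; omega) (by simp; omega) τ ⟨hτ.1, hτ.2.trans hσ.2⟩
      rw [norm_smul, Real.norm_eq_abs]
      calc |c| * ‖G τ‖ ≤ 1 * (ε * τ ^ r) := by gcongr
        _ ≤ ε * σ ^ r := by
          rw [one_mul]
          have := pow_le_pow_left₀ hτ.1 hτ.2 r
          gcongr
    have hmv := (convex_Icc (0 : ℝ) σ).norm_image_sub_le_of_norm_hasDerivWithin_le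
      (f := F) (fun τ hτ => (hder τ ⟨hτ.1, hτ.2.trans hσ.2⟩).mono
        (Icc_subset_Icc_right hσ.2)) hbound (left_mem_Icc.2 hσ.1) (right_mem_Icc.2 hσ.1)
    rw [hF0, sub_zero, sub_zero, Real.norm_of_nonneg hσ.1] at hmv
    rw [pow_succ, ← mul_assoc]
    exact hmv

/-! ### A Gronwall estimate for absolutely continuous functions -/

/-- Absolute continuity turns the almost everywhere bound into an integral inequality for
$H=\sum_v|h_v|$, to which Gronwall applies. The second bound keeps the factor $t$, which supplies
one more power of time in the final remainder. -/
theorem abs_sub_le_of_ae_abs_deriv_le {ι : Type*} (S : Finset ι) (h : ι → ℝ → ℝ) {K t : ℝ}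
    (hK : 0 ≤ K) (ht : 0 ≤ t) (hac : ∀ u ∈ S, AbsolutelyContinuousOnInterval (h u) 0 t)
    (hd : ∀ u ∈ S, ∀ᵐ σ, σ ∈ Ioo 0 t → |deriv (h u) σ| ≤ K * ∑ v ∈ S, |h v σ|) :
    ∀ σ ∈ Icc 0 t, (∑ v ∈ S, |h v σ| ≤ Real.exp (K * S.card * t) * ∑ v ∈ S, |h v 0|) ∧
      ∀ u ∈ S, |h u σ - h u 0| ≤
        K * t * (Real.exp (K * S.card * t) * ∑ v ∈ S, |h v 0|) := by
  set H : ℝ → ℝ := fun σ => ∑ v ∈ S, |h v σ| with hH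
  have hH0 : ∀ σ, 0 ≤ H σ := fun σ => Finset.sum_nonneg fun _ _ => abs_nonneg _
  have hcont : ContinuousOn H (Icc 0 t) := by
    refine continuousOn_finsetSum _ fun v hv => ?_
    have := (hac v hv).continuousOn
    rw [uIcc_of_le ht] at this
    exact this.abs
  have hint : ∀ σ ∈ Icc 0 t, IntervalIntegrable H volume 0 σ := fun σ hσ =>
    ContinuousOn.intervalIntegrable (by
      rw [uIcc_of_le hσ.1]; exact hcont.mono (Icc_subset_Icc_right hσ.2))
  have hbound : ∀ σ ∈ Icc 0 t, ∀ u ∈ S, |h u σ - h u 0| ≤ K * ∫ τ in (0 : ℝ)..σ, H τ := by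
    intro σ hσ u hu
    have hsub : uIcc 0 σ ⊆ uIcc 0 t := by
      rw [uIcc_of_le hσ.1, uIcc_of_le ht]
      exact Icc_subset_Icc_right hσ.2
    rw [← ((hac u hu).mono hsub).integral_deriv_eq_sub, ← intervalIntegral.integral_const_mul,
      ← Real.norm_eq_abs]
    refine intervalIntegral.norm_integral_le_of_norm_le hσ.1 ?_ ((hint σ hσ).const_mul K)
    have hne : ∀ᵐ τ : ℝ, τ ≠ t := by simp [ae_iff]
    filter_upwards [hd u hu, hne] with τ hτ hτt hτσ
    exact hτ ⟨hτσ.1, lt_of_le_of_ne (hτσ.2.trans hσ.2) hτt⟩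
  -- The majorant $\Phi$ of $H$ is differentiable although $H$ need not be.
  set Φ : ℝ → ℝ := fun σ => H 0 + K * S.card * ∫ τ in (0 : ℝ)..σ, H τ with hΦ
  have hHΦ : ∀ σ ∈ Icc 0 t, H σ ≤ Φ σ := by
    intro σ hσ
    have : H σ ≤ ∑ u ∈ S, (|h u 0| + K * ∫ τ in (0 : ℝ)..σ, H τ) := by
      refine Finset.sum_le_sum fun u hu => ?_
      have h1 := hbound σ hσ u hu
      have h2 := abs_sub_abs_le_abs_sub (h u σ) (h u 0)
      linarith
    rw [Finset.sum_add_distrib, Finset.sum_const, nsmul_eq_mul] at this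
    rw [hΦ]
    simp only
    rw [mul_comm K, mul_assoc]
    exact this
  have hKc : 0 ≤ K * S.card := by positivity
  have hΦd : ∀ σ ∈ Ico 0 t, HasDerivWithinAt Φ (K * S.card * H σ) (Ici σ) σ := by
    intro σ hσ
    refine ((HasDerivWithinAt.const_mul (K * S.card) ?_).const_add _)
    have hmem : Icc 0 t ∈ 𝓝[>] σ :=
      mem_of_superset (Ioc_mem_nhdsGT hσ.2) (fun x hx => ⟨hσ.1.trans hx.1.le, hx.2⟩)
    refine intervalIntegral.integral_hasDerivWithinAt_right
      (hint σ (Ico_subset_Icc_self hσ)) (t := Ioi σ) ?_ ?_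
    · exact ⟨Icc 0 t, hmem, hcont.aestronglyMeasurable measurableSet_Icc⟩
    · exact (hcont σ (Ico_subset_Icc_self hσ)).mono_of_mem_nhdsWithin hmem
  have hΦc : ContinuousOn Φ (Icc 0 t) := by
    refine continuousOn_const.add (continuousOn_const.mul ?_)
    have := intervalIntegral.continuousOn_primitive_interval (f := H) (μ := volume) (a := 0)
      (b := t) (by
        rw [uIcc_of_le ht]
        exact hcont.integrableOn_Icc)
    rwa [uIcc_of_le ht] at this
  have hΦ0 : Φ 0 = H 0 := by simp [hΦ]
  have hgr : ∀ σ ∈ Icc 0 t, Φ σ ≤ H 0 * Real.exp (K * S.card * σ) := by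
    intro σ hσ
    have := norm_le_gronwallBound_of_norm_deriv_right_le (f := Φ)
      (f' := fun σ => K * S.card * H σ) (δ := H 0) (K := K * S.card) (ε := 0) hΦc hΦd
      (by rw [hΦ0, Real.norm_of_nonneg (hH0 0)]) (fun τ hτ => by
        rw [add_zero, norm_mul, Real.norm_of_nonneg hKc, Real.norm_of_nonneg (hH0 _)]
        refine mul_le_mul_of_nonneg_left ?_ hKc
        exact (hHΦ τ (Ico_subset_Icc_self hτ)).trans (Real.le_norm_self _)) σ hσ
    rw [gronwallBound_ε0, sub_zero] at this
    exact (Real.le_norm_self _).trans this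
  have hHe : ∀ σ ∈ Icc 0 t, H σ ≤ Real.exp (K * S.card * t) * H 0 := by
    intro σ hσ
    refine ((hHΦ σ hσ).trans (hgr σ hσ)).trans ?_
    rw [mul_comm]
    exact mul_le_mul_of_nonneg_right
      (Real.exp_le_exp.2 (mul_le_mul_of_nonneg_left hσ.2 hKc)) (hH0 0)
  intro σ hσ
  refine ⟨hHe σ hσ, fun u hu => (hbound σ hσ u hu).trans ?_⟩
  rw [mul_assoc]
  refine mul_le_mul_of_nonneg_left ?_ hK
  have h1 : ∫ τ in (0 : ℝ)..σ, H τ ≤ ∫ τ in (0 : ℝ)..σ, Real.exp (K * S.card * t) * H 0 :=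
    intervalIntegral.integral_mono_on hσ.1 (hint σ hσ) intervalIntegrable_const
      fun τ hτ => hHe τ ⟨hτ.1, hτ.2.trans hσ.2⟩
  rw [intervalIntegral.integral_const, sub_zero, smul_eq_mul] at h1
  refine h1.trans (mul_le_mul_of_nonneg_right hσ.2 ?_)
  have := hH0 0
  positivity

/-! ### Flows of `C¹` vector fields -/

section FlowLemmas

variable {E : Type*} [NormedAddCommGroup E] [NormedSpace ℝ E]

theorem FlowTo.flowDefined {Z : E → E} {t : ℝ} {x y : E} (h : FlowTo Z t x y) :
    FlowDefined Z t x := ⟨y, h⟩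

theorem FlowDefined.flowTo {Z : E → E} {t : ℝ} {x : E} (h : FlowDefined Z t x) :
    FlowTo Z t x (flow Z t x) := by
  rw [flow, dif_pos h]
  exact h.choose_spec

/-- A curve with velocity `c • Z` is a reparametrized integral curve of `Z`. -/
theorem flowTo_of_hasDerivWithinAt {Z : E → E} {γ : ℝ → E} {c : ℝ} (hc : c ≠ 0) {I : Set ℝ}
    (hI : I.OrdConnected) (hγ : ∀ t ∈ I, HasDerivWithinAt γ (c • Z (γ t)) I t) {a b : ℝ}
    (ha : a ∈ I) (hb : b ∈ I) : FlowTo Z (c * (b - a)) (γ a) (γ b) := by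
  refine ⟨fun σ => γ (a + σ / c), by simp, by simp [mul_div_cancel_left₀ _ hc], ?_⟩
  have hmaps : MapsTo (fun σ => a + σ / c) (uIcc 0 (c * (b - a))) I := by
    intro σ hσ
    refine hI.uIcc_subset ha hb ?_
    have h1 : σ / c ∈ uIcc 0 (b - a) := by
      have := mem_image_of_mem (fun x => x / c) hσ
      rw [Set.image_div_const_uIcc] at this
      simpa [mul_div_cancel_left₀ _ hc] using this
    have h2 := mem_image_of_mem (fun x => a + x) h1
    rw [Set.image_const_add_uIcc] at h2
    simpa using h2
  intro σ hσ
  have h1 : HasDerivWithinAt (fun σ : ℝ => a + σ / c) c⁻¹ (uIcc 0 (c * (b - a))) σ := by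
    have := ((hasDerivAt_id σ).div_const c).const_add a
    rw [one_div] at this
    exact this.hasDerivWithinAt
  have h2 := (hγ _ (hmaps hσ)).scomp σ h1 hmaps
  simpa [smul_smul, inv_mul_cancel₀ hc, Function.comp_def] using h2

theorem FlowTo.symm {Z : E → E} {t : ℝ} {x y : E} (h : FlowTo Z t x y) : FlowTo Z (-t) y x := by
  obtain ⟨γ, rfl, rfl, hγ⟩ := h
  have := flowTo_of_hasDerivWithinAt (Z := Z) (γ := γ) (c := 1) one_ne_zero
    (ordConnected_uIcc (a := 0) (b := t)) (fun σ hσ => by simpa using hγ σ hσ) right_mem_uIcc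
    left_mem_uIcc
  simpa using this

theorem FlowTo.smul {Z : E → E} {t r : ℝ} (hr : r ≠ 0) {x y : E} (h : FlowTo Z t x y) :
    FlowTo (r • Z) (t / r) x y := by
  obtain ⟨γ, rfl, rfl, hγ⟩ := h
  have := flowTo_of_hasDerivWithinAt (Z := r • Z) (γ := γ) (c := r⁻¹) (inv_ne_zero hr)
    (ordConnected_uIcc (a := 0) (b := t)) (fun σ hσ => by
      simpa [smul_smul, inv_mul_cancel₀ hr] using hγ σ hσ) left_mem_uIcc right_mem_uIcc
  rwa [sub_zero, inv_mul_eq_div] at this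

variable [FiniteDimensional ℝ E]

theorem exists_lipschitzOnWith_closedBall {Z : E → E} (hZ : ContDiff ℝ 1 Z) (r : ℝ) :
    ∃ K, LipschitzOnWith K Z (Metric.closedBall 0 r) :=
  hZ.contDiffOn.exists_lipschitzOnWith one_ne_zero (convex_closedBall 0 r)
    (isCompact_closedBall 0 r)

/-- A $C^1$ field is only locally Lipschitz, but both curves have compact images, hence stay in a
ball on which the field is Lipschitz. -/
theorem eqOn_of_integralCurve {Z : E → E} (hZ : ContDiff ℝ 1 Z) {γ γ' : ℝ → E} {a b t₀ : ℝ}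
    (hγ : IsIntegralCurveOn γ (fun _ => Z) (Icc a b))
    (hγ' : IsIntegralCurveOn γ' (fun _ => Z) (Icc a b))
    (ht₀ : t₀ ∈ Icc a b) (h : γ t₀ = γ' t₀) : EqOn γ γ' (Icc a b) := by
  obtain ⟨r, hr⟩ := ((isCompact_Icc.image_of_continuousOn hγ.continuousOn).isBounded.union
    (isCompact_Icc.image_of_continuousOn hγ'.continuousOn).isBounded).subset_closedBall 0
  obtain ⟨K, hK⟩ := exists_lipschitzOnWith_closedBall hZ r
  have hm : ∀ t ∈ Icc a b, γ t ∈ Metric.closedBall 0 r :=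
    fun t ht => hr (Or.inl (mem_image_of_mem _ ht))
  have hm' : ∀ t ∈ Icc a b, γ' t ∈ Metric.closedBall 0 r :=
    fun t ht => hr (Or.inr (mem_image_of_mem _ ht))
  have hR : ∀ {δ : ℝ → E}, IsIntegralCurveOn δ (fun _ => Z) (Icc a b) → ∀ t ∈ Ico t₀ b,
      HasDerivWithinAt δ (Z (δ t)) (Ici t) t := by
    intro δ hδ t ht
    refine (hδ t ⟨ht₀.1.trans ht.1, ht.2.le⟩).mono_of_mem_nhdsWithin ?_
    exact Icc_mem_nhdsGE_of_mem ⟨ht₀.1.trans ht.1, ht.2⟩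
  have hL : ∀ {δ : ℝ → E}, IsIntegralCurveOn δ (fun _ => Z) (Icc a b) → ∀ t ∈ Ioc a t₀,
      HasDerivWithinAt δ (Z (δ t)) (Iic t) t := by
    intro δ hδ t ht
    refine (hδ t ⟨ht.1.le, ht.2.trans ht₀.2⟩).mono_of_mem_nhdsWithin ?_
    exact Icc_mem_nhdsLE_of_mem ⟨ht.1, ht.2.trans ht₀.2⟩
  intro t ht
  rcases le_total t₀ t with h' | h'
  · refine ODE_solution_unique_of_mem_Icc_right (v := fun _ => Z)
      (s := fun _ => Metric.closedBall 0 r) (K := K) (fun _ _ => hK)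
      (hγ.continuousOn.mono (Icc_subset_Icc_left ht₀.1)) (hR hγ)
      (fun t ht => hm t ⟨ht₀.1.trans ht.1, ht.2.le⟩)
      (hγ'.continuousOn.mono (Icc_subset_Icc_left ht₀.1)) (hR hγ')
      (fun t ht => hm' t ⟨ht₀.1.trans ht.1, ht.2.le⟩) h ⟨h', ht.2⟩
  · refine ODE_solution_unique_of_mem_Icc_left (v := fun _ => Z)
      (s := fun _ => Metric.closedBall 0 r) (K := K) (fun _ _ => hK)
      (hγ.continuousOn.mono (Icc_subset_Icc_right ht₀.2)) (hL hγ)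
      (fun t ht => hm t ⟨ht.1.le, ht.2.trans ht₀.2⟩)
      (hγ'.continuousOn.mono (Icc_subset_Icc_right ht₀.2)) (hL hγ')
      (fun t ht => hm' t ⟨ht.1.le, ht.2.trans ht₀.2⟩) h ⟨ht.1, h'⟩

theorem FlowTo.unique {Z : E → E} (hZ : ContDiff ℝ 1 Z) {t : ℝ} {x y y' : E}
    (h : FlowTo Z t x y) (h' : FlowTo Z t x y') : y = y' := by
  obtain ⟨γ, h0, rfl, hγ⟩ := h
  obtain ⟨γ', h0', rfl, hγ'⟩ := h'
  exact eqOn_of_integralCurve hZ hγ hγ' (left_mem_uIcc (a := 0) (b := t)) (h0.trans h0'.symm)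
    right_mem_uIcc

theorem FlowTo.flow_eq {Z : E → E} (hZ : ContDiff ℝ 1 Z) {t : ℝ} {x y : E}
    (h : FlowTo Z t x y) : flow Z t x = y :=
  h.flowDefined.flowTo.unique hZ h

/-- The end point of the flow is chosen separately for each time. By uniqueness all choices lie on
one integral curve; the halves for positive and negative times are glued at $0$. -/
theorem hasDerivWithinAt_flow {Z : E → E} (hZ : ContDiff ℝ 1 Z) {t₀ : ℝ} (ht₀ : 0 ≤ t₀) {x : E}
    (h : ∀ τ, |τ| ≤ t₀ → FlowDefined Z τ x) : flow Z 0 x = x ∧ ∀ τ ∈ Icc (-t₀) t₀,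
      HasDerivWithinAt (fun τ => flow Z τ x) (Z (flow Z τ x)) (Icc (-t₀) t₀) τ := by
  have key : ∀ s, |s| ≤ t₀ → ∀ τ ∈ uIcc 0 s,
      HasDerivWithinAt (fun τ => flow Z τ x) (Z (flow Z τ x)) (uIcc 0 s) τ := by
    intro s hs
    obtain ⟨y, γ, h0, -, hγ⟩ := h s hs
    have he : ∀ τ ∈ uIcc 0 s, flow Z τ x = γ τ := by
      intro τ hτ
      refine FlowTo.flow_eq hZ ⟨γ, h0, rfl, hγ.mono ?_⟩
      exact uIcc_subset_uIcc left_mem_uIcc hτ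
    intro τ hτ
    rw [he τ hτ]
    exact (hγ τ hτ).congr he (he τ hτ)
  have hp := key t₀ (abs_of_nonneg ht₀).le
  have hn := key (-t₀) (by rw [abs_neg, abs_of_nonneg ht₀])
  rw [uIcc_of_le ht₀] at hp
  rw [uIcc_of_ge (by linarith)] at hn
  constructor
  · obtain ⟨y, γ, hγ0, -, hγ⟩ := h 0 (by simpa using ht₀)
    refine FlowTo.flow_eq hZ ⟨γ, hγ0, hγ0, hγ⟩
  · intro τ hτ
    have hu : Icc (-t₀) t₀ = Icc (-t₀) 0 ∪ Icc 0 t₀ :=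
      (Icc_union_Icc_eq_Icc (by linarith) ht₀).symm
    rcases lt_trichotomy τ 0 with h' | h' | h'
    · refine (hn τ ⟨hτ.1, h'.le⟩).mono_of_mem_nhdsWithin ?_
      rw [hu]
      filter_upwards [self_mem_nhdsWithin, mem_nhdsWithin_of_mem_nhds (Iio_mem_nhds h')]
        with σ hσ hσ'
      rcases hσ with hσ | hσ
      · exact hσ
      · exact absurd hσ.1 (not_le.2 hσ')
    · subst h'
      rw [hu]
      exact (hn 0 ⟨hτ.1, le_rfl⟩).union (hp 0 ⟨le_rfl, ht₀⟩)
    · refine (hp τ ⟨h'.le, hτ.2⟩).mono_of_mem_nhdsWithin ?_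
      rw [hu]
      filter_upwards [self_mem_nhdsWithin, mem_nhdsWithin_of_mem_nhds (Ioi_mem_nhds h')]
        with σ hσ hσ'
      rcases hσ with hσ | hσ
      · exact absurd hσ.2 (not_le.2 hσ')
      · exact hσ

theorem flow_flow {Z : E → E} (hZ : ContDiff ℝ 1 Z) {t₀ : ℝ} (ht₀ : 0 ≤ t₀) {x : E}
    (h : ∀ τ, |τ| ≤ t₀ → FlowDefined Z τ x) {a b : ℝ} (ha : |a| ≤ t₀) (hb : |b| ≤ t₀) :
    FlowTo Z (b - a) (flow Z a x) (flow Z b x) := by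
  have := flowTo_of_hasDerivWithinAt (c := 1) one_ne_zero ordConnected_Icc
    (fun τ hτ => by simpa using (hasDerivWithinAt_flow hZ ht₀ h).2 τ hτ) (abs_le.1 ha)
    (abs_le.1 hb)
  rwa [one_mul] at this

/-! ### Points from which all short compositions of flows exist -/

variable {m : ℕ}

/-- All compositions of at most `M` flows from `x`, for times at most `t₀`, stay in `Ω₀`. -/
def Good (f : Fin m → E → E) (t₀ : ℝ) (Ω₀ : Set E) (M : ℕ) (x : E) : Prop :=
  ∀ σ : List (Fin m × ℝ), σ.length ≤ M → (∀ p ∈ σ, |p.2| ≤ t₀) →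
    RunDefined f σ x ∧ run f σ x ∈ Ω₀

variable {f : Fin m → E → E} {t₀ : ℝ} {Ω₀ : Set E} {x : E} {M : ℕ}

omit [FiniteDimensional ℝ E] in
theorem Good.mono (h : Good f t₀ Ω₀ M x) {M' : ℕ} (hM : M' ≤ M) : Good f t₀ Ω₀ M' x :=
  fun σ hσ => h σ (hσ.trans hM)

omit [FiniteDimensional ℝ E] in
theorem Good.mem (h : Good f t₀ Ω₀ M x) : x ∈ Ω₀ := (h [] (by simp) (by simp)).2

omit [FiniteDimensional ℝ E] in
theorem Good.flowDefined (h : Good f t₀ Ω₀ (M + 1) x) (j : Fin m) {τ : ℝ} (hτ : |τ| ≤ t₀) :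
    FlowDefined (f j) τ x :=
  (h [(j, τ)] (by simp) (by simpa using hτ)).1.1

omit [FiniteDimensional ℝ E] in
theorem Good.flow (h : Good f t₀ Ω₀ (M + 1) x) (j : Fin m) {τ : ℝ} (hτ : |τ| ≤ t₀) :
    Good f t₀ Ω₀ M (HorizontalFields.flow (f j) τ x) := by
  intro σ hσ hp
  have := h ((j, τ) :: σ) (by simpa using hσ) (by simpa using ⟨hτ, fun a b => hp (a, b)⟩)
  exact ⟨this.1.2, this.2⟩

omit [FiniteDimensional ℝ E] in
theorem Good.run {σ : List (Fin m × ℝ)} (h : Good f t₀ Ω₀ (M + σ.length) x)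
    (hσ : ∀ p ∈ σ, |p.2| ≤ t₀) : Good f t₀ Ω₀ M (HorizontalFields.run f σ x) := by
  induction σ generalizing x with
  | nil => exact h
  | cons p σ ih =>
    refine ih (Good.flow (j := p.1) (τ := p.2) (by simpa [add_assoc] using h) ?_) ?_
    · exact hσ p (by simp)
    · exact fun q hq => hσ q (by simp [hq])

/-- The trajectory `σ ↦ e^{cσ X_j} x`. -/
theorem Good.hasDerivWithinAt (h : Good f t₀ Ω₀ (M + 1) x) {j : Fin m} (hf : ContDiff ℝ 1 (f j))
    (ht₀ : 0 ≤ t₀) {c : ℝ} (hc : |c| ≤ 1) {σ : ℝ} (hσ : σ ∈ Icc (-t₀) t₀) :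
    HasDerivWithinAt (fun σ => HorizontalFields.flow (f j) (c * σ) x)
      (c • f j (HorizontalFields.flow (f j) (c * σ) x)) (Icc (-t₀) t₀) σ := by
  have hmaps : MapsTo (fun σ => c * σ) (Icc (-t₀) t₀) (Icc (-t₀) t₀) := by
    intro σ hσ
    rw [mem_Icc, ← abs_le] at hσ ⊢
    rw [abs_mul]
    calc |c| * |σ| ≤ 1 * t₀ := mul_le_mul hc hσ (abs_nonneg _) zero_le_one
      _ = t₀ := one_mul _
  have h1 := (hasDerivWithinAt_flow hf ht₀ (x := x) fun τ hτ => h.flowDefined j hτ).2 _ (hmaps hσ)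
  have h2 : HasDerivWithinAt (fun σ => c * σ) c (Icc (-t₀) t₀) σ := by
    simpa using ((hasDerivAt_id σ).const_mul c).hasDerivWithinAt
  exact h1.scomp σ h2 hmaps

theorem Good.flow_zero (h : Good f t₀ Ω₀ (M + 1) x) {j : Fin m} (hf : ContDiff ℝ 1 (f j))
    (ht₀ : 0 ≤ t₀) : HorizontalFields.flow (f j) 0 x = x :=
  (hasDerivWithinAt_flow hf ht₀ (x := x) fun _ hτ => h.flowDefined j hτ).1

theorem Good.flowTo (h : Good f t₀ Ω₀ (M + 1) x) {j : Fin m} (hf : ContDiff ℝ 1 (f j))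
    (ht₀ : 0 ≤ t₀) {a b : ℝ} (ha : |a| ≤ t₀) (hb : |b| ≤ t₀) :
    FlowTo (f j) (b - a) (HorizontalFields.flow (f j) a x) (HorizontalFields.flow (f j) b x) :=
  flow_flow hf ht₀ (fun _ hτ => h.flowDefined j hτ) ha hb

/-- A function which has a derivative along the flow at the points of a trajectory is
differentiable along the trajectory. -/
theorem Good.hasDerivWithinAt_comp {F : Type*} [NormedAddCommGroup F] [NormedSpace ℝ F]
    (h : Good f t₀ Ω₀ (M + 1) x) {j : Fin m} (hf : ContDiff ℝ 1 (f j)) (ht₀ : 0 ≤ t₀) {c : ℝ}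
    (hc : |c| ≤ 1) {σ : ℝ} (hσ : σ ∈ Icc (-t₀) t₀) {g : E → F} {g' : F}
    (hg : HasDerivAt (fun τ => g (HorizontalFields.flow (f j) τ
      (HorizontalFields.flow (f j) (c * σ) x))) g' 0) :
    HasDerivWithinAt (fun σ => g (HorizontalFields.flow (f j) (c * σ) x)) (c • g')
      (Icc (-t₀) t₀) σ := by
  have hmaps : ∀ σ ∈ Icc (-t₀) t₀, |c * σ| ≤ t₀ := by
    intro σ hσ
    rw [mem_Icc, ← abs_le] at hσ
    rw [abs_mul]
    calc |c| * |σ| ≤ 1 * t₀ := mul_le_mul hc hσ (abs_nonneg _) zero_le_one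
      _ = t₀ := one_mul _
  have h2 : HasDerivAt (fun τ => c * τ - c * σ) c σ := by
    simpa using ((hasDerivAt_id σ).const_mul c).sub_const (c * σ)
  have h0 : c * σ - c * σ = 0 := sub_self _
  rw [← h0] at hg
  have h3 := (HasDerivAt.scomp (h := fun τ => c * τ - c * σ) σ hg h2).hasDerivWithinAt
    (s := Icc (-t₀) t₀)
  refine h3.congr_of_mem (fun τ hτ => ?_) hσ
  simp only [Function.comp_apply]
  rw [(h.flowTo hf ht₀ (hmaps σ hσ) (hmaps τ hτ)).flow_eq hf]

/-! ### The distance -/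

omit [FiniteDimensional ℝ E] in
theorem runDefined_append (L L' : List (Fin m × ℝ)) (x : E) :
    RunDefined f (L ++ L') x ↔ RunDefined f L x ∧ RunDefined f L' (run f L x) := by
  induction L generalizing x with
  | nil => simp [RunDefined, run]
  | cons p L ih => simp [RunDefined, run, ih, and_assoc]

theorem run_smul (hf : ∀ j, ContDiff ℝ 1 (f j)) {r : ℝ} (hr : r ≠ 0) (L : List (Fin m × ℝ))
    (x : E) (h : RunDefined f L x) :
    RunDefined (fun j => r • f j) (L.map fun p => (p.1, p.2 / r)) x ∧
      run (fun j => r • f j) (L.map fun p => (p.1, p.2 / r)) x = run f L x := by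
  induction L generalizing x with
  | nil => exact ⟨trivial, rfl⟩
  | cons p L ih =>
    have h1 := h.1.flowTo.smul hr
    have h2 : flow (r • f p.1) (p.2 / r) x = flow (f p.1) p.2 x :=
      h1.flow_eq ((hf p.1).const_smul r)
    have h3 := ih _ h.2
    simp only [List.map_cons, RunDefined, run]
    rw [h2]
    exact ⟨⟨h1.flowDefined, h3.1⟩, h3.2⟩

theorem run_invSteps (hf : ∀ j, ContDiff ℝ 1 (f j)) (L : List (Fin m × ℝ)) (x : E)
    (h : RunDefined f L x) :
    RunDefined f (invSteps L) (run f L x) ∧ run f (invSteps L) (run f L x) = x := by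
  induction L generalizing x with
  | nil => exact ⟨trivial, rfl⟩
  | cons p L ih =>
    have h1 := ih _ h.2
    have h2 := h.1.flowTo.symm
    have e : invSteps (p :: L) = invSteps L ++ [(p.1, -p.2)] := by simp [invSteps]
    rw [e, runDefined_append, run_append, run, h1.2]
    exact ⟨⟨h1.1, h2.flowDefined, trivial⟩, h2.flow_eq (hf p.1)⟩

/-- Dividing all times by $r$ and multiplying the fields by $r$ leaves the end point unchanged and
makes the total time at most $1$. -/
theorem hdist_run_le (hf : ∀ j, ContDiff ℝ 1 (f j)) (L : List (Fin m × ℝ)) (x : E)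
    (h : RunDefined f L x) {r : ℝ} (hr : 0 < r) (hL : (L.map fun p => |p.2|).sum ≤ r) :
    hdist f x (run f L x) ≤ ENNReal.ofReal r := by
  have h1 := run_smul hf hr.ne' L x h
  refine iInf₂_le_of_le r ⟨hr, _, ?_, h1.1, h1.2⟩ le_rfl
  have e : ((L.map fun p => (p.1, p.2 / r)).map fun p => |p.2|).sum =
      (L.map fun p => |p.2|).sum / r := by
    rw [List.map_map, div_eq_mul_inv, ← List.sum_map_mul_right]
    congr 1
    refine List.map_congr_left fun p _ => ?_
    simp [abs_of_pos hr, div_eq_mul_inv]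
  rw [e, div_le_one hr]
  exact hL

theorem hdist_run_le' (hf : ∀ j, ContDiff ℝ 1 (f j)) (L : List (Fin m × ℝ)) (x : E)
    (h : RunDefined f L x) {r : ℝ} (hr : 0 < r) (hL : (L.map fun p => |p.2|).sum ≤ r) :
    hdist f (run f L x) x ≤ ENNReal.ofReal r := by
  have h1 := run_invSteps hf L x h
  have h2 := hdist_run_le hf (invSteps L) (run f L x) h1.1 hr (by
    refine le_trans (le_of_eq ?_) hL
    simp [invSteps, Function.comp_def])
  rwa [h1.2] at h2

theorem FlowTo.hdist_le (hf : ∀ j, ContDiff ℝ 1 (f j)) {j : Fin m} {τ r : ℝ} {x y : E}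
    (h : FlowTo (f j) τ x y) (hr : 0 < r) (hτ : |τ| ≤ r) : hdist f x y ≤ ENNReal.ofReal r := by
  have := hdist_run_le hf [(j, τ)] x ⟨h.flowDefined, trivial⟩ hr (by simpa using hτ)
  rwa [run, run, h.flow_eq (hf j)] at this

-- The estimate is stated with real upper bounds $r$ of the distance, which avoids dividing by an
-- infimum that may be $0$ or $\infty$.
omit [FiniteDimensional ℝ E] in
theorem exists_norm_sub_le_of_dLip {F : Type*} [NormedAddCommGroup F] {g : E → F}
    [NormedSpace ℝ F] {A : Set E} (h : dLip f g A < ∞) :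
    ∃ K : ℝ, 0 ≤ K ∧ ∀ x ∈ A, ∀ y ∈ A, ∀ r : ℝ, 0 < r → hdist f x y ≤ ENNReal.ofReal r →
      ‖g x - g y‖ ≤ K * r := by
  refine ⟨(dLip f g A).toReal, ENNReal.toReal_nonneg, fun x hx y hy r hr hd => ?_⟩
  rcases eq_or_ne x y with rfl | hxy
  · rw [sub_self, norm_zero]
    have := ENNReal.toReal_nonneg (a := dLip f g A)
    positivity
  · have h1 : ‖g x - g y‖ₑ / hdist f x y ≤ dLip f g A :=
      le_iSup₂_of_le x hx (le_iSup₂_of_le y hy (le_iSup_of_le hxy le_rfl))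
    have h2 : ‖g x - g y‖ₑ ≤ dLip f g A * hdist f x y :=
      (ENNReal.div_le_iff_le_mul (Or.inr h.ne)
        (Or.inl (hd.trans_lt ENNReal.ofReal_lt_top).ne)).1 h1
    have h3 : ‖g x - g y‖ₑ ≤ ENNReal.ofReal ((dLip f g A).toReal * r) := by
      refine h2.trans ?_
      rw [ENNReal.ofReal_mul ENNReal.toReal_nonneg, ENNReal.ofReal_toReal h.ne]
      gcongr
    rw [← ofReal_norm] at h3
    refine (ENNReal.ofReal_le_ofReal_iff ?_).1 h3
    have := ENNReal.toReal_nonneg (a := dLip f g A)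
    positivity

end FlowLemmas

/-! ### The horizontal Taylor formula -/

section Taylor

variable {m : ℕ}

/-- The composition of the flows in the list, with all times multiplied by `t`. -/
def scaleSteps (t : ℝ) (σ : List (Fin m × ℝ)) : List (Fin m × ℝ) :=
  σ.map fun p => (p.1, p.2 * t)

theorem scaleSteps_append (t : ℝ) (σ σ' : List (Fin m × ℝ)) :
    scaleSteps t (σ ++ σ') = scaleSteps t σ ++ scaleSteps t σ' := by
  simp [scaleSteps]

theorem length_scaleSteps (t : ℝ) (σ : List (Fin m × ℝ)) :
    (scaleSteps t σ).length = σ.length := by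
  simp [scaleSteps]

theorem invSteps_scaleSteps (t : ℝ) (σ : List (Fin m × ℝ)) :
    invSteps (scaleSteps t σ) = scaleSteps t (invSteps σ) := by
  simp [scaleSteps, invSteps, List.map_reverse]

theorem length_invSteps (σ : List (Fin m × ℝ)) : (invSteps σ).length = σ.length := by
  simp [invSteps]

theorem cSteps_eq_scaleSteps (w : List (Fin m)) (t : ℝ) :
    cSteps w t = scaleSteps t (cSteps w 1) := by
  induction w with
  | nil => rfl
  | cons a w ih =>
    cases w with
    | nil => simp [cSteps, scaleSteps]
    | cons b v =>
      rw [cSteps_cons_cons, cSteps_cons_cons, ih, scaleSteps_append, scaleSteps_append,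
        scaleSteps_append, invSteps_scaleSteps]
      simp [scaleSteps]

theorem abs_of_mem_invSteps {σ : List (Fin m × ℝ)} (h : ∀ p ∈ σ, |p.2| = 1) :
    ∀ p ∈ invSteps σ, |p.2| = 1 := by
  intro p hp
  simp only [invSteps, List.mem_reverse, List.mem_map] at hp
  obtain ⟨q, hq, rfl⟩ := hp
  simpa using h q hq

theorem abs_of_mem_cSteps (w : List (Fin m)) : ∀ p ∈ cSteps w 1, |p.2| = 1 := by
  induction w with
  | nil => simp [cSteps]
  | cons a w ih =>
    cases w with
    | nil => simp [cSteps]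
    | cons b v =>
      intro p hp
      rw [cSteps_cons_cons, List.mem_append, List.mem_append, List.mem_append] at hp
      rcases hp with ((hp | hp) | hp) | hp
      · simp_all
      · exact ih p hp
      · simp_all
      · exact abs_of_mem_invSteps ih p hp

theorem abs_of_mem_scaleSteps {σ : List (Fin m × ℝ)} (h : ∀ p ∈ σ, |p.2| = 1) {t t₀ : ℝ}
    (ht : t ∈ Icc 0 t₀) : ∀ p ∈ scaleSteps t σ, |p.2| ≤ t₀ := by
  intro p hp
  simp only [scaleSteps, List.mem_map] at hp
  obtain ⟨q, hq, rfl⟩ := hp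
  rw [abs_mul, h q hq, one_mul, abs_of_nonneg ht.1]
  exact ht.2

theorem sum_abs_scaleSteps {σ : List (Fin m × ℝ)} (h : ∀ p ∈ σ, |p.2| = 1) {t : ℝ}
    (ht : 0 ≤ t) : ((scaleSteps t σ).map fun p => |p.2|).sum = σ.length * t := by
  induction σ with
  | nil => simp [scaleSteps]
  | cons p σ ih =>
    have h1 := ih fun q hq => h q (by simp [hq])
    simp only [scaleSteps, List.map_cons, List.sum_cons, List.length_cons] at h1 ⊢
    rw [h1, abs_mul, h p (by simp), abs_of_nonneg ht]
    push_cast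
    ring

theorem sum_range_sum_antidiagonal {V : Type*} [AddCommMonoid V] (F : ℕ → ℕ → V) (r : ℕ) :
    ∑ N ∈ Finset.range (r + 1), ∑ p ∈ Finset.HasAntidiagonal.antidiagonal N, F p.2 p.1 =
      ∑ i ∈ Finset.range (r + 1), ∑ n ∈ Finset.range (r - i + 1), F i n := by
  have h : ∀ N, ∑ p ∈ Finset.HasAntidiagonal.antidiagonal N, F p.2 p.1 =
      ∑ k ∈ Finset.range (N + 1), F k (N - k) := by
    intro N
    rw [← Finset.Nat.sum_antidiagonal_eq_sum_range_succ,
      ← Finset.Nat.sum_antidiagonal_swap]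
    rfl
  simp only [h]
  rw [Finset.sum_range_diag_flip]
  refine Finset.sum_congr rfl fun i hi => ?_
  rw [Finset.mem_range] at hi
  congr 2
  omega

/-- The Cauchy product, sorted by the number $i$ of letters taken from the last exponential. This is
the formal counterpart of expanding first along the last flow and then along the others. -/
theorem pair_coeff_mul_pexp {V : Type*} [AddCommGroup V] [Module ℝ V] (h : List (Fin m) → V)
    (P : PowerSeries (FreeAlgebra ℝ (Fin m))) (c t : ℝ) (j : Fin m) (u : List (Fin m)) (r : ℕ) :
    ∑ n ∈ Finset.range (r + 1), t ^ n • pair h (PowerSeries.coeff n (P * pexp c (gen j)) * monom u)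
      = ∑ i ∈ Finset.range (r + 1), ((c * t) ^ i / (i.factorial : ℝ)) •
        ∑ n ∈ Finset.range (r - i + 1),
          t ^ n • pair h (PowerSeries.coeff n P * monom (List.replicate i j ++ u)) := by
  have := sum_range_sum_antidiagonal (fun i n => (t ^ (n + i) * (c ^ i / (i.factorial : ℝ))) •
    pair h (PowerSeries.coeff n P * monom (List.replicate i j ++ u))) r
  calc _ = _ := ?_
    _ = _ := this
    _ = _ := ?_
  · refine Finset.sum_congr rfl fun N _ => ?_
    rw [PowerSeries.coeff_mul, Finset.sum_mul, map_sum, Finset.smul_sum]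
    refine Finset.sum_congr rfl fun p hp => ?_
    rw [Finset.HasAntidiagonal.mem_antidiagonal] at hp
    rw [coeff_pexp, mul_smul_comm, smul_mul_assoc, map_smul, smul_smul, hp, mul_assoc, monom_append,
      monom_replicate]
  · refine Finset.sum_congr rfl fun i _ => ?_
    rw [Finset.smul_sum]
    refine Finset.sum_congr rfl fun n _ => ?_
    rw [smul_smul]
    congr 1
    ring

variable {E : Type*} [NormedAddCommGroup E] [NormedSpace ℝ E] [FiniteDimensional ℝ E]
  {F : Type*} [NormedAddCommGroup F] [NormedSpace ℝ F]
  {f : Fin m → E → E} {t₀ : ℝ} {Ω₀ : Set E}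

omit [FiniteDimensional ℝ E] in
theorem run_scaleSteps_concat (σ : List (Fin m × ℝ)) (j : Fin m) (c t : ℝ) (x : E) :
    run f (scaleSteps t (σ ++ [(j, c)])) x =
      flow (f j) (c * t) (run f (scaleSteps t σ) x) := by
  rw [scaleSteps_append, run_append]
  rfl

/-- The horizontal Taylor formula: expansion of a function along a composition of flows. -/
theorem horizontal_taylor (hf : ∀ j, ContDiff ℝ 1 (f j)) (ht₀ : 0 < t₀)
    (J : List (Fin m) → E → F) (k : ℕ)
    (hJ : ∀ u : List (Fin m), u.length < k → ∀ j x, Good f t₀ Ω₀ 1 x →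
      HasDerivAt (fun τ => J u (flow (f j) τ x)) (J (j :: u) x) 0)
    (hJc : ∀ u : List (Fin m), u.length = k → DContinuous f (J u))
    (σ : List (Fin m × ℝ)) (hσ : ∀ p ∈ σ, |p.2| = 1) (M : ℕ) (x : E)
    (hx : Good f t₀ Ω₀ (M + 1 + σ.length) x) (r : ℕ) (u : List (Fin m)) (hu : u.length + r = k) :
    (fun t => J u (run f (scaleSteps t σ) x) - ∑ n ∈ Finset.range (r + 1),
      t ^ n • pair (fun v => J v x) (PowerSeries.coeff n (flowSeries σ) * monom u))
      =o[𝓝[>] (0 : ℝ)] fun t => t ^ r := by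
  induction σ using List.reverseRecOn generalizing M r u with
  | nil =>
    have : (fun t : ℝ => J u (run f (scaleSteps t []) x) - ∑ n ∈ Finset.range (r + 1),
        t ^ n • pair (fun v => J v x) (PowerSeries.coeff n (flowSeries []) * monom u)) =
        fun _ => 0 := by
      funext t
      rw [flowSeries_nil, Finset.sum_eq_single 0]
      · simp [pair_monom, scaleSteps, run]
      · intro n _ hn
        simp [PowerSeries.coeff_one, hn]
      · simp
    rw [this]
    exact Asymptotics.isLittleO_zero _ _
  | append_singleton σ p ih =>
    obtain ⟨j, c⟩ := p
    have hσ' : ∀ p ∈ σ, |p.2| = 1 := fun p hp => hσ p (by simp [hp])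
    have hc : |c| = 1 := hσ (j, c) (by simp)
    have hx' : Good f t₀ Ω₀ (M + 1 + 1 + σ.length) x := hx.mono (by simp; omega)
    have ih' := fun r u hu => ih hσ' (M + 1) hx' r u hu
    set z : ℝ → E := fun t => run f (scaleSteps t σ) x with hz
    have hzG : ∀ t ∈ Icc 0 t₀, Good f t₀ Ω₀ (M + 1 + 1) (z t) := fun t ht =>
      Good.run (σ := scaleSteps t σ) (by rwa [length_scaleSteps])
        (abs_of_mem_scaleSteps hσ' ht)
    -- Taylor's formula along the last flow, started at the moving point $z(t)$. Every point
    -- involved has distance at most $(|\sigma|+1)t$ from $x$, so $d$-continuity of the functions of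
    -- order $k$ at $x$ makes the error $o(t^r)$.
    have hsmall : (fun t => J u (flow (f j) (c * t) (z t)) - ∑ i ∈ Finset.range (r + 1),
        ((c * t) ^ i / (i.factorial : ℝ)) • J (List.replicate i j ++ u) (z t))
        =o[𝓝[>] (0 : ℝ)] fun t => t ^ r := by
      rw [Asymptotics.isLittleO_iff]
      intro ε hε
      have hev : ∀ v ∈ words m k k, ∀ᶠ t in 𝓝[>] (0 : ℝ), ∀ τ ∈ Icc 0 t,
          ‖J v (flow (f j) (c * τ) (z t)) - J v x‖ < ε / 2 := by
        intro v hv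
        obtain ⟨δ, hδ, h⟩ := hJc v (le_antisymm (mem_words.1 hv).2 (mem_words.1 hv).1) x (ε / 2)
          (by positivity)
        have hδ' : 0 < min t₀ (δ / (σ.length + 2)) := by positivity
        filter_upwards [Ioo_mem_nhdsGT hδ'] with t ht τ hτ
        have htt : t ≤ t₀ := (ht.2.trans_le (min_le_left _ _)).le
        apply h
        have hrun := hx' (scaleSteps t σ) (by rw [length_scaleSteps]; omega)
          (abs_of_mem_scaleSteps hσ' ⟨ht.1.le, htt⟩)
        have hfl := (hzG t ⟨ht.1.le, htt⟩).flowDefined j (τ := c * τ) (by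
          rw [abs_mul, hc, one_mul, abs_of_nonneg hτ.1]; exact hτ.2.trans htt)
        have hd := hdist_run_le' hf (scaleSteps t σ ++ [(j, c * τ)]) x
          ((runDefined_append _ _ _).2 ⟨hrun.1, hfl, trivial⟩) (r := (σ.length + 1) * t)
          (by have := ht.1; positivity) (by
            rw [List.map_append, List.sum_append, sum_abs_scaleSteps hσ' ht.1.le]
            simp only [List.map_cons, List.map_nil, List.sum_cons, List.sum_nil, add_zero]
            rw [abs_mul, hc, one_mul, abs_of_nonneg hτ.1]
            linarith [hτ.2])
        rw [run_append] at hd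
        refine lt_of_le_of_lt hd ?_
        rw [ENNReal.ofReal_lt_ofReal_iff hδ]
        have h2 : t < δ / (σ.length + 2) := ht.2.trans_le (min_le_right _ _)
        rw [lt_div_iff₀ (by positivity)] at h2
        nlinarith [ht.1]
      rw [← Finset.eventually_all] at hev
      filter_upwards [hev, Ioo_mem_nhdsGT ht₀] with t ht htt
      have hG := hzG t ⟨htt.1.le, htt.2.le⟩
      have hsub : Icc 0 t ⊆ Icc (-t₀) t₀ := Icc_subset_Icc (by linarith) htt.2.le
      have hfl0 : flow (f j) (c * 0) (z t) = z t := by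
        rw [mul_zero]; exact hG.flow_zero (hf j) ht₀.le
      have := jet_taylor (fun v τ => J v (flow (f j) (c * τ) (z t))) hc.le j 0 k hε.le (t := t)
        (fun v _ hv τ hτ => (hG.hasDerivWithinAt_comp (hf j) ht₀.le hc.le (hsub hτ)
          (hJ v hv j _ ((hG.flow j (by
            rw [abs_mul, hc, one_mul, abs_of_nonneg hτ.1]
            exact hτ.2.trans htt.2.le)).mono (by omega)))).mono hsub)
        (fun v _ hv τ hτ => by
          have hw : v ∈ words m k k := mem_words.2 ⟨hv.ge, hv.le⟩
          have h1 := ht v hw τ hτ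
          have h2 := ht v hw 0 (left_mem_Icc.2 htt.1.le)
          calc _ = ‖(J v (flow (f j) (c * τ) (z t)) - J v x) -
                (J v (flow (f j) (c * 0) (z t)) - J v x)‖ := by rw [sub_sub_sub_cancel_right]
            _ ≤ _ := norm_sub_le _ _
            _ ≤ ε := by linarith)
        r u (Nat.zero_le _) hu t (right_mem_Icc.2 htt.1.le)
      simp only [hfl0] at this
      rw [Real.norm_of_nonneg (by have := htt.1; positivity)]
      exact this
    -- The Taylor coefficients at $z(t)$ are expanded at $x$ by the induction hypothesis. Order
    -- $r-i$ suffices for the $i$-th one, since it carries the factor $t^i$.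
    have hsum : (fun t => ∑ i ∈ Finset.range (r + 1), ((c * t) ^ i / (i.factorial : ℝ)) •
        (J (List.replicate i j ++ u) (z t) - ∑ n ∈ Finset.range (r - i + 1),
          t ^ n • pair (fun v => J v x)
            (PowerSeries.coeff n (flowSeries σ) * monom (List.replicate i j ++ u))))
        =o[𝓝[>] (0 : ℝ)] fun t => t ^ r := by
      refine Asymptotics.IsLittleO.fun_sum fun i hi => ?_
      rw [Finset.mem_range] at hi
      have h1 := ih' (r - i) (List.replicate i j ++ u) (by simp; omega)
      have h2 : (fun t : ℝ => (c * t) ^ i / (i.factorial : ℝ)) =O[𝓝[>] (0 : ℝ)]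
          fun t => t ^ i := by
        refine Asymptotics.IsBigO.of_bound 1 (Eventually.of_forall fun t => ?_)
        rw [norm_div, norm_pow, norm_mul, Real.norm_eq_abs c, hc, one_mul, one_mul, norm_pow]
        refine div_le_self (pow_nonneg (norm_nonneg t) i) ?_
        rw [Real.norm_natCast]
        exact_mod_cast Nat.one_le_iff_ne_zero.2 (Nat.factorial_ne_zero i)
      refine (h2.smul_isLittleO h1).congr_right fun t => ?_
      rw [smul_eq_mul, ← pow_add]
      congr 1
      omega
    refine (hsmall.add hsum).congr_left fun t => ?_
    have hfs : flowSeries (σ ++ [(j, c)]) = flowSeries σ * pexp c (gen j) := by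
      rw [flowSeries_append, flowSeries_singleton]
    rw [hfs, pair_coeff_mul_pexp, run_scaleSteps_concat]
    simp only [smul_sub, Finset.sum_sub_distrib]
    abel

/-! ### Derivatives of the coefficients along commutators -/

omit [FiniteDimensional ℝ E] in
theorem coeff_concat (v : List (Fin m)) (j : Fin m) : coeff f (v ++ [j]) = iterLie f v (f j) := by
  induction v with
  | nil => rfl
  | cons a v ih =>
    cases v with
    | nil => rfl
    | cons b v =>
      rw [iterLie, ← ih]
      rfl

omit [FiniteDimensional ℝ E] in
theorem coeff_cons {v : List (Fin m)} (hv : v ≠ []) (j : Fin m) :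
    coeff f (j :: v) = lieDeriv (f j) (coeff f v) := by
  cases v with
  | nil => exact absurd rfl hv
  | cons a v => rfl

-- The last letter of $v$ selects the field and the others are derivatives, so regularity of order
-- $s-1$ of the fields covers words of length up to $s$.
omit [FiniteDimensional ℝ E] in
theorem coeff_regularity {s : ℕ} (hH : ∀ j, HContDiffLip f (s - 1) (f j)) {v : List (Fin m)}
    (hv : v ≠ []) :
    (v.length < s → ∀ j x, HasDerivAt (fun τ => coeff f v (flow (f j) τ x))
      (coeff f (j :: v) x) 0) ∧
    (v.length ≤ s → DContinuous f (coeff f v)) ∧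
    (v.length = s → ∀ A, Bornology.IsBounded A → dLip f (coeff f v) A < ∞) := by
  obtain ⟨v', j, rfl⟩ : ∃ v' j, v = v' ++ [j] := ⟨_, _, (List.dropLast_append_getLast hv).symm⟩
  rw [List.length_append, List.length_singleton]
  refine ⟨fun h i x => ?_, fun h => ?_, fun h => ?_⟩
  · rw [coeff_cons hv, coeff_concat]
    exact ((hH j).1.1 v' (by omega) i x).hasDerivAt
  · rw [coeff_concat]
    exact (hH j).1.2 v' (by omega)
  · rw [coeff_concat]
    exact (hH j).2 v' (by omega)

theorem length_of_mem_expansion {w : List (Fin m)} {p : ℤ × List (Fin m)}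
    (hp : p ∈ expansion w) : p.2.length = w.length := by
  induction w generalizing p with
  | nil => simp [expansion] at hp
  | cons a w ih =>
    cases w with
    | nil => simp only [expansion, List.mem_singleton] at hp; simp [hp]
    | cons b v =>
      simp only [expansion, List.mem_append, List.mem_map] at hp
      rcases hp with ⟨q, hq, rfl⟩ | ⟨q, hq, rfl⟩ <;> simp [ih hq]

theorem pair_nestedBracket {V : Type*} [AddCommGroup V] [Module ℝ V] (h : List (Fin m) → V)
    (w : List (Fin m)) :
    pair h (nestedBracket gen w) = ((expansion w).map fun p => p.1 • h p.2).sum := by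
  rw [nestedBracket_eq_expansion, map_list_sum, List.map_map]
  congr 1
  refine List.map_congr_left fun p _ => ?_
  rw [Function.comp_apply, map_zsmul]
  congr 1
  exact pair_monom h p.2

-- The bridge between algebra and geometry: commutators depend only on the image under `nest`, so
-- identities between formal brackets become identities between the vectors $f_v$.
omit [FiniteDimensional ℝ E] in
theorem pair_nest_coeff (x : E) (S : FreeAlgebra ℝ (Fin m)) :
    pair (fun v => coeff f v x) (nest m S) = pair (fun v => commVec f v x) S := by
  have : (pair (fun v => coeff f v x)).comp (nest m) = pair (fun v => commVec f v x) := by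
    apply linearMap_ext_monom
    intro v
    rw [LinearMap.comp_apply, nest, pair_monom, pair_monom, pair_nestedBracket]
    rfl
  exact LinearMap.congr_fun this S

/-- The leading term of the Taylor expansion along a commutator of flows. -/
theorem horizontal_taylor_cSteps (hf : ∀ j, ContDiff ℝ 1 (f j)) (ht₀ : 0 < t₀)
    (J : List (Fin m) → E → F) (w : List (Fin m)) (hw : w ≠ [])
    (hJ : ∀ u : List (Fin m), u.length < w.length → ∀ j x, Good f t₀ Ω₀ 1 x →
      HasDerivAt (fun τ => J u (flow (f j) τ x)) (J (j :: u) x) 0)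
    (hJc : ∀ u : List (Fin m), u.length = w.length → DContinuous f (J u)) (x : E)
    (hx : Good f t₀ Ω₀ (1 + (cSteps w 1).length) x) :
    (fun t => J [] (cMap f w t x) - J [] x -
      t ^ w.length • ((expansion w).map fun p => p.1 • J p.2 x).sum)
      =o[𝓝[>] (0 : ℝ)] fun t => t ^ w.length := by
  have h := horizontal_taylor hf ht₀ J w.length hJ hJc (cSteps w 1) (abs_of_mem_cSteps w) 0 x
    (by simpa using hx) w.length [] (by simp)
  obtain ⟨Y, hY, hY0⟩ := exists_flowSeries_cSteps w hw
  have hk : w.length ≠ 0 := by simpa using hw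
  obtain ⟨h0, hi, hl⟩ := coeff_one_add_X_pow_mul hk Y
  refine h.congr_left fun t => ?_
  rw [← cSteps_eq_scaleSteps, hY, sub_sub]
  congr 1
  rw [Finset.sum_range_succ, Finset.sum_eq_single_of_mem 0 (by simp; omega), h0, hl, hY0]
  · simp only [monom_nil, mul_one, pow_zero, one_smul, pair_nestedBracket]
    congr 1
    exact pair_monom (fun v => J v x) []
  · intro i hi1 hi2
    rw [hi i (by omega) (by simpa using hi1), zero_mul, map_zero, smul_zero]

/-- `X_w^♯ f_j = f_w · ∇ f_j`. -/
theorem fderiv_commVec (hf : ∀ j, ContDiff ℝ 1 (f j)) (ht₀ : 0 < t₀) {s : ℕ}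
    (hH : ∀ j, HContDiffLip f (s - 1) (f j)) (w : List (Fin m)) (hw : w ≠ []) (hws : w.length < s)
    (x : E) (hx : Good f t₀ Ω₀ (1 + (cSteps w 1).length) x) (j : Fin m) :
    fderiv ℝ (f j) x (commVec f w x) =
      ((expansion w).map fun p => p.1 • coeff f (p.2 ++ [j]) x).sum := by
  set A := ((expansion w).map fun p => p.1 • coeff f (p.2 ++ [j]) x).sum with hA
  set k := w.length with hk
  have hk0 : k ≠ 0 := by simpa [hk] using hw
  have h1 := horizontal_taylor_cSteps hf ht₀ (fun v => coeff f (v ++ [j])) w hw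
    (fun u hu i y _ => by
      have := (coeff_regularity hH (v := u ++ [j]) (by simp)).1 (by simp; omega) i y
      exact this)
    (fun u hu => (coeff_regularity hH (v := u ++ [j]) (by simp)).2.1 (by simp; omega)) x hx
  -- The jet of the identity map: $X_j^\sharp\mathrm{id}=f_j$, and further derivatives give the
  -- functions $X_{v_1}^\sharp\cdots X_{v_{p-1}}^\sharp f_{v_p}$. Its Taylor formula reads
  -- $C_tx=x+t^kf_w(x)+o(t^k)$.
  let J : List (Fin m) → E → E := fun v => if v = [] then id else coeff f v
  have h2 := horizontal_taylor_cSteps hf ht₀ J w hw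
    (fun u hu i y hy => by
      by_cases hu0 : u = []
      · subst hu0
        have h3 := (hy.hasDerivWithinAt (M := 0) (hf i) ht₀.le (c := 1) (by simp) (σ := 0)
          ⟨by linarith, ht₀.le⟩).hasDerivAt (Icc_mem_nhds (by linarith) ht₀)
        simp only [one_mul, one_smul, hy.flow_zero (M := 0) (hf i) ht₀.le] at h3
        simpa [J, coeff] using h3
      · have := (coeff_regularity hH (v := u) hu0).1 (by omega) i y
        simpa [J, hu0] using this)
    (fun u hu => by
      have hu0 : u ≠ [] := by
        rintro rfl
        exact hk0 hu.symm
      simp only [J, if_neg hu0]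
      exact (coeff_regularity hH hu0).2.1 (by omega)) x hx
  have hcv : ((expansion w).map fun p => p.1 • J p.2 x).sum = commVec f w x := by
    rw [commVec]
    congr 1
    refine List.map_congr_left fun p hp => ?_
    have : p.2 ≠ [] := by
      intro h
      have := length_of_mem_expansion hp
      rw [h] at this
      exact hk0 this.symm
    simp only [J, if_neg this]
  rw [hcv] at h2
  simp only [J, if_true, id_eq] at h2
  simp only [List.nil_append] at h1
  have h1' : (fun t => f j (cMap f w t x) - f j x - t ^ k • A)
      =o[𝓝[>] (0 : ℝ)] fun t => t ^ k := h1
  have hO : (fun t => cMap f w t x - x) =O[𝓝[>] (0 : ℝ)] fun t => t ^ k := by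
    have h3 : (fun t : ℝ => t ^ k • commVec f w x) =O[𝓝[>] (0 : ℝ)] fun t => t ^ k := by
      refine Asymptotics.IsBigO.of_bound ‖commVec f w x‖ (Eventually.of_forall fun t => ?_)
      rw [norm_smul, mul_comm]
    exact (h2.isBigO.add h3).congr_left fun t => by rw [sub_add_cancel]
  have htend : Tendsto (fun t => cMap f w t x) (𝓝[>] (0 : ℝ)) (𝓝 x) := by
    have h4 : Tendsto (fun t : ℝ => t ^ k) (𝓝[>] (0 : ℝ)) (𝓝 0) := by
      have : Tendsto (fun t : ℝ => t ^ k) (𝓝 0) (𝓝 (0 ^ k)) := (continuous_pow k).tendsto 0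
      rw [zero_pow hk0] at this
      exact this.mono_left nhdsWithin_le_nhds
    have h5 := hO.trans_tendsto h4
    simpa using h5.add_const x
  have hdf : HasFDerivAt (f j) (fderiv ℝ (f j) x) x :=
    ((hf j).differentiable one_ne_zero x).hasFDerivAt
  have h6 := (hdf.isLittleO.comp_tendsto htend).trans_isBigO hO
  have h7 : (fun t => fderiv ℝ (f j) x (cMap f w t x - x - t ^ k • commVec f w x))
      =o[𝓝[>] (0 : ℝ)] fun t => t ^ k :=
    ((fderiv ℝ (f j) x).isBigO_comp _ _).trans_isLittleO h2
  -- The field $f_j$ along $C_tx$ is expanded twice, horizontally and by its differential at $x$.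
  -- The difference of the two terms in $t^k$ must be $o(t^k)$, hence zero.
  have h8 : (fun t : ℝ => t ^ k • (fderiv ℝ (f j) x (commVec f w x) - A))
      =o[𝓝[>] (0 : ℝ)] fun t => t ^ k := by
    refine ((h1'.sub h6).sub h7).congr_left fun t => ?_
    simp only [Function.comp_apply, map_sub, map_smul, smul_sub]
    abel
  by_contra hne
  have hpos : 0 < ‖fderiv ℝ (f j) x (commVec f w x) - A‖ := norm_pos_iff.2 (sub_ne_zero.2 hne)
  have h9 := (Asymptotics.isLittleO_iff.1 h8 (half_pos hpos)).and self_mem_nhdsWithin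
  obtain ⟨t, ht, ht0⟩ := h9.exists
  have ht0' : (0 : ℝ) < t := ht0
  rw [norm_smul, mul_comm] at ht
  have h10 : 0 < ‖t ^ k‖ := norm_pos_iff.2 (pow_pos ht0' k).ne'
  have := le_of_mul_le_mul_right ht h10
  linarith

/-- `ad_{X_j} X_w = X_{jw}` for the short words. -/
theorem lieDeriv_commVec_sub (hf : ∀ j, ContDiff ℝ 1 (f j)) (ht₀ : 0 < t₀) {s : ℕ}
    (hH : ∀ j, HContDiffLip f (s - 1) (f j)) (w : List (Fin m)) (hw : w ≠ []) (hws : w.length < s)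
    (x : E) (hx : Good f t₀ Ω₀ (1 + (cSteps w 1).length) x) (j : Fin m) :
    HasDerivAt (fun τ => commVec f w (flow (f j) τ x))
      (commVec f (j :: w) x + fderiv ℝ (f j) x (commVec f w x)) 0 := by
  have hlist : ∀ Λ : List (ℤ × List (Fin m)), (∀ p ∈ Λ, p.2 ≠ [] ∧ p.2.length < s) →
      HasDerivAt (fun τ => (Λ.map fun p => p.1 • coeff f p.2 (flow (f j) τ x)).sum)
        ((Λ.map fun p => p.1 • coeff f (j :: p.2) x).sum) 0 := by
    intro Λ hΛ
    induction Λ with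
    | nil => simpa using hasDerivAt_const (0 : ℝ) (0 : E)
    | cons p Λ ih =>
      have h1 := hΛ p (by simp)
      have h2 := ((coeff_regularity hH h1.1).1 h1.2 j x).const_smul (p.1 : ℝ)
      simp only [List.map_cons, List.sum_cons]
      have h3 := HasDerivAt.fun_add h2 (ih fun q hq => hΛ q (by simp [hq]))
      simpa [Int.cast_smul_eq_zsmul] using h3
  have h := hlist (expansion w) fun p hp => by
    have := length_of_mem_expansion hp
    refine ⟨fun h0 => hw ?_, by omega⟩
    rw [h0] at this
    exact List.length_eq_zero_iff.1 this.symm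
  refine h.congr_deriv ?_
  rw [fderiv_commVec hf ht₀ hH w hw hws x hx j]
  obtain ⟨b, v, rfl⟩ := List.exists_cons_of_ne_nil hw
  rw [commVec]
  simp only [expansion, List.map_append, List.map_map, List.sum_append]
  -- In $X_{jw}=X_jX_w-X_wX_j$ the second half is $-X_w^\sharp f_j$, which cancels against
  -- $f_w\cdot\nabla f_j$.
  have e : ((expansion (b :: v)).map ((fun p => p.1 • coeff f p.2 x) ∘
      fun p => (-p.1, p.2 ++ [j]))).sum =
      -((expansion (b :: v)).map fun p => p.1 • coeff f (p.2 ++ [j]) x).sum := by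
    induction expansion (b :: v) with
    | nil => simp
    | cons p Λ ih =>
      simp only [List.map_cons, List.sum_cons, ih, Function.comp_apply, neg_smul, neg_add]
  rw [e, neg_add_cancel_right]
  rfl

end Taylor

/-! ### The differential of the flow -/

section Transport

variable {m : ℕ} {E : Type*} [NormedAddCommGroup E] [NormedSpace ℝ E] [FiniteDimensional ℝ E]
  {f : Fin m → E → E} {t₀ : ℝ} {Ω₀ : Set E}

/-- The operators `P σ` transport tangent vectors from the point `e^{cσ X_j} y` back to `y`. -/
def IsTransport (f : Fin m → E → E) (t₀ : ℝ) (j : Fin m) (c : ℝ) (y : E) (P : ℝ → E →L[ℝ] E) :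
    Prop :=
  P 0 = ContinuousLinearMap.id ℝ E ∧ ∀ σ ∈ Icc 0 t₀, HasDerivWithinAt P
    (-(c • (P σ).comp (fderiv ℝ (f j) (flow (f j) (c * σ) y)))) (Icc 0 t₀) σ

theorem abs_mul_le_of_mem {c σ : ℝ} (hc : |c| ≤ 1) (hσ : σ ∈ Icc 0 t₀) : |c * σ| ≤ t₀ := by
  rw [abs_mul, abs_of_nonneg hσ.1]
  exact (mul_le_of_le_one_left hσ.1 hc).trans hσ.2

theorem Good.hasDerivWithinAt_Icc {M : ℕ} {x : E} (h : Good f t₀ Ω₀ (M + 1) x) {j : Fin m}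
    (hf : ContDiff ℝ 1 (f j)) {c : ℝ} (hc : |c| ≤ 1) {σ : ℝ} (hσ : σ ∈ Icc 0 t₀) :
    HasDerivWithinAt (fun σ => HorizontalFields.flow (f j) (c * σ) x)
      (c • f j (HorizontalFields.flow (f j) (c * σ) x)) (Icc 0 t₀) σ := by
  have ht₀ : 0 ≤ t₀ := hσ.1.trans hσ.2
  have hsub : Icc 0 t₀ ⊆ Icc (-t₀) t₀ := Icc_subset_Icc_left (by linarith)
  exact (h.hasDerivWithinAt hf ht₀ hc (hsub hσ)).mono hsub

theorem Good.continuousOn {M : ℕ} {x : E} (h : Good f t₀ Ω₀ (M + 1) x) {j : Fin m}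
    (hf : ContDiff ℝ 1 (f j)) {c : ℝ} (hc : |c| ≤ 1) :
    ContinuousOn (fun σ => HorizontalFields.flow (f j) (c * σ) x) (Icc 0 t₀) :=
  fun _ hσ => (h.hasDerivWithinAt_Icc hf hc hσ).continuousWithinAt

theorem exists_isTransport (ht₀ : 0 ≤ t₀) {M : ℕ} {y : E} (hy : Good f t₀ Ω₀ (M + 1) y)
    {j : Fin m} (hf : ContDiff ℝ 1 (f j)) {c : ℝ} (hc : |c| ≤ 1) :
    ∃ P, IsTransport f t₀ j c y P := by
  set B : ℝ → E →L[ℝ] E := fun σ => fderiv ℝ (f j) (flow (f j) (c * σ) y) with hB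
  have hBc : ContinuousOn B (Icc 0 t₀) :=
    (hf.continuous_fderiv one_ne_zero).comp_continuousOn (hy.continuousOn hf hc)
  -- The transport equation is linear in $P$: its right-hand side is composition with $-cB(\sigma)$
  -- on the right.
  set A : ℝ → (E →L[ℝ] E) →L[ℝ] (E →L[ℝ] E) := fun σ =>
    -(c • (ContinuousLinearMap.compL ℝ E E E).flip (B σ)) with hA
  have hAc : ContinuousOn A (Icc 0 t₀) :=
    (((ContinuousLinearMap.compL ℝ E E E).flip.continuous.comp_continuousOn hBc).const_smul c).neg
  obtain ⟨K, hK⟩ := isCompact_Icc.exists_bound_of_continuousOn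
    (E := (E →L[ℝ] E) →L[ℝ] (E →L[ℝ] E)) (f := A) hAc
  obtain ⟨P, hP0, hP⟩ := exists_linear_ode_solution ht₀ (le_max_right K 0) A hAc
    (fun t ht => (hK t ht).trans (le_max_left K 0)) (ContinuousLinearMap.id ℝ E)
  exact ⟨P, hP0, fun σ hσ => by simpa [hA, hB] using hP σ hσ⟩

omit [NormedSpace ℝ E] [FiniteDimensional ℝ E] in
theorem exists_closedBall_superset (hb : Bornology.IsBounded Ω₀) :
    ∃ r : ℝ, Ω₀ ⊆ Metric.closedBall 0 r := hb.subset_closedBall 0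

/-- The flow depends on the initial point in a Lipschitz way. -/
theorem exists_norm_flow_sub_le (hb : Bornology.IsBounded Ω₀) (t₀ : ℝ) {j : Fin m}
    (hf : ContDiff ℝ 1 (f j)) {c : ℝ} (hc : |c| ≤ 1) :
    ∃ K : ℝ, 0 ≤ K ∧ ∀ z z' : E, Good f t₀ Ω₀ 1 z → Good f t₀ Ω₀ 1 z' → ∀ σ ∈ Icc 0 t₀,
      ‖flow (f j) (c * σ) z - flow (f j) (c * σ) z'‖ ≤ K * ‖z - z'‖ := by
  obtain ⟨r, hr⟩ := exists_closedBall_superset hb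
  obtain ⟨L, hL⟩ := exists_lipschitzOnWith_closedBall (contDiff_const_smul c |>.comp hf) r
  refine ⟨Real.exp (L * t₀), (Real.exp_pos _).le, fun z z' hz hz' σ hσ => ?_⟩
  have ht₀ : 0 ≤ t₀ := hσ.1.trans hσ.2
  have hder : ∀ z, Good f t₀ Ω₀ 1 z → ∀ t ∈ Ico 0 t₀,
      HasDerivWithinAt (fun σ => flow (f j) (c * σ) z) (c • f j (flow (f j) (c * t) z))
        (Ici t) t := fun z hz t ht =>
    (hz.hasDerivWithinAt_Icc (M := 0) hf hc (Ico_subset_Icc_self ht)).mono_of_mem_nhdsWithin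
      (Icc_mem_nhdsGE_of_mem ht)
  have hmem : ∀ z, Good f t₀ Ω₀ 1 z → ∀ t ∈ Ico 0 t₀,
      flow (f j) (c * t) z ∈ Metric.closedBall 0 r := fun z hz t ht =>
    hr (hz.flow (M := 0) j (abs_mul_le_of_mem hc (Ico_subset_Icc_self ht))).mem
  have h := dist_le_of_trajectories_ODE_of_mem (v := fun _ x => c • f j x)
    (s := fun _ => Metric.closedBall 0 r) (K := L) (δ := ‖z - z'‖) (fun _ _ => hL)
    (hz.continuousOn (M := 0) hf hc) (hder z hz) (hmem z hz) (hz'.continuousOn (M := 0) hf hc)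
    (hder z' hz') (hmem z' hz') (by
      simp only [mul_zero]
      rw [hz.flow_zero (M := 0) hf ht₀, hz'.flow_zero (M := 0) hf ht₀, dist_eq_norm]) σ hσ
  rw [dist_eq_norm, mul_comm ‖z - z'‖] at h
  refine h.trans ?_
  gcongr
  rw [sub_zero]
  exact hσ.2

/-- The differential is uniformly continuous on the ball, and the mean value inequality applies on
its convex intersection with a small ball about $a$. -/
theorem uniform_differentiability {Z : E → E} (hZ : ContDiff ℝ 1 Z) (r : ℝ) {ε : ℝ} (hε : 0 < ε) :
    ∃ δ > 0, ∀ a ∈ Metric.closedBall (0 : E) r, ∀ b ∈ Metric.closedBall (0 : E) r, ‖b - a‖ < δ →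
      ‖Z b - Z a - fderiv ℝ Z a (b - a)‖ ≤ ε * ‖b - a‖ := by
  have huc := (isCompact_closedBall (0 : E) r).uniformContinuousOn_of_continuous
    (hZ.continuous_fderiv one_ne_zero).continuousOn
  rw [Metric.uniformContinuousOn_iff] at huc
  obtain ⟨δ, hδ, h⟩ := huc ε hε
  refine ⟨δ, hδ, fun a ha b hb hab => ?_⟩
  have hconv : Convex ℝ (Metric.closedBall (0 : E) r ∩ Metric.ball a δ) :=
    (convex_closedBall 0 r).inter (convex_ball a δ)
  refine hconv.norm_image_sub_le_of_norm_hasFDerivWithin_le'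
    (fun x _ => ((hZ.differentiable one_ne_zero) x).hasFDerivAt.hasFDerivWithinAt)
    (fun x hx => ?_) ⟨ha, Metric.mem_ball_self hδ⟩ ⟨hb, by rwa [Metric.mem_ball, dist_eq_norm]⟩
  rw [← dist_eq_norm]
  exact (h x hx.1 a ha hx.2).le

/-- The flow is differentiable with respect to the initial point. -/
theorem hasFDerivWithinAt_flow (hb : Bornology.IsBounded Ω₀) {j : Fin m}
    (hf : ContDiff ℝ 1 (f j)) {c : ℝ} (hc : |c| ≤ 1) {t : ℝ} (ht : t ∈ Icc 0 t₀) {z : E}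
    (hz : Good f t₀ Ω₀ 2 z) {P : ℝ → E →L[ℝ] E}
    (hP : IsTransport f t₀ j (-c) (flow (f j) (c * t) z) P) :
    HasFDerivWithinAt (fun z => flow (f j) (c * t) z) (P t) {z | Good f t₀ Ω₀ 1 z} z := by
  have ht₀ : 0 ≤ t₀ := ht.1.trans ht.2
  obtain ⟨r, hr⟩ := exists_closedBall_superset hb
  obtain ⟨K, hK0, hK⟩ := exists_norm_flow_sub_le hb t₀ hf hc
  have hz1 : Good f t₀ Ω₀ 1 z := hz.mono (by norm_num)
  have hPc : ContinuousOn P (Icc 0 t₀) := fun σ hσ => (hP.2 σ hσ).continuousWithinAt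
  obtain ⟨N, hN⟩ := isCompact_Icc.exists_bound_of_continuousOn hPc
  have hN0 : 0 ≤ N := (norm_nonneg _).trans (hN 0 ⟨le_rfl, ht₀⟩)
  have hback : ∀ s ∈ Icc 0 t, flow (f j) (-c * (t - s)) (flow (f j) (c * t) z) =
      flow (f j) (c * s) z := by
    intro s hs
    have := hz1.flowTo (M := 0) hf ht₀ (abs_mul_le_of_mem hc ht)
      (abs_mul_le_of_mem hc (σ := s) ⟨hs.1, hs.2.trans ht.2⟩)
    rw [← this.flow_eq hf]
    congr 1
    ring
  -- $P(t-s)$ carries vectors from $e^{csX_j}z$ forward to the end point $e^{ctX_j}z$.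
  have hQ : ∀ s ∈ Icc 0 t, HasDerivWithinAt (fun s => P (t - s))
      (-(c • (P (t - s)).comp (fderiv ℝ (f j) (flow (f j) (c * s) z)))) (Icc 0 t) s := by
    intro s hs
    have hmaps : MapsTo (fun s => t - s) (Icc 0 t) (Icc 0 t₀) := fun s hs =>
      ⟨by linarith [hs.2], by linarith [hs.1, ht.2]⟩
    have h1 := hP.2 _ (hmaps hs)
    rw [hback s hs] at h1
    have h2 := h1.scomp s ((hasDerivAt_id s).const_sub t).hasDerivWithinAt hmaps
    simpa [Function.comp_def] using h2
  rw [hasFDerivWithinAt_iff_isLittleO, Asymptotics.isLittleO_iff]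
  intro ε hε
  -- Chosen so that the bounds $N$ for the transport, $K$ for the Lipschitz constant and the time
  -- $t$ recombine to at most $\varepsilon$.
  have hε' : 0 < ε / (N * K * t + 1) := by have := ht.1; positivity
  obtain ⟨δ, hδ, hδ'⟩ := uniform_differentiability hf r hε'
  have hnear : ∀ᶠ z' in 𝓝[{z | Good f t₀ Ω₀ 1 z}] z, ‖z' - z‖ < δ / (K + 1) := by
    refine mem_nhdsWithin_of_mem_nhds ?_
    filter_upwards [Metric.ball_mem_nhds z (ε := δ / (K + 1)) (by positivity)] with z' hz'
    rwa [Metric.mem_ball, dist_eq_norm] at hz'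
  filter_upwards [hnear, self_mem_nhdsWithin] with z' hz' hzG
  have hzG : Good f t₀ Ω₀ 1 z' := hzG
  set Δ : ℝ → E := fun s => flow (f j) (c * s) z' - flow (f j) (c * s) z with hΔ
  have hΔb : ∀ s ∈ Icc 0 t, ‖Δ s‖ ≤ K * ‖z' - z‖ := fun s hs =>
    hK z' z hzG hz1 s ⟨hs.1, hs.2.trans ht.2⟩
  have hΔδ : K * ‖z' - z‖ < δ := by
    rw [lt_div_iff₀ (by positivity)] at hz'
    nlinarith [norm_nonneg (z' - z)]
  have hsub : Icc 0 t ⊆ Icc 0 t₀ := Icc_subset_Icc_right ht.2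
  -- Variation of constants: the linear part cancels and only the first-order Taylor error of the
  -- field is left. The end values $s=t$ and $s=0$ are the increment of the flow and its linear
  -- prediction.
  have hder : ∀ s ∈ Icc 0 t, HasDerivWithinAt (fun s => P (t - s) (Δ s))
      (c • P (t - s) (f j (flow (f j) (c * s) z') - f j (flow (f j) (c * s) z) -
        fderiv ℝ (f j) (flow (f j) (c * s) z) (Δ s))) (Icc 0 t) s := by
    intro s hs
    have h1 := (hzG.hasDerivWithinAt_Icc (M := 0) hf hc (hsub hs)).mono hsub
    have h2 := (hz1.hasDerivWithinAt_Icc (M := 0) hf hc (hsub hs)).mono hsub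
    refine ((hQ s hs).clm_apply (h1.sub h2)).congr_deriv ?_
    simp only [neg_apply, smul_apply, ContinuousLinearMap.comp_apply, map_sub, map_smul, smul_sub,
      hΔ, Pi.sub_apply]
    abel
  have hmem : ∀ w, Good f t₀ Ω₀ 1 w → ∀ s ∈ Icc 0 t,
      flow (f j) (c * s) w ∈ Metric.closedBall 0 r := fun w hw s hs =>
    hr (hw.flow (M := 0) j (abs_mul_le_of_mem hc (hsub hs))).mem
  have hbd : ∀ s ∈ Icc 0 t, ‖c • P (t - s) (f j (flow (f j) (c * s) z') -
      f j (flow (f j) (c * s) z) - fderiv ℝ (f j) (flow (f j) (c * s) z) (Δ s))‖ ≤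
      N * (ε / (N * K * t + 1) * (K * ‖z' - z‖)) := by
    intro s hs
    rw [norm_smul, Real.norm_eq_abs]
    refine (mul_le_of_le_one_left (norm_nonneg _) hc).trans ?_
    refine (ContinuousLinearMap.le_opNorm _ _).trans ?_
    refine mul_le_mul (hN _ ⟨by linarith [hs.2], by linarith [hs.1, ht.2]⟩) ?_
      (norm_nonneg _) hN0
    refine (hδ' _ (hmem z hz1 s hs) _ (hmem z' hzG s hs)
      ((hΔb s hs).trans_lt hΔδ)).trans ?_
    exact mul_le_mul_of_nonneg_left (hΔb s hs) hε'.le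
  have hmv := (convex_Icc (0 : ℝ) t).norm_image_sub_le_of_norm_hasDerivWithin_le hder hbd
    (left_mem_Icc.2 ht.1) (right_mem_Icc.2 ht.1)
  have e0 : P (t - t) (Δ t) = flow (f j) (c * t) z' - flow (f j) (c * t) z := by
    rw [sub_self, hP.1]
    rfl
  have e1 : P (t - 0) (Δ 0) = P t (z' - z) := by
    simp only [hΔ, sub_zero, mul_zero]
    rw [hzG.flow_zero (M := 0) hf ht₀, hz1.flow_zero (M := 0) hf ht₀]
  rw [e0, e1, sub_zero, Real.norm_of_nonneg ht.1] at hmv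
  refine hmv.trans ?_
  have h3 : N * (ε / (N * K * t + 1) * (K * ‖z' - z‖)) * t =
      ε * ‖z' - z‖ * (N * K * t / (N * K * t + 1)) := by ring
  rw [h3]
  have h4 : N * K * t / (N * K * t + 1) ≤ 1 := by
    have := ht.1
    rw [div_le_one (by positivity)]
    linarith
  exact mul_le_of_le_one_right (by positivity) h4

/-- The velocity of a curve to which a flow is applied. -/
theorem hasDerivWithinAt_flow_curve (hb : Bornology.IsBounded Ω₀) {j : Fin m}
    (hf : ContDiff ℝ 1 (f j)) {c : ℝ} (hc : |c| ≤ 1) {t : ℝ} (ht : t ∈ Icc 0 t₀) {ζ : ℝ → E}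
    {D : E} (hζ : ∀ τ ∈ Icc 0 t₀, Good f t₀ Ω₀ 2 (ζ τ))
    (hD : HasDerivWithinAt ζ D (Icc 0 t₀) t) {P : ℝ → E →L[ℝ] E}
    (hP : IsTransport f t₀ j (-c) (flow (f j) (c * t) (ζ t)) P) :
    HasDerivWithinAt (fun τ => flow (f j) (c * τ) (ζ τ))
      (c • f j (flow (f j) (c * t) (ζ t)) + P t D) (Icc 0 t₀) t := by
  have ht₀ : 0 ≤ t₀ := ht.1.trans ht.2
  have hG : ∀ τ ∈ Icc 0 t₀, Good f t₀ Ω₀ 1 (ζ τ) := fun τ hτ => (hζ τ hτ).mono (by norm_num)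
  obtain ⟨K, hK0, hK⟩ := exists_norm_flow_sub_le hb t₀ hf hc
  set y := flow (f j) (c * t) (ζ t) with hy
  have h1 : HasDerivWithinAt (fun τ => flow (f j) (c * t) (ζ τ)) (P t D) (Icc 0 t₀) t :=
    (hasFDerivWithinAt_flow hb hf hc ht (hζ t ht) hP).comp_hasDerivWithinAt t hD hG
  -- The increment splits into a change of the starting point for fixed time and, here, a change of
  -- time from the moving starting point. For the latter the velocity is uniformly close to
  -- $cf_j(y)$.
  have h2 : HasDerivWithinAt (fun τ => flow (f j) (c * τ) (ζ τ) - flow (f j) (c * t) (ζ τ))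
      (c • f j y) (Icc 0 t₀) t := by
    rw [hasDerivWithinAt_iff_isLittleO, Asymptotics.isLittleO_iff]
    intro ε hε
    obtain ⟨δ, hδ, hfδ⟩ := Metric.continuousAt_iff.1 (hf.continuous.continuousAt (x := y)) ε hε
    have hζc : ∀ᶠ τ in 𝓝[Icc 0 t₀] t, ‖ζ τ - ζ t‖ < δ / (2 * (K + 1)) := by
      have := hD.continuousWithinAt
      rw [ContinuousWithinAt, tendsto_iff_norm_sub_tendsto_zero] at this
      exact this.eventually (gt_mem_nhds (by positivity))
    have hΓc : ∀ᶠ τ in 𝓝[Icc 0 t₀] t, ‖flow (f j) (c * τ) (ζ t) - y‖ < δ / 2 := by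
      have := (hG t ht).continuousOn (M := 0) hf hc t ht
      rw [ContinuousWithinAt, tendsto_iff_norm_sub_tendsto_zero] at this
      exact this.eventually (gt_mem_nhds (by positivity))
    have hΓc' : ∀ᶠ τ in 𝓝[Icc 0 t₀] t, ∀ s ∈ uIcc t τ,
        ‖flow (f j) (c * s) (ζ t) - y‖ < δ / 2 := by
      obtain ⟨ρ, hρ, h⟩ := Metric.mem_nhdsWithin_iff.1 hΓc
      refine Metric.mem_nhdsWithin_iff.2 ⟨ρ, hρ, fun τ hτ s hs => h ⟨?_, ?_⟩⟩
      · have := abs_sub_left_of_mem_uIcc hs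
        rw [Metric.mem_ball, Real.dist_eq] at *
        exact this.trans_lt hτ.1
      · exact ordConnected_Icc.uIcc_subset ht hτ.2 hs
    filter_upwards [hζc, hΓc', self_mem_nhdsWithin] with τ hτ1 hτ2 hτ
    have hsub : uIcc t τ ⊆ Icc 0 t₀ := ordConnected_Icc.uIcc_subset ht hτ
    have hmv := (convex_uIcc t τ).norm_image_sub_le_of_norm_hasDerivWithin_le
      (f := fun s => flow (f j) (c * s) (ζ τ) - s • (c • f j y))
      (f' := fun s => c • f j (flow (f j) (c * s) (ζ τ)) - c • f j y) (C := ε)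
      (fun s hs => by
        have h3 := ((hG τ hτ).hasDerivWithinAt_Icc (M := 0) hf hc (hsub hs)).mono hsub
        have h4 := ((hasDerivAt_id s).smul_const (c • f j y)).hasDerivWithinAt (s := uIcc t τ)
        rw [one_smul] at h4
        exact h3.sub h4)
      (fun s hs => by
        rw [← smul_sub, norm_smul, Real.norm_eq_abs]
        refine (mul_le_of_le_one_left (norm_nonneg _) hc).trans ?_
        rw [← dist_eq_norm]
        refine (hfδ ?_).le
        rw [dist_eq_norm]
        have h3 := hK _ _ (hG τ hτ) (hG t ht) s (hsub hs)
        have h4 := hτ2 s hs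
        have h5 := norm_sub_le_norm_sub_add_norm_sub (flow (f j) (c * s) (ζ τ))
          (flow (f j) (c * s) (ζ t)) y
        rw [lt_div_iff₀ (by positivity)] at hτ1
        nlinarith [norm_nonneg (ζ τ - ζ t)])
      left_mem_uIcc right_mem_uIcc
    calc _ = _ := ?_
      _ ≤ _ := hmv
    congr 1
    rw [sub_self, sub_zero, sub_smul]
    abel
  refine (h2.add h1).congr_of_mem (fun τ _ => ?_) ht
  simp

end Transport

/-! ### Transport of commutators along a flow -/

section Jets

variable {m s : ℕ} {E : Type*} [NormedAddCommGroup E] [NormedSpace ℝ E] [FiniteDimensional ℝ E]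
  {f : Fin m → E → E} {t₀ : ℝ} {Ω₀ : Set E}

/-- Descending induction on the word length: at length $s$ the $d$-Lipschitz hypothesis applies, and
shorter words have bounded derivatives along the trajectory. -/
theorem exists_lipschitzOnWith_coeff (hf : ∀ j, ContDiff ℝ 1 (f j))
    (hH : ∀ j, HContDiffLip f (s - 1) (f j)) (hb : Bornology.IsBounded Ω₀) {y : E}
    (hy : Good f t₀ Ω₀ 1 y) (j : Fin m) {c : ℝ} (hc : |c| ≤ 1) (r : ℕ) (v : List (Fin m))
    (hv : v ≠ []) (hr : v.length + r = s) :
    ∃ K, LipschitzOnWith K (fun σ => coeff f v (flow (f j) (c * σ) y)) (Icc 0 t₀) := by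
  induction r generalizing v with
  | zero =>
    obtain ⟨K, hK0, hK⟩ := exists_norm_sub_le_of_dLip ((coeff_regularity hH hv).2.2 hr Ω₀ hb)
    lift K to NNReal using hK0
    refine ⟨K, LipschitzOnWith.of_dist_le_mul fun a ha b hb' => ?_⟩
    rw [dist_eq_norm, Real.dist_eq]
    rcases eq_or_ne a b with rfl | hab
    · simp
    · have hpos : 0 < |a - b| := abs_pos.2 (sub_ne_zero.2 hab)
      refine hK _ (hy.flow (M := 0) j (abs_mul_le_of_mem hc ha)).mem _
        (hy.flow (M := 0) j (abs_mul_le_of_mem hc hb')).mem _ hpos ?_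
      refine (hy.flowTo (M := 0) (hf j) (ha.1.trans ha.2) (abs_mul_le_of_mem hc ha)
        (abs_mul_le_of_mem hc hb')).hdist_le hf hpos ?_
      rw [← mul_sub, abs_mul, abs_sub_comm b]
      exact mul_le_of_le_one_left (abs_nonneg _) hc
  | succ r ih =>
    obtain ⟨K, hK⟩ := ih (j :: v) (List.cons_ne_nil _ _) (by simp; omega)
    obtain ⟨B, hB⟩ := isCompact_Icc.exists_bound_of_continuousOn hK.continuousOn
    refine ⟨B.toNNReal, (convex_Icc 0 t₀).lipschitzOnWith_of_nnnorm_hasDerivWithin_le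
      (f' := fun σ => c • coeff f (j :: v) (flow (f j) (c * σ) y)) (fun σ hσ => ?_)
      fun σ hσ => ?_⟩
    · have ht₀ : 0 ≤ t₀ := hσ.1.trans hσ.2
      have hsub : Icc 0 t₀ ⊆ Icc (-t₀) t₀ := Icc_subset_Icc_left (by linarith)
      exact (hy.hasDerivWithinAt_comp (M := 0) (hf j) ht₀ hc (hsub hσ)
        ((coeff_regularity hH hv).1 (by omega) j _)).mono hsub
    · rw [← NNReal.coe_le_coe, coe_nnnorm, norm_smul, Real.norm_eq_abs]
      exact ((mul_le_of_le_one_left (norm_nonneg _) hc).trans (hB σ hσ)).trans (Real.le_coe_toNNReal B)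

theorem exists_lipschitzOnWith_commVec (hf : ∀ j, ContDiff ℝ 1 (f j))
    (hH : ∀ j, HContDiffLip f (s - 1) (f j)) (hb : Bornology.IsBounded Ω₀) {y : E}
    (hy : Good f t₀ Ω₀ 1 y) (j : Fin m) {c : ℝ} (hc : |c| ≤ 1) (v : List (Fin m))
    (hv : v ≠ []) (hvs : v.length ≤ s) :
    ∃ K, LipschitzOnWith K (fun σ => commVec f v (flow (f j) (c * σ) y)) (Icc 0 t₀) := by
  have hlist : ∀ Λ : List (ℤ × List (Fin m)), (∀ p ∈ Λ, p.2 ≠ [] ∧ p.2.length ≤ s) →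
      ∃ K, LipschitzOnWith K
        (fun σ => (Λ.map fun p => p.1 • coeff f p.2 (flow (f j) (c * σ) y)).sum) (Icc 0 t₀) := by
    intro Λ hΛ
    induction Λ with
    | nil => exact ⟨0, (LipschitzWith.const (0 : E)).lipschitzOnWith⟩
    | cons p Λ ih =>
      obtain ⟨K, hK⟩ := ih fun q hq => hΛ q (by simp [hq])
      have h1 := hΛ p (by simp)
      obtain ⟨K', hK'⟩ := exists_lipschitzOnWith_coeff hf hH hb hy j hc (s - p.2.length) p.2 h1.1
        (by omega)
      have h2 := (((p.1 : ℝ) • ContinuousLinearMap.id ℝ E).lipschitz.comp_lipschitzOnWith hK').add hK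
      refine ⟨‖(p.1 : ℝ) • ContinuousLinearMap.id ℝ E‖₊ * K' + K, ?_⟩
      intro a ha b hb
      simpa [Int.cast_smul_eq_zsmul] using h2 ha hb
  refine hlist (expansion v) fun p hp => ?_
  have := length_of_mem_expansion hp
  refine ⟨fun h => hv ?_, by omega⟩
  rw [h] at this
  exact List.length_eq_zero_iff.1 this.symm

omit [FiniteDimensional ℝ E] in
theorem exists_lipschitzOnWith_clm_apply {P : ℝ → E →L[ℝ] E} {g : ℝ → E} {t : ℝ}
    (ξ : E →L[ℝ] ℝ) (hP : ∃ K, LipschitzOnWith K P (Icc 0 t))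
    (hg : ∃ K, LipschitzOnWith K g (Icc 0 t)) :
    ∃ K, LipschitzOnWith K (fun σ => ξ (P σ (g σ))) (Icc 0 t) := by
  obtain ⟨K, hK⟩ := hP
  obtain ⟨K', hK'⟩ := hg
  obtain ⟨B, hB⟩ := isCompact_Icc.exists_bound_of_continuousOn hK.continuousOn
  obtain ⟨B', hB'⟩ := isCompact_Icc.exists_bound_of_continuousOn hK'.continuousOn
  refine ⟨‖ξ‖₊ * (K * B'.toNNReal + B.toNNReal * K'),
    LipschitzOnWith.of_dist_le_mul fun a ha b hb => ?_⟩
  have h1 : P a (g a) - P b (g b) = (P a - P b) (g a) + P b (g a - g b) := by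
    simp
  have h2 := hK.dist_le_mul a ha b hb
  have h3 := hK'.dist_le_mul a ha b hb
  rw [dist_eq_norm] at h2 h3 ⊢
  rw [← map_sub, h1]
  simp only [NNReal.coe_mul, NNReal.coe_add, Real.coe_toNNReal', coe_nnnorm]
  calc ‖ξ ((P a - P b) (g a) + P b (g a - g b))‖
      ≤ ‖ξ‖ * ‖(P a - P b) (g a) + P b (g a - g b)‖ := ξ.le_opNorm _
    _ ≤ ‖ξ‖ * (‖P a - P b‖ * ‖g a‖ + ‖P b‖ * ‖g a - g b‖) := by
        gcongr
        exact (norm_add_le _ _).trans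
          (add_le_add (ContinuousLinearMap.le_opNorm _ _) (ContinuousLinearMap.le_opNorm _ _))
    _ ≤ ‖ξ‖ * (K * dist a b * max B' 0 + max B 0 * (K' * dist a b)) := by
        have h4 := (hB' a ha).trans (le_max_left B' 0)
        have h5 := (hB b hb).trans (le_max_left B 0)
        gcongr
    _ = _ := by ring

/-- The involutivity condition holds at almost all points of a trajectory. -/
theorem ae_involutive (hf : ∀ j, ContDiff ℝ 1 (f j)) {C₀ : ℝ} (hC₀ : 0 < C₀)
    (hI : Involutive f s Ω₀ C₀) {y : E} (hy : Good f t₀ Ω₀ 2 y) (j : Fin m) {c : ℝ}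
    (hc : c = 1 ∨ c = -1) (w : List (Fin m)) (hw : w.length = s) :
    ∀ᵐ σ : ℝ, σ ∈ Icc 0 t₀ → ∃ b : List (Fin m) → ℝ,
      adComm f (f j) w (flow (f j) (c * σ) y) =
        ∑ u ∈ words m 1 s, b u • commVec f u (flow (f j) (c * σ) y) ∧
      ∀ u ∈ words m 1 s, |b u| ≤ C₀ := by
  have hc1 : |c| ≤ 1 := by rcases hc with rfl | rfl <;> simp
  set p : ℝ → Prop := fun σ => ∃ b : List (Fin m) → ℝ,
    adComm f (f j) w (flow (f j) (c * σ) y) =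
      ∑ u ∈ words m 1 s, b u • commVec f u (flow (f j) (c * σ) y) ∧
    ∀ u ∈ words m 1 s, |b u| ≤ C₀ with hp
  rw [ae_iff]
  have hset : {σ | ¬(σ ∈ Icc 0 t₀ → p σ)} = {σ | σ ∈ Icc 0 t₀ ∧ ¬p σ} := by
    ext σ
    simp [and_assoc]
  rw [hset]
  -- Involutivity is available only for times up to $C_0^{-1}$ from a base point, so it is used near
  -- each point of the trajectory and the exceptional null sets are pulled back by $\sigma\mapsto
  -- c(\sigma-a)$.
  refine measure_null_of_locally_null _ fun a ha => ?_
  have ha : a ∈ Icc 0 t₀ := ha.1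
  refine ⟨{σ | σ ∈ Icc 0 t₀ ∧ ¬p σ} ∩ Icc (a - C₀⁻¹) (a + C₀⁻¹),
    inter_mem self_mem_nhdsWithin (mem_nhdsWithin_of_mem_nhds (Icc_mem_nhds
      (by have := inv_pos.2 hC₀; linarith) (by have := inv_pos.2 hC₀; linarith))), ?_⟩
  have hz := (hy.flow (M := 1) j (abs_mul_le_of_mem hc1 ha)).mem
  have h1 := (ae_restrict_iff' measurableSet_Icc).1 (hI (f j) ⟨j, Or.inl rfl⟩ w hw _ hz)
  have hmp : MeasurePreserving (fun σ : ℝ => c * (σ - a)) := by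
    rcases hc with rfl | rfl
    · simpa using measurePreserving_sub_right volume a
    · simpa using Measure.measurePreserving_sub_left volume a
  have h2 := hmp.quasiMeasurePreserving.ae h1
  rw [ae_iff] at h2
  refine measure_mono_null (fun σ hσ => ?_) h2
  obtain ⟨⟨hσ1, hσ2⟩, hσ3⟩ := hσ
  intro h3
  apply hσ2
  have hft := hy.flowTo (M := 1) (hf j) (ha.1.trans ha.2) (abs_mul_le_of_mem hc1 ha)
    (abs_mul_le_of_mem hc1 hσ1)
  rw [← mul_sub] at hft
  have hm : c * (σ - a) ∈ Icc (-C₀⁻¹) C₀⁻¹ := by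
    rcases hc with rfl | rfl
    · constructor <;> linarith [hσ3.1, hσ3.2]
    · constructor <;> linarith [hσ3.1, hσ3.2]
  have h4 := h3 hm hft.flowDefined
  rwa [hft.flow_eq (hf j)] at h4

/-- Expansion of the transported commutators. -/
theorem jet_transport (hf : ∀ j, ContDiff ℝ 1 (f j)) (hH : ∀ j, HContDiffLip f (s - 1) (f j))
    (hb : Bornology.IsBounded Ω₀) (ht₀ : 0 < t₀) {C₀ : ℝ} (hC₀ : 1 ≤ C₀)
    (hI : Involutive f s Ω₀ C₀) {N : ℕ}
    (hN : ∀ w : List (Fin m), w.length < s → (cSteps w 1).length ≤ N) {y : E}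
    (hy : Good f t₀ Ω₀ (N + 2) y) (j : Fin m) {c : ℝ} (hc : c = 1 ∨ c = -1) {P : ℝ → E →L[ℝ] E}
    (hP : IsTransport f t₀ j c y P) (ξ : E →L[ℝ] ℝ) {τ : ℝ} (hτ : τ ∈ Icc 0 t₀) :
    (∑ v ∈ words m 1 s, |ξ (P τ (commVec f v (flow (f j) (c * τ) y)))| ≤
      Real.exp (C₀ * (words m 1 s).card * t₀) * ∑ v ∈ words m 1 s, |ξ (commVec f v y)|) ∧
    ∀ (r : ℕ) (u : List (Fin m)), u ≠ [] → u.length + r = s →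
      |ξ (P τ (commVec f u (flow (f j) (c * τ) y))) - ∑ i ∈ Finset.range (r + 1),
        ((c * τ) ^ i / (i.factorial : ℝ)) * ξ (commVec f (List.replicate i j ++ u) y)| ≤
      C₀ * Real.exp (C₀ * (words m 1 s).card * t₀) * τ ^ (r + 1) *
        ∑ v ∈ words m 1 s, |ξ (commVec f v y)| := by
  have hc1 : |c| ≤ 1 := by rcases hc with rfl | rfl <;> simp
  have hcc : c * c = 1 := by rcases hc with rfl | rfl <;> norm_num
  set W := words m 1 s with hW
  set Γ : ℝ → E := fun σ => flow (f j) (c * σ) y with hΓ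
  set h : List (Fin m) → ℝ → ℝ := fun u σ => ξ (P σ (commVec f u (Γ σ))) with hh
  have hsub : Icc 0 t₀ ⊆ Icc (-t₀) t₀ := Icc_subset_Icc_left (by linarith)
  have hsubτ : Icc 0 τ ⊆ Icc 0 t₀ := Icc_subset_Icc_right hτ.2
  have hΓG : ∀ σ ∈ Icc 0 t₀, Good f t₀ Ω₀ (N + 1) (Γ σ) := fun σ hσ =>
    hy.flow (M := N + 1) j (abs_mul_le_of_mem hc1 hσ)
  have hy1 : Good f t₀ Ω₀ 1 y := hy.mono (by omega)
  have hy2 : Good f t₀ Ω₀ 2 y := hy.mono (by omega)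
  have hΓ0 : Γ 0 = y := by
    simp only [hΓ, mul_zero]
    exact hy1.flow_zero (M := 0) (hf j) ht₀.le
  have hh0 : ∀ u, h u 0 = ξ (commVec f u y) := by
    intro u
    simp only [hh, hΓ0, hP.1]
    rfl
  -- The term $f_u\cdot\nabla f_j$ in the derivative of $f_u$ along $X_j$ is cancelled by the
  -- transport equation, and only $f_{ju}$ survives.
  have hd : ∀ u : List (Fin m), 1 ≤ u.length → u.length < s → ∀ σ ∈ Icc 0 t₀,
      HasDerivWithinAt (h u) (c • h (j :: u) σ) (Icc 0 t₀) σ := by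
    intro u hu1 hu2 σ hσ
    have hu0 : u ≠ [] := by rintro rfl; simp at hu1
    have h1 := (hy1.hasDerivWithinAt_comp (M := 0) (hf j) ht₀.le hc1 (hsub hσ)
      (lieDeriv_commVec_sub hf ht₀ hH u hu0 hu2 (Γ σ)
        ((hΓG σ hσ).mono (by have := hN u hu2; omega)) j)).mono hsub
    have h2 := ξ.hasFDerivAt.comp_hasDerivWithinAt σ ((hP.2 σ hσ).clm_apply h1)
    refine h2.congr_deriv ?_
    simp only [neg_apply, smul_apply, ContinuousLinearMap.comp_apply, map_add, map_neg, map_smul,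
      smul_add, hh, hΓ]
    abel
  have hPlip : ∃ K, LipschitzOnWith K P (Icc 0 t₀) := by
    have hBc : ContinuousOn (fun σ => -(c • (P σ).comp (fderiv ℝ (f j) (Γ σ)))) (Icc 0 t₀) := by
      have h1 : ContinuousOn P (Icc 0 t₀) := fun σ hσ => (hP.2 σ hσ).continuousWithinAt
      have h2 : ContinuousOn (fun σ => fderiv ℝ (f j) (Γ σ)) (Icc 0 t₀) :=
        ((hf j).continuous_fderiv one_ne_zero).comp_continuousOn
          (hy1.continuousOn (M := 0) (hf j) hc1)
      exact ((h1.clm_comp h2).const_smul c).neg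
    obtain ⟨B, hB⟩ := isCompact_Icc.exists_bound_of_continuousOn hBc
    refine ⟨B.toNNReal,
      (convex_Icc 0 t₀).lipschitzOnWith_of_nnnorm_hasDerivWithin_le hP.2 fun σ hσ => ?_⟩
    rw [← NNReal.coe_le_coe, coe_nnnorm]
    exact (hB σ hσ).trans (Real.le_coe_toNNReal B)
  have hac : ∀ u ∈ W, AbsolutelyContinuousOnInterval (h u) 0 τ := by
    intro u hu
    rw [hW, mem_words] at hu
    obtain ⟨K, hK⟩ := exists_lipschitzOnWith_clm_apply ξ hPlip
      (exists_lipschitzOnWith_commVec hf hH hb hy1 j hc1 u (by rintro rfl; simp at hu) hu.2)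
    refine LipschitzOnWith.absolutelyContinuousOnInterval (K := K) ?_
    rw [uIcc_of_le hτ.1]
    exact hK.mono hsubτ
  -- For $|u|<s$ the derivative is $c\,h_{ju}$, itself a term of the sum. For $|u|=s$ the trajectory
  -- is differentiable almost everywhere, and involutivity bounds the derivative.
  have hderiv : ∀ u ∈ W, ∀ᵐ σ, σ ∈ Ioo 0 τ → |deriv (h u) σ| ≤ C₀ * ∑ v ∈ W, |h v σ| := by
    intro u hu
    have hu' := mem_words.1 hu
    have hu0 : u ≠ [] := by rintro rfl; simp at hu'
    rcases hu'.2.lt_or_eq with hlt | heq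
    · refine Eventually.of_forall fun σ hσ => ?_
      have hσ' : σ ∈ Icc 0 t₀ := hsubτ (Ioo_subset_Icc_self hσ)
      rw [((hd u hu'.1 hlt σ hσ').hasDerivAt
        (Icc_mem_nhds hσ.1 (hσ.2.trans_le hτ.2))).deriv, smul_eq_mul, abs_mul]
      have h1 : |h (j :: u) σ| ≤ ∑ v ∈ W, |h v σ| :=
        Finset.single_le_sum (f := fun v => |h v σ|) (fun _ _ => abs_nonneg _)
          (mem_words.2 ⟨by simp, by simp; omega⟩)
      calc |c| * |h (j :: u) σ| ≤ C₀ * |h (j :: u) σ| := by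
            gcongr
            linarith
        _ ≤ _ := by gcongr
    · obtain ⟨K, hK⟩ := exists_lipschitzOnWith_commVec hf hH hb hy1 j hc1 u hu0 hu'.2
      filter_upwards [hK.ae_differentiableWithinAt_of_mem_real,
        ae_involutive hf (by linarith) hI hy2 j hc u heq] with σ hσd hσi hσ
      have hσ' : σ ∈ Icc 0 t₀ := hsubτ (Ioo_subset_Icc_self hσ)
      have hnhds : Icc 0 t₀ ∈ 𝓝 σ := Icc_mem_nhds hσ.1 (hσ.2.trans_le hτ.2)
      obtain ⟨b, hb1, hb2⟩ := hσi hσ'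
      have hD := ((hσd hσ').differentiableAt hnhds).hasDerivAt
      set D := deriv (fun σ => commVec f u (flow (f j) (c * σ) y)) σ with hDdef
      -- Since $c^2=1$, flowing from $\Gamma(\sigma)$ for time $\theta$ leads to
      -- $\Gamma(\sigma+c\theta)$. So the Lie derivative in `adComm` is a genuine limit here.
      have hlie : HasDerivAt (fun θ => commVec f u (flow (f j) θ (Γ σ))) (c • D) 0 := by
        have h0 : σ + c * 0 = σ := by ring
        have hlin : HasDerivAt (fun θ : ℝ => σ + c * θ) c 0 := by
          simpa using ((hasDerivAt_id (0 : ℝ)).const_mul c).const_add σ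
        rw [← h0] at hD
        have h1 := HasDerivAt.scomp (h := fun θ : ℝ => σ + c * θ) 0 hD hlin
        refine h1.congr_of_eventuallyEq ?_
        have hev : ∀ᶠ θ in 𝓝 (0 : ℝ), σ + c * θ ∈ Icc 0 t₀ := by
          apply hlin.continuousAt
          simpa using hnhds
        filter_upwards [hev] with θ hθ
        have h2 := hy1.flowTo (M := 0) (hf j) ht₀.le (abs_mul_le_of_mem hc1 hσ')
          (abs_mul_le_of_mem hc1 hθ)
        rw [Function.comp_apply, ← h2.flow_eq (hf j)]
        congr 2
        rw [mul_add, ← mul_assoc, hcc]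
        ring
      have hlie' : lieDeriv (f j) (commVec f u) (Γ σ) = c • D := hlie.deriv
      have hDe : D = c • lieDeriv (f j) (commVec f u) (Γ σ) := by
        rw [hlie', smul_smul, hcc, one_smul]
      have h2 := ξ.hasFDerivAt.comp_hasDerivAt σ
        (((hP.2 σ hσ').hasDerivAt hnhds).clm_apply hD)
      have h3 : HasDerivAt (h u) (c * ∑ v ∈ W, b v * h v σ) σ := by
        refine h2.congr_deriv ?_
        have h4 : ∑ v ∈ W, b v * h v σ = ξ (P σ (adComm f (f j) u (Γ σ))) := by
          rw [hb1, map_sum, map_sum]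
          simp [hh, hΓ, hW]
        rw [h4, adComm, hDe]
        simp only [neg_apply, smul_apply, ContinuousLinearMap.comp_apply, map_add, map_neg,
          map_smul, map_sub, hΓ, smul_eq_mul]
        ring
      rw [h3.deriv, abs_mul]
      refine (mul_le_of_le_one_left (abs_nonneg _) hc1).trans ?_
      rw [Finset.mul_sum]
      refine (Finset.abs_sum_le_sum_abs _ _).trans (Finset.sum_le_sum fun v hv => ?_)
      rw [abs_mul]
      exact mul_le_mul_of_nonneg_right (hb2 v hv) (abs_nonneg _)
  set H := ∑ v ∈ W, |ξ (commVec f v y)| with hHdef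
  have hH0 : 0 ≤ H := Finset.sum_nonneg fun _ _ => abs_nonneg _
  have hgr := abs_sub_le_of_ae_abs_deriv_le W h (by linarith : (0 : ℝ) ≤ C₀) hτ.1 hac hderiv
  have hC00 : 0 ≤ C₀ * W.card := by have : 0 ≤ C₀ := by linarith
                                    positivity
  have hexp : Real.exp (C₀ * W.card * τ) ≤ Real.exp (C₀ * W.card * t₀) :=
    Real.exp_le_exp.2 (mul_le_mul_of_nonneg_left hτ.2 hC00)
  simp only [hh0] at hgr
  rw [← hHdef] at hgr
  constructor
  · exact (hgr τ (right_mem_Icc.2 hτ.1)).1.trans (mul_le_mul_of_nonneg_right hexp hH0)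
  · intro r u hu0 hur
    have hε : 0 ≤ C₀ * τ * (Real.exp (C₀ * W.card * t₀) * H) := by
      have := hτ.1
      have : 0 ≤ C₀ := by linarith
      positivity
    -- The oscillation at length $s$ already carries a factor $\tau$, whence the remainder
    -- $\tau^{r+1}$.
    have := jet_taylor h hc1 j 1 s hε (t := τ)
      (fun v hv1 hv2 σ hσ => (hd v hv1 hv2 σ (hsubτ hσ)).mono hsubτ)
      (fun v hv1 hv2 σ hσ => by
        rw [hh0]
        refine ((hgr σ hσ).2 v (mem_words.2 ⟨hv1, hv2.le⟩)).trans ?_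
        have := hτ.1
        gcongr) r u (List.length_pos_iff.2 hu0) hur τ (right_mem_Icc.2 hτ.1)
    simp only [hh0] at this
    calc _ ≤ _ := this
      _ = _ := by ring

end Jets

/-! ### The velocity of a composition of flows -/

section Velocity

variable {m : ℕ}

theorem pair_comp {V V' : Type*} [AddCommGroup V] [Module ℝ V] [AddCommGroup V'] [Module ℝ V']
    (φ : V →ₗ[ℝ] V') (h : List (Fin m) → V) (S : FreeAlgebra ℝ (Fin m)) :
    pair (fun v => φ (h v)) S = φ (pair h S) := by
  have : pair (fun v => φ (h v)) = φ.comp (pair h) :=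
    linearMap_ext_monom fun v => by rw [LinearMap.comp_apply, pair_monom, pair_monom]
  rw [this]
  rfl

/-- Estimates for monomials extend to homogeneous elements. -/
theorem exists_pair_sub_le {s i : ℕ} (hi : i < s) {K : ℝ} (hK : 0 ≤ K) (c : ℝ) (j : Fin m)
    {S : FreeAlgebra ℝ (Fin m)} (hS : S ∈ homog m (i + 1)) :
    ∃ C, 0 ≤ C ∧ ∀ (h₀ h₁ : List (Fin m) → ℝ) (H t : ℝ),
      (∀ (r : ℕ) (u : List (Fin m)), u ≠ [] → u.length + r = s →
        |h₀ u - ∑ n ∈ Finset.range (r + 1),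
          ((c * t) ^ n / (n.factorial : ℝ)) * h₁ (List.replicate n j ++ u)| ≤
            K * t ^ (r + 1) * H) →
      |pair h₀ S - ∑ n ∈ Finset.range (s - i), t ^ n *
        pair h₁ (PowerSeries.coeff n (pexp c (gen j)) * S)| ≤ C * t ^ (s - i) * H := by
  obtain ⟨α, rfl⟩ := exists_sum_monom_of_mem_homog hS
  refine ⟨(∑ v ∈ words m (i + 1) (i + 1), |α v|) * K,
    mul_nonneg (Finset.sum_nonneg fun _ _ => abs_nonneg _) hK, fun h₀ h₁ H t h => ?_⟩
  obtain ⟨r, rfl⟩ : ∃ r, s = i + 1 + r := ⟨s - (i + 1), by omega⟩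
  have hr : i + 1 + r - i = r + 1 := by omega
  rw [hr]
  have h2 : pair h₀ (∑ v ∈ words m (i + 1) (i + 1), α v • monom v) -
      ∑ n ∈ Finset.range (r + 1), t ^ n * pair h₁ (PowerSeries.coeff n (pexp c (gen j)) *
        ∑ v ∈ words m (i + 1) (i + 1), α v • monom v) =
      ∑ v ∈ words m (i + 1) (i + 1), α v * (h₀ v - ∑ n ∈ Finset.range (r + 1),
        ((c * t) ^ n / (n.factorial : ℝ)) * h₁ (List.replicate n j ++ v)) := by
    simp only [mul_sub, Finset.sum_sub_distrib, map_sum, map_smul, pair_monom, smul_eq_mul,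
      Finset.mul_sum]
    congr 1
    rw [Finset.sum_comm]
    refine Finset.sum_congr rfl fun v _ => Finset.sum_congr rfl fun n _ => ?_
    rw [coeff_pexp, ← monom_replicate, mul_smul_comm, smul_mul_assoc, ← monom_append, map_smul,
      map_smul, pair_monom]
    simp only [smul_eq_mul]
    ring
  rw [h2]
  refine (Finset.abs_sum_le_sum_abs _ _).trans ?_
  rw [Finset.sum_mul, Finset.sum_mul, Finset.sum_mul]
  refine Finset.sum_le_sum fun v hv => ?_
  rw [abs_mul, mul_assoc, mul_assoc, ← mul_assoc K]
  have hv' := mem_words.1 hv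
  exact mul_le_mul_of_nonneg_left (h r v (by rintro rfl; simp at hv') (by omega)) (abs_nonneg _)

variable {E : Type*} [NormedAddCommGroup E] [NormedSpace ℝ E] [FiniteDimensional ℝ E]

/-- The velocity of a composition of flows is given by the formal velocity up to an error of
order `s`. -/
theorem exists_velocity_estimate {s : ℕ} (hs : 1 ≤ s) {C₀ : ℝ} (hC₀ : 1 ≤ C₀) (T : ℝ) {N : ℕ}
    (hN : ∀ w : List (Fin m), w.length < s → (cSteps w 1).length ≤ N)
    (σ : List (Fin m × ℝ)) (hσ : ∀ p ∈ σ, |p.2| = 1) :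
    ∃ C, 0 ≤ C ∧ ∀ (f : Fin m → E → E) (Ω₀ : Set E) (t₀ : ℝ), (∀ j, ContDiff ℝ 1 (f j)) →
      (∀ j, HContDiffLip f (s - 1) (f j)) → Bornology.IsBounded Ω₀ → 0 < t₀ → t₀ ≤ T →
      Involutive f s Ω₀ C₀ → ∀ x, Good f t₀ Ω₀ (N + 2 + σ.length) x → ∀ t ∈ Icc 0 t₀,
      ∃ D, HasDerivWithinAt (fun τ => run f (scaleSteps τ σ) x) D (Icc 0 t₀) t ∧
        ∀ ξ : E →L[ℝ] ℝ,
          |ξ D - ∑ i ∈ Finset.range s, t ^ i *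
            pair (fun v => ξ (commVec f v (run f (scaleSteps t σ) x)))
              (PowerSeries.coeff i (velSeries σ))| ≤
          C * t ^ s * ∑ v ∈ words m 1 s, |ξ (commVec f v (run f (scaleSteps t σ) x))| := by
  induction σ using List.reverseRecOn with
  | nil =>
    refine ⟨0, le_rfl, fun f Ω₀ t₀ _ _ _ _ _ _ x _ t _ => ⟨0, ?_, fun ξ => ?_⟩⟩
    · exact hasDerivWithinAt_const _ _ x
    · simp [velSeries_nil]
  | append_singleton σ p ih =>
    obtain ⟨j, c⟩ := p
    have hσ' : ∀ p ∈ σ, |p.2| = 1 := fun p hp => hσ p (by simp [hp])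
    obtain ⟨C, hC, hest⟩ := ih hσ'
    have hc1 : |c| = 1 := hσ (j, c) (by simp)
    have hc : c = 1 ∨ c = -1 := eq_or_eq_neg_of_abs_eq hc1
    have hcn : -c = 1 ∨ -c = -1 := by rcases hc with rfl | rfl <;> simp
    set e := Real.exp (C₀ * (words m 1 s).card * T) with he
    have hCe : 0 ≤ C₀ * e := mul_nonneg (by linarith) (Real.exp_pos _).le
    have hpair : ∀ i, ∃ A, 0 ≤ A ∧ (i < s → ∀ (h₀ h₁ : List (Fin m) → ℝ) (H t : ℝ),
        (∀ (r : ℕ) (u : List (Fin m)), u ≠ [] → u.length + r = s →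
          |h₀ u - ∑ n ∈ Finset.range (r + 1),
            ((-c * t) ^ n / (n.factorial : ℝ)) * h₁ (List.replicate n j ++ u)| ≤
              C₀ * e * t ^ (r + 1) * H) →
        |pair h₀ (PowerSeries.coeff i (velSeries σ)) - ∑ n ∈ Finset.range (s - i), t ^ n *
          pair h₁ (PowerSeries.coeff n (pexp (-c) (gen j)) *
            PowerSeries.coeff i (velSeries σ))| ≤ A * t ^ (s - i) * H) := by
      intro i
      by_cases hi : i < s
      · obtain ⟨A, hA, h⟩ := exists_pair_sub_le hi hCe (-c) j (coeff_velSeries_mem σ i)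
        exact ⟨A, hA, fun _ => h⟩
      · exact ⟨0, le_rfl, fun h => absurd h hi⟩
    choose A hA hAest using hpair
    -- The old error, enlarged by transport at most by the Gronwall factor $e$, plus the errors
    -- $A_i$ of transporting the coefficients of degree $i$.
    refine ⟨C * e + ∑ i ∈ Finset.range s, A i, by
      have := Finset.sum_nonneg fun i (_ : i ∈ Finset.range s) => hA i
      have := (Real.exp_pos (C₀ * (words m 1 s).card * T)).le
      positivity, fun f Ω₀ t₀ hf hH hb ht₀ htT hI x hx t ht => ?_⟩
    have hlen : (σ ++ [(j, c)]).length = σ.length + 1 := by simp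
    rw [hlen] at hx
    obtain ⟨D, hD, hξ⟩ := hest f Ω₀ t₀ hf hH hb ht₀ htT hI x (hx.mono (by omega)) t ht
    have hz : ∀ τ ∈ Icc 0 t₀, Good f t₀ Ω₀ (N + 3) (run f (scaleSteps τ σ) x) := fun τ hτ =>
      Good.run (σ := scaleSteps τ σ) (by rw [length_scaleSteps]; exact hx.mono (by omega))
        (abs_of_mem_scaleSteps hσ' hτ)
    set z := run f (scaleSteps t σ) x with hzdef
    set y := flow (f j) (c * t) z with hy
    have hct : |c * t| ≤ t₀ := abs_mul_le_of_mem hc1.le ht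
    have hyG : Good f t₀ Ω₀ (N + 2) y := (hz t ht).flow j hct
    have hyz : flow (f j) (-c * t) y = z := by
      have := ((hz t ht).flowDefined (M := N + 2) j hct).flowTo.symm.flow_eq (hf j)
      rwa [neg_mul]
    obtain ⟨P, hP⟩ := exists_isTransport ht₀.le (M := N + 1) hyG (hf j) (c := -c)
      (by rw [abs_neg]; exact hc1.le)
    simp only [run_scaleSteps_concat, ← hzdef, ← hy]
    refine ⟨_, hasDerivWithinAt_flow_curve hb (hf j) hc1.le ht
      (fun τ hτ => (hz τ hτ).mono (by omega)) hD hP, fun ξ => ?_⟩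
    obtain ⟨hj1, hj2⟩ := jet_transport hf hH hb ht₀ hC₀ hI hN hyG j hcn hP ξ ht
    rw [hyz] at hj1
    simp only [hyz] at hj2
    set H := ∑ v ∈ words m 1 s, |ξ (commVec f v y)| with hHdef
    have hH0 : 0 ≤ H := Finset.sum_nonneg fun _ _ => abs_nonneg _
    have hexp : Real.exp (C₀ * (words m 1 s).card * t₀) ≤ e :=
      Real.exp_le_exp.2 (mul_le_mul_of_nonneg_left htT (by positivity))
    have ht0 : 0 ≤ t := ht.1
    set h₀ : List (Fin m) → ℝ := fun v => ξ (P t (commVec f v z)) with hh₀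
    set h₁ : List (Fin m) → ℝ := fun v => ξ (commVec f v y) with hh₁
    -- The induction hypothesis at $z$ is tested with $\xi\circ P_t$; Gronwall bounds the resulting
    -- sum by values at the new point $y$.
    have hmain : |ξ (P t D) - ∑ i ∈ Finset.range s, t ^ i *
        pair h₀ (PowerSeries.coeff i (velSeries σ))| ≤ C * t ^ s * (e * H) := by
      refine (hξ (ξ.comp (P t))).trans ?_
      refine mul_le_mul_of_nonneg_left (hj1.trans ?_) (by positivity)
      gcongr
    have hsum : |∑ i ∈ Finset.range s, t ^ i * pair h₀ (PowerSeries.coeff i (velSeries σ)) -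
        ∑ i ∈ Finset.range s, t ^ i * ∑ n ∈ Finset.range (s - i), t ^ n *
          pair h₁ (PowerSeries.coeff n (pexp (-c) (gen j)) *
            PowerSeries.coeff i (velSeries σ))| ≤ (∑ i ∈ Finset.range s, A i) * t ^ s * H := by
      rw [← Finset.sum_sub_distrib, Finset.sum_mul, Finset.sum_mul]
      refine (Finset.abs_sum_le_sum_abs _ _).trans (Finset.sum_le_sum fun i hi => ?_)
      have hi := Finset.mem_range.1 hi
      have h3 := hAest i hi h₀ h₁ H t fun r u hu hur => (hj2 r u hu hur).trans (by gcongr)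
      rw [← mul_sub, abs_mul, abs_of_nonneg (by positivity)]
      calc _ ≤ t ^ i * (A i * t ^ (s - i) * H) := by gcongr
        _ = A i * (t ^ i * t ^ (s - i)) * H := by ring
        _ = _ := by rw [← pow_add, Nat.add_sub_cancel' hi.le]
    -- The truncated recursion of `velSeries`: the expansion of the coefficient of degree $i$ stops
    -- at total degree $s-1$, that is, at words of length $s$.
    have hformal : ∑ i ∈ Finset.range s, t ^ i *
          pair h₁ (PowerSeries.coeff i (velSeries (σ ++ [(j, c)]))) =
        c * h₁ [j] + ∑ i ∈ Finset.range s, t ^ i * ∑ n ∈ Finset.range (s - i), t ^ n *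
          pair h₁ (PowerSeries.coeff n (pexp (-c) (gen j)) *
            PowerSeries.coeff i (velSeries σ)) := by
      obtain ⟨r, rfl⟩ : ∃ r, s = r + 1 := ⟨s - 1, by omega⟩
      have h4 := sum_range_sum_antidiagonal (fun i n => t ^ i * (t ^ n *
        pair h₁ (PowerSeries.coeff n (pexp (-c) (gen j)) *
          PowerSeries.coeff i (velSeries σ)))) r
      have h5 : ∀ i ∈ Finset.range (r + 1), r + 1 - i = r - i + 1 := fun i hi => by
        have := Finset.mem_range.1 hi
        omega
      have h6 : ∑ i ∈ Finset.range (r + 1), t ^ i * ∑ n ∈ Finset.range (r + 1 - i), t ^ n *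
          pair h₁ (PowerSeries.coeff n (pexp (-c) (gen j)) *
            PowerSeries.coeff i (velSeries σ)) =
          ∑ i ∈ Finset.range (r + 1), ∑ n ∈ Finset.range (r - i + 1), t ^ i * (t ^ n *
            pair h₁ (PowerSeries.coeff n (pexp (-c) (gen j)) *
              PowerSeries.coeff i (velSeries σ))) :=
        Finset.sum_congr rfl fun i hi => by rw [h5 i hi, Finset.mul_sum]
      rw [h6, ← h4]
      have h7 : ∀ i, t ^ i * pair h₁ (PowerSeries.coeff i (velSeries (σ ++ [(j, c)]))) =
          (if i = 0 then c * h₁ [j] else 0) +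
          ∑ q ∈ Finset.HasAntidiagonal.antidiagonal i, t ^ q.2 * (t ^ q.1 *
            pair h₁ (PowerSeries.coeff q.1 (pexp (-c) (gen j)) *
              PowerSeries.coeff q.2 (velSeries σ))) := by
        intro i
        rw [velSeries_concat, map_add, map_add, PowerSeries.coeff_mul, map_sum, mul_add, add_comm,
          Finset.mul_sum]
        congr 1
        · rw [PowerSeries.coeff_C]
          split_ifs with hi
          · have : gen j = monom [j] := by rw [monom_cons, monom_nil, mul_one]
            rw [hi, map_smul, this, pair_monom]
            simp
          · simp
        · refine Finset.sum_congr rfl fun q hq => ?_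
          rw [Finset.HasAntidiagonal.mem_antidiagonal] at hq
          rw [← hq, pow_add]
          ring
      simp only [h7, Finset.sum_add_distrib]
      congr 1
      simp
    rw [hformal, map_add, map_smul, smul_eq_mul]
    have hcomm : h₁ [j] = ξ (f j y) := by simp [hh₁, commVec, expansion, coeff]
    rw [hcomm, add_sub_add_left_eq_sub]
    calc _ ≤ _ := abs_sub_le _ (∑ i ∈ Finset.range s, t ^ i *
            pair h₀ (PowerSeries.coeff i (velSeries σ))) _
      _ ≤ _ := add_le_add hmain hsum
      _ = _ := by ring

end Velocity

/-! ### The velocity in terms of commutators -/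

section Formula

variable {m : ℕ}

/-- The degree is determined by the word length, so one function $\alpha$ on words serves for all
degrees. -/
theorem exists_coeff_velSeries_eq (σ : List (Fin m × ℝ)) : ∃ α : List (Fin m) → ℝ, ∀ i,
    PowerSeries.coeff i (velSeries σ) = ∑ v ∈ words m (i + 1) (i + 1), α v • monom v := by
  choose α hα using fun i => exists_sum_monom_of_mem_homog (coeff_velSeries_mem σ i)
  refine ⟨fun v => α (v.length - 1) v, fun i => (hα i).trans (Finset.sum_congr rfl fun v hv => ?_)⟩
  have := mem_words.1 hv
  simp only [show v.length - 1 = i by omega]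

theorem sum_words_eq {V : Type*} [AddCommMonoid V] (k s : ℕ) (F : List (Fin m) → V) :
    ∑ v ∈ words m (k + 1) s, F v =
      ∑ i ∈ Finset.Ico k s, ∑ v ∈ words m (i + 1) (i + 1), F v := by
  rw [← Finset.sum_fiberwise_of_maps_to (s := words m (k + 1) s) (t := Finset.Ico k s)
    (g := fun v => v.length - 1)]
  · refine Finset.sum_congr rfl fun i hi => Finset.sum_congr ?_ fun _ _ => rfl
    rw [Finset.mem_Ico] at hi
    ext v
    rw [Finset.mem_filter, mem_words, mem_words]
    omega
  · intro v hv
    rw [mem_words] at hv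
    rw [Finset.mem_Ico]
    omega

variable {E : Type*} [NormedAddCommGroup E] [NormedSpace ℝ E]

/-- Degrees below $\ell$ are evaluated through `nest`, where they cancel or add up to the multiple
of $f_w$. From degree $\ell$ on the coefficients are kept as they are. -/
theorem sum_pair_coeff_velSeries {s : ℕ} {w : List (Fin m)} (hw : 1 ≤ w.length)
    (hws : w.length ≤ s) {σ : List (Fin m × ℝ)} {ε : ℝ} {Y : PowerSeries (FreeAlgebra ℝ (Fin m))}
    (hY : flowSeries σ = 1 + PowerSeries.X ^ w.length * Y)
    (hY0 : PowerSeries.constantCoeff Y = ε • nestedBracket gen w) {α : List (Fin m) → ℝ}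
    (hα : ∀ i, PowerSeries.coeff i (velSeries σ) =
      ∑ v ∈ words m (i + 1) (i + 1), α v • monom v) (f : Fin m → E → E) (t : ℝ) (z : E) :
    ∑ i ∈ Finset.range s, t ^ i • pair (fun v => commVec f v z)
        (PowerSeries.coeff i (velSeries σ)) =
      (ε * (w.length * t ^ (w.length - 1))) • commVec f w z +
        ∑ v ∈ words m (w.length + 1) s, (α v * t ^ (v.length - 1)) • commVec f v z := by
  obtain ⟨h1, h2⟩ := nest_coeff_velSeries σ (by omega) hY
  rw [Finset.range_eq_Ico, ← Finset.sum_Ico_consecutive _ (Nat.zero_le w.length) hws,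
    sum_words_eq]
  congr 1
  · rw [← Finset.range_eq_Ico, Finset.sum_eq_single (w.length - 1)]
    · rw [← pair_nest_coeff, h2, hY0, map_smul, map_smul, pair_nestedBracket, ← commVec,
        smul_smul, smul_smul]
      congr 1
      ring
    · intro i hi hne
      rw [Finset.mem_range] at hi
      rw [← pair_nest_coeff, h1 i (by omega), map_zero, smul_zero]
    · intro h
      rw [Finset.mem_range] at h
      omega
  · refine Finset.sum_congr rfl fun i _ => ?_
    rw [hα, map_sum, Finset.smul_sum]
    refine Finset.sum_congr rfl fun v hv => ?_
    have := mem_words.1 hv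
    rw [map_smul, pair_monom, smul_smul, show v.length - 1 = i by omega, mul_comm]

variable [FiniteDimensional ℝ E]

/-- The velocity of a composition of flows whose formal series starts with a nested commutator. -/
theorem exists_velocity_formula {s : ℕ} {C₀ : ℝ} (hC₀ : 1 ≤ C₀) (T : ℝ) {N : ℕ}
    (hN : ∀ w : List (Fin m), w.length < s → (cSteps w 1).length ≤ N) {w : List (Fin m)}
    (hw : 1 ≤ w.length) (hws : w.length ≤ s) {σ : List (Fin m × ℝ)} (hσ : ∀ p ∈ σ, |p.2| = 1)
    {ε : ℝ} {Y : PowerSeries (FreeAlgebra ℝ (Fin m))}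
    (hY : flowSeries σ = 1 + PowerSeries.X ^ w.length * Y)
    (hY0 : PowerSeries.constantCoeff Y = ε • nestedBracket gen w) {α : List (Fin m) → ℝ}
    (hα : ∀ i, PowerSeries.coeff i (velSeries σ) =
      ∑ v ∈ words m (i + 1) (i + 1), α v • monom v) :
    ∃ B, 0 ≤ B ∧ ∀ (f : Fin m → E → E) (Ω₀ : Set E) (t₀ : ℝ), (∀ j, ContDiff ℝ 1 (f j)) →
      (∀ j, HContDiffLip f (s - 1) (f j)) → Bornology.IsBounded Ω₀ → 0 < t₀ → t₀ ≤ T →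
      Involutive f s Ω₀ C₀ → ∀ x, Good f t₀ Ω₀ (N + 2 + σ.length) x → ∀ t ∈ Icc 0 t₀,
      ∃ b : List (Fin m) → ℝ, (∀ u, |b u| ≤ B) ∧
        HasDerivWithinAt (fun τ => run f (scaleSteps τ σ) x)
          ((ε * (w.length * t ^ (w.length - 1))) • commVec f w (run f (scaleSteps t σ) x) +
            ∑ v ∈ words m (w.length + 1) s,
              (α v * t ^ (v.length - 1)) • commVec f v (run f (scaleSteps t σ) x) +
            t ^ s • ∑ u ∈ words m 1 s, b u • commVec f u (run f (scaleSteps t σ) x))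
          (Icc 0 t₀) t := by
  obtain ⟨B, hB, hest⟩ := exists_velocity_estimate (E := E) (hw.trans hws) hC₀ T hN σ hσ
  refine ⟨B, hB, fun f Ω₀ t₀ hf hH hb ht₀ htT hI x hx t ht => ?_⟩
  obtain ⟨D, hD, hξ⟩ := hest f Ω₀ t₀ hf hH hb ht₀ htT hI x hx t ht
  set z := run f (scaleSteps t σ) x with hz
  have hsum := sum_pair_coeff_velSeries hw hws hY hY0 hα f t z
  set M := ∑ i ∈ Finset.range s, t ^ i • pair (fun v => commVec f v z)
        (PowerSeries.coeff i (velSeries σ)) with hM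
  have hts : 0 ≤ t ^ s := pow_nonneg ht.1 s
  obtain ⟨c, hc, hDM⟩ := exists_sum_eq_of_forall_dual (words m 1 s) (fun u => commVec f u z)
    (D - M) (mul_nonneg hB hts) fun ξ => by
      have h := hξ ξ
      have h1 : ∀ i, pair (fun v => ξ (commVec f v z)) (PowerSeries.coeff i (velSeries σ)) =
          ξ (pair (fun v => commVec f v z) (PowerSeries.coeff i (velSeries σ))) := fun i =>
        pair_comp ξ.toLinearMap _ _
      simp only [h1] at h
      rw [map_sub, hM, map_sum]
      simpa only [map_smul, smul_eq_mul] using h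
  -- At $t=0$ the quotient is $0$ by convention; this is harmless, as the bound on $c_u$ then forces
  -- $c_u=0$.
  refine ⟨fun u => c u / t ^ s, fun u => ?_, hD.congr_deriv ?_⟩
  · rw [abs_div, abs_of_nonneg hts]
    exact div_le_of_le_mul₀ hts hB (hc u)
  · rw [← hsum, ← sub_eq_iff_eq_add', hDM, Finset.smul_sum]
    refine Finset.sum_congr rfl fun u _ => ?_
    rw [smul_smul]
    congr 1
    rcases eq_or_ne (t ^ s) 0 with h0 | h0
    · have := hc u
      rw [h0, mul_zero] at this
      simp [abs_nonpos_iff.1 this]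
    · exact (mul_div_cancel₀ _ h0).symm

end Formula

end HorizontalFields

end

/-! ### Conclusion: the theorem -/

theorem mainTheorem3 (m s : ℕ) [NeZero s] :
    -- the algebraic coefficients: universal numbers, depending on the word `w` only
    ∃ a a' : List (Fin m) → List (Fin m) → ℝ,
    ∀ n : ℕ, ∃ N₀ : ℕ, ∀ L C₀ T : ℝ, ∃ B : ℝ,
    ∀ (f : Fin m → EuclideanSpace ℝ (Fin n) → EuclideanSpace ℝ (Fin n)) (q : ℕ)
      (Y : Fin q ≃ {w : List (Fin m) // w ∈ words m 1 s}),
      ClassA s f Y →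
    ∀ Ω Ω₀ : Set (EuclideanSpace ℝ (Fin n)),
      IsOpen Ω₀ → Bornology.IsBounded Ω₀ → closure Ω ⊆ Ω₀ →
      lipConst f s Ω₀ ≤ ENNReal.ofReal L →
      1 < C₀ → Involutive f s Ω₀ C₀ →
    ∀ t₀ : ℝ, 0 < t₀ → t₀ ≤ T →
      -- all compositions of at most `N₀` flows, for times at most `t₀`, stay in `Ω₀`
      (∀ x ∈ Ω, ∀ σ : List (Fin m × ℝ), σ.length ≤ N₀ → (∀ p ∈ σ, |p.2| ≤ t₀) →
        RunDefined f σ x ∧ run f σ x ∈ Ω₀) →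
    ∀ w : List (Fin m), 1 ≤ w.length → w.length ≤ s →
      (∃ b b' : List (Fin m) → EuclideanSpace ℝ (Fin n) → ℝ → ℝ,
        (∀ u ∈ words m 1 s, ∀ x ∈ Ω, ∀ t ∈ Set.Icc 0 t₀, |b u x t| ≤ B ∧ |b' u x t| ≤ B) ∧
        ∀ ψ : EuclideanSpace ℝ (Fin n) → ℝ, ContDiff ℝ 1 ψ →
        ∀ x ∈ Ω, ∀ t ∈ Set.Icc 0 t₀,
          HasDerivWithinAt (fun τ => ψ (cMap f w τ x))
            (w.length * t ^ (w.length - 1) * commDeriv f w ψ (cMap f w t x) +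
              ∑ v ∈ words m (w.length + 1) s,
                a w v * t ^ (v.length - 1) * commDeriv f v ψ (cMap f w t x) +
              t ^ s * ∑ u ∈ words m 1 s, b u x t * commDeriv f u ψ (cMap f w t x))
            (Set.Icc 0 t₀) t ∧
          HasDerivWithinAt (fun τ => ψ (cMapInv f w τ x))
            (-(w.length * t ^ (w.length - 1) * commDeriv f w ψ (cMapInv f w t x)) +
              ∑ v ∈ words m (w.length + 1) s,
                a' w v * t ^ (v.length - 1) * commDeriv f v ψ (cMapInv f w t x) +
              t ^ s * ∑ u ∈ words m 1 s, b' u x t * commDeriv f u ψ (cMapInv f w t x))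
            (Set.Icc 0 t₀) t) ∧
      (w.length < s → ∀ x ∈ Ω,
        ∑ v ∈ words m (w.length + 1) (w.length + 1), (a w v + a' w v) • commVec f v x = 0) := by
  choose α hα using fun w : List (Fin m) => exists_coeff_velSeries_eq (cSteps w 1)
  choose α' hα' using fun w : List (Fin m) => exists_coeff_velSeries_eq (invSteps (cSteps w 1))
  refine ⟨α, α', fun n => ?_⟩
  set N := ∑ w ∈ words m 0 s, (cSteps w 1).length with hNdef
  have hN : ∀ w : List (Fin m), w.length ≤ s → (cSteps w 1).length ≤ N := fun w hw =>
    Finset.single_le_sum (f := fun w : List (Fin m) => (cSteps w 1).length)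
      (fun _ _ => Nat.zero_le _) (mem_words.2 ⟨Nat.zero_le _, hw⟩)
  -- One $N$ pays for the flows of $C_t$ or its inverse. The remaining $N+2$ leave room for the
  -- short commutators used in the transport argument.
  refine ⟨N + 2 + N, fun L C₀ T => ?_⟩
  by_cases hC : 1 < C₀
  swap
  · exact ⟨0, fun _ _ _ _ _ _ _ _ _ _ h => absurd h hC⟩
  have hB : ∀ w ∈ words m 1 s, ∃ B, 0 ≤ B ∧
      ∀ (f : Fin m → EuclideanSpace ℝ (Fin n) → EuclideanSpace ℝ (Fin n))
        (Ω₀ : Set (EuclideanSpace ℝ (Fin n))) (t₀ : ℝ), (∀ j, ContDiff ℝ 1 (f j)) →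
      (∀ j, HContDiffLip f (s - 1) (f j)) → Bornology.IsBounded Ω₀ → 0 < t₀ → t₀ ≤ T →
      Involutive f s Ω₀ C₀ → ∀ x, Good f t₀ Ω₀ (N + 2 + N) x → ∀ t ∈ Set.Icc 0 t₀,
      (∃ b : List (Fin m) → ℝ, (∀ u, |b u| ≤ B) ∧
        HasDerivWithinAt (fun τ => cMap f w τ x)
          ((1 * (w.length * t ^ (w.length - 1)) : ℝ) • commVec f w (cMap f w t x) +
            ∑ v ∈ words m (w.length + 1) s,
              (α w v * t ^ (v.length - 1)) • commVec f v (cMap f w t x) +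
            t ^ s • ∑ u ∈ words m 1 s, b u • commVec f u (cMap f w t x))
          (Set.Icc 0 t₀) t) ∧
      ∃ b : List (Fin m) → ℝ, (∀ u, |b u| ≤ B) ∧
        HasDerivWithinAt (fun τ => cMapInv f w τ x)
          ((-1 * (w.length * t ^ (w.length - 1)) : ℝ) • commVec f w (cMapInv f w t x) +
            ∑ v ∈ words m (w.length + 1) s,
              (α' w v * t ^ (v.length - 1)) • commVec f v (cMapInv f w t x) +
            t ^ s • ∑ u ∈ words m 1 s, b u • commVec f u (cMapInv f w t x))
          (Set.Icc 0 t₀) t := by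
    intro w hw
    rw [mem_words] at hw
    have hw0 : w ≠ [] := List.length_pos_iff.1 hw.1
    obtain ⟨Y, hY, hY0⟩ := exists_flowSeries_cSteps w hw0
    obtain ⟨Y', hY', hY0'⟩ := exists_flowSeries_invSteps_cSteps w hw0
    obtain ⟨B, hB, h⟩ := exists_velocity_formula (E := EuclideanSpace ℝ (Fin n)) hC.le T
      (fun v hv => hN v hv.le) hw.1 hw.2 (abs_of_mem_cSteps w) (ε := 1) hY (by rw [hY0, one_smul])
      (hα w)
    obtain ⟨B', hB', h'⟩ := exists_velocity_formula (E := EuclideanSpace ℝ (Fin n)) hC.le T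
      (fun v hv => hN v hv.le) hw.1 hw.2 (abs_of_mem_invSteps (abs_of_mem_cSteps w)) (ε := -1) hY'
      (by rw [hY0', neg_one_smul]) (hα' w)
    refine ⟨B + B', add_nonneg hB hB', fun f Ω₀ t₀ hf hH hb ht₀ htT hI x hx t ht => ⟨?_, ?_⟩⟩
    · obtain ⟨b, hb1, hb2⟩ := h f Ω₀ t₀ hf hH hb ht₀ htT hI x
        (hx.mono (by have := hN w hw.2; omega)) t ht
      refine ⟨b, fun u => (hb1 u).trans (by linarith), ?_⟩
      have hrun : ∀ τ, cMap f w τ x = run f (scaleSteps τ (cSteps w 1)) x := fun τ => by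
        rw [cMap, cSteps_eq_scaleSteps]
      simp only [hrun]
      exact hb2
    · obtain ⟨b, hb1, hb2⟩ := h' f Ω₀ t₀ hf hH hb ht₀ htT hI x
        (hx.mono (by have := hN w hw.2; rw [length_invSteps]; omega)) t ht
      refine ⟨b, fun u => (hb1 u).trans (by linarith), ?_⟩
      have hrun : ∀ τ, cMapInv f w τ x = run f (scaleSteps τ (invSteps (cSteps w 1))) x :=
        fun τ => by rw [cMapInv, cSteps_eq_scaleSteps, invSteps_scaleSteps]
      simp only [hrun]
      exact hb2
  choose! B hB0 hB using hB
  refine ⟨∑ w ∈ words m 1 s, B w, fun f q Y hA Ω Ω₀ _ hb _ _ _ hI t₀ ht₀ htT hgood w hw hws => ?_⟩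
  have hwm : w ∈ words m 1 s := mem_words.2 ⟨hw, hws⟩
  have hBw : B w ≤ ∑ w ∈ words m 1 s, B w := Finset.single_le_sum (f := B) hB0 hwm
  constructor
  -- The formula is chosen at the level of the velocity vector, before any $\psi$ enters; hence the
  -- coefficients do not depend on $\psi$. Off $\Omega\times[0,t_0]$ they are set to $0$.
  · have h := fun (x : EuclideanSpace ℝ (Fin n)) (t : ℝ) (hx : x ∈ Ω) (ht : t ∈ Set.Icc 0 t₀) =>
      hB w hwm f Ω₀ t₀ hA.contDiff hA.horizontal hb ht₀ htT hI x (hgood x hx) t ht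
    choose b hb1 using fun x t hx ht => (h x t hx ht).1
    choose b' hb1' using fun x t hx ht => (h x t hx ht).2
    classical
    refine ⟨fun u x t => if h : x ∈ Ω ∧ t ∈ Set.Icc 0 t₀ then b x t h.1 h.2 u else 0,
      fun u x t => if h : x ∈ Ω ∧ t ∈ Set.Icc 0 t₀ then b' x t h.1 h.2 u else 0,
      fun u _ x hx t ht => ?_, fun ψ hψ x hx t ht => ?_⟩
    · simp only [dif_pos (And.intro hx ht)]
      exact ⟨((hb1 x t hx ht).1 u).trans hBw, ((hb1' x t hx ht).1 u).trans hBw⟩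
    · have hd : ∀ z, HasFDerivAt ψ (fderiv ℝ ψ z) z := fun z =>
        ((hψ.differentiable one_ne_zero) z).hasFDerivAt
      simp only [dif_pos (And.intro hx ht)]
      constructor
      · refine ((hd _).comp_hasDerivWithinAt t (hb1 x t hx ht).2).congr_deriv ?_
        simp only [map_add, map_sum, map_smul, smul_eq_mul, commDeriv, one_mul]
      · refine ((hd _).comp_hasDerivWithinAt t (hb1' x t hx ht).2).congr_deriv ?_
        simp only [map_add, map_sum, map_smul, smul_eq_mul, commDeriv, neg_mul, one_mul]
  · intro _ x _
    -- The cancellation holds for the formal brackets of degree $\ell+1$ and is then evaluated at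
    -- $x$.
    have h := congrArg (pair fun v => coeff f v x)
      (nest_coeff_velSeries_add w (List.length_pos_iff.1 hw))
    rw [map_add, map_zero, pair_nest_coeff, pair_nest_coeff, hα w, hα' w, map_sum, map_sum,
      ← Finset.sum_add_distrib] at h
    simpa only [map_smul, pair_monom, ← add_smul] using h
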